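/- Let $A:\mathbb R\to\mathbb R$ be infinitely differentiable with $A^{(p)}\in L^1(\mathbb R)$ for all $p\ge 0$. For real $s$ let $A_s$ be the integral operator on $L^2(\mathbb R_+)$ with kernel $A(x+y+s)$, and $K_s=A_s^2$, with kernel $K_s(x,y)=\int_0^\infty A(x+r+s)A(y+r+s)\,dr$. Fix $s\in\mathbb R$ such that $A_s$ is Hilbert–Schmidt and $K_s\le I$. (a) If $K_t\le I$ for some $t<s$, then $I-K_s$ is invertible. (b) Assume that $I-K_s$ is invertible. Let $a_p(y)=A^{(p)}(y+s)$ on $\mathbb R_+$ and $w=A_s(I-K_s)^{-1}a_0$, so that $(I-K_s)^{-1}|\delta\rangle=|\delta\rangle+w$, where $\langle\delta|$ is evaluation at $0$. Put $$q_p=\langle\delta|A_s^{(p)}(I-K_s)^{-1}|\delta\rangle=A^{(p)}(s)+\langle a_p,w\rangle,\qquad u_p=\langle\delta|A_s(I-K_s)^{-1}A_s^{(p)}|\delta\rangle=\langle a_0,(I-K_s)^{-1}a_p\rangle,$$ where $A_s^{(p)}$ is the $p$-th derivative of $A_s$ in $s$. Let $\varphi=A_s(I-K_s)^{-1}|\delta\rangle$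 and $\psi=A_s\varphi$, regarded as functions on $\mathbb R$ by $\varphi(x)=A(x+s)+\int_0^\infty A(x+y+s)w(y)\,dy$ and $\psi(x)=\int_0^\infty A(x+y+s)\varphi(y)\,dy$. For $\zeta\in\mathbb C\setminus\mathbb R$ let $(D+i\zeta)^{-1}$ be the resolvent of the derivative on the line: $((D+i\zeta)^{-1}g)(x)$ equals $-\int_0^\infty g(x+t)e^{i\zeta t}dt$ if $\operatorname{Im}\zeta>0$ and $\int_{-\infty}^0 g(x+t)e^{i\zeta t}dt$ if $\operatorname{Im}\zeta<0$. Define for $z\in\mathbb C\setminus\mathbb R$ $$X(z)=I+\langle\delta|\begin{bmatrix}-(D-iz)^{-1}A_s & i(D+iz)^{-1}\\ -i(D-iz)^{-1} & -(D+iz)^{-1}A_s\end{bmatrix}A_s(I-K_s)^{-1}|\delta\rangle = I+\begin{bmatrix}-((D-iz)^{-1}\psi)(0) & i((D+iz)^{-1}\varphi)(0)\\ -i((D-iz)^{-1}\varphi)(0) & -((D+iz)^{-1}\psi)(0)\end{bmatrix}.$$ Let $r(z)=-i\int_{\mathbb R}e^{-izt}A(t)\,dt$ for $z\in\mathbb R$.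 Then: 1. $X$ solves the Riemann–Hilbert problem of the Zakharov–Shabat system with reflection coefficient $r$. That is, $X$ is analytic on $\mathbb C\setminus\mathbb R$ and extends continuously to the closed upper and to the closed lower half-plane; for every $z\in\mathbb R$ the limits $X_\pm(z)=\lim_{\epsilon\downarrow0}X(z\pm i\epsilon)$ exist and satisfy $$X_+(z)=X_-(z)\begin{bmatrix}1-|r(z)|^2 & -\overline{r(z)}e^{-isz}\\ r(z)e^{isz} & 1\end{bmatrix};$$ and there are constant matrices $X_1,X_2$ with $X(z)=I+X_1z^{-1}+X_2z^{-2}+O(z^{-3})$ as $z\to\infty$ in $\mathbb C\setminus\mathbb R$. 2. For every $N\ge0$, $X(z)=I+\sum_{\ell=1}^{N}X_\ell z^{-\ell}+O(z^{-N-1})$ as $z\to\infty$ in $\mathbb C\setminus\mathbb R$, with $$X_{p+1}=\begin{bmatrix}(-i)^{p+1}u_p & i^pq_p\\ (-i)^pq_p & i^{p+1}u_p\end{bmatrix}\qquad(p\ge0).$$ 3. The Fredholm determinant $\operatorname{Det}(I-K_s)=\sum_{n\ge0}\frac{(-1)^n}{n!}\int_{\mathbb R_+^n}\det[K_s(x_i,x_j)]_{i,j=1}^n\,dx$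 generates these functions: it is positive, $\partial_s\log\operatorname{Det}(I-K_s)=u_0$, and for all $p\ge0$, $\partial_sq_p=q_{p+1}-q_0u_p$ and $\partial_su_p=-q_0q_p$. -/

import Mathlib

open MeasureTheory Set Filter Topology Asymptotics

/-! ### Square-integrable functions on the half-line and integral operators -/

/-- Lebesgue measure on the half-line `(0, ∞)`. -/
noncomputable abbrev halfLine : Measure ℝ := volume.restrict (Ioi (0 : ℝ))

/-- The real Hilbert space `L²(ℝ₊)`. -/
abbrev L2R : Type := Lp ℝ 2 halfLine

/-- The class in `L²(ℝ₊)` of a function that is square-integrable there (and `0` otherwise). -/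
noncomputable def toL2 (f : ℝ → ℝ) : L2R :=
  open Classical in if h : MemLp f 2 halfLine then h.toLp f else 0

/-- The kernel `k` is square-integrable on `ℝ₊ × ℝ₊`, that is, the integral operator on `L²(ℝ₊)`
with kernel `k` is a Hilbert–Schmidt operator. -/
def HilbertSchmidtKernel (k : ℝ → ℝ → ℝ) : Prop :=
  MemLp (fun p : ℝ × ℝ => k p.1 p.2) 2 (halfLine.prod halfLine)

lemma HilbertSchmidtKernel.ae_memLp {k : ℝ → ℝ → ℝ} (hk : HilbertSchmidtKernel k) :
    ∀ᵐ x ∂halfLine, MemLp (k x) 2 halfLine := by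
  have h1 := (memLp_two_iff_integrable_sq hk.1).1 hk
  filter_upwards [h1.prod_right_ae, hk.1.prodMk_left] with x hx hx'
  exact (memLp_two_iff_integrable_sq hx').2 hx

lemma HilbertSchmidtKernel.ae_sq_le {k : ℝ → ℝ → ℝ} (hk : HilbertSchmidtKernel k) (f : L2R) :
    ∀ᵐ x ∂halfLine, (∫ y, k x y * f y ∂halfLine) ^ 2 ≤
      (∫ y, (k x y) ^ 2 ∂halfLine) * ‖f‖ ^ 2 := by
  filter_upwards [hk.ae_memLp] with x hx
  have e1 : ∫ y, k x y * f y ∂halfLine = inner ℝ (hx.toLp (k x)) f := by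
    rw [L2.inner_def]
    refine integral_congr_ae ?_
    filter_upwards [hx.coeFn_toLp] with y hy
    rw [hy]; simp [mul_comm]
  have e2 : ∫ y, (k x y) ^ 2 ∂halfLine = ‖hx.toLp (k x)‖ ^ 2 := by
    rw [← real_inner_self_eq_norm_sq, L2.inner_def]
    refine integral_congr_ae ?_
    filter_upwards [hx.coeFn_toLp] with y hy
    rw [hy]; simp [pow_two]
  rw [e1, e2, ← mul_pow, ← sq_abs]
  exact pow_le_pow_left₀ (abs_nonneg _) (abs_real_inner_le_norm _ _) 2

lemma HilbertSchmidtKernel.memLp_apply {k : ℝ → ℝ → ℝ} (hk : HilbertSchmidtKernel k) (f : L2R) :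
    MemLp (fun x => ∫ y, k x y * f y ∂halfLine) 2 halfLine := by
  have hm : AEStronglyMeasurable (fun x => ∫ y, k x y * f y ∂halfLine) halfLine :=
    AEStronglyMeasurable.integral_prod_right'
      (f := fun p : ℝ × ℝ => k p.1 p.2 * f p.2) (hk.1.mul (Lp.aestronglyMeasurable f).comp_snd)
  refine (memLp_two_iff_integrable_sq hm).2 ?_
  have h1 := (memLp_two_iff_integrable_sq hk.1).1 hk
  refine (h1.integral_prod_left.mul_const (‖f‖ ^ 2)).mono' (hm.pow 2) ?_
  filter_upwards [hk.ae_sq_le f] with x hx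
  rw [Real.norm_eq_abs, abs_of_nonneg (sq_nonneg _)]
  exact hx

/-- The Hilbert–Schmidt operator `(T f)(x) = ∫_{ℝ₊} k(x, y) f(y) dy` on `L²(ℝ₊)`. -/
noncomputable def hilbertSchmidtOp (k : ℝ → ℝ → ℝ) (hk : HilbertSchmidtKernel k) :
    L2R →L[ℝ] L2R :=
  LinearMap.mkContinuous
    { toFun := fun f => (hk.memLp_apply f).toLp _
      map_add' := by
        intro f g
        rw [← MemLp.toLp_add]
        refine MemLp.toLp_congr _ _ ?_
        filter_upwards [hk.ae_memLp] with x hx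
        have hf : Integrable (fun y => k x y * f y) halfLine := hx.integrable_mul (Lp.memLp f)
        have hg : Integrable (fun y => k x y * g y) halfLine := hx.integrable_mul (Lp.memLp g)
        rw [Pi.add_apply, ← integral_add hf hg]
        refine integral_congr_ae ?_
        filter_upwards [Lp.coeFn_add f g] with y hy
        rw [hy, Pi.add_apply]; ring
      map_smul' := by
        intro c f
        rw [RingHom.id_apply, ← MemLp.toLp_const_smul]
        refine MemLp.toLp_congr _ _ (ae_of_all _ fun x => ?_)
        rw [Pi.smul_apply, smul_eq_mul, ← integral_const_mul]
        refine integral_congr_ae ?_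
        filter_upwards [Lp.coeFn_smul c f] with y hy
        rw [hy, Pi.smul_apply, smul_eq_mul]; ring }
    (Real.sqrt (∫ x, ∫ y, (k x y) ^ 2 ∂halfLine ∂halfLine)) (by
      intro f
      have h0 : 0 ≤ ∫ x, ∫ y, (k x y) ^ 2 ∂halfLine ∂halfLine :=
        integral_nonneg fun x => integral_nonneg fun y => sq_nonneg _
      have h1 := (memLp_two_iff_integrable_sq hk.1).1 hk
      refine abs_le_of_sq_le_sq' ?_ (by positivity) |>.2
      rw [mul_pow, Real.sq_sqrt h0]
      change ‖(hk.memLp_apply f).toLp _‖ ^ 2 ≤ _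
      rw [← real_inner_self_eq_norm_sq, L2.inner_def, ← integral_mul_const]
      refine integral_mono_ae (L2.integrable_inner _ _)
        (h1.integral_prod_left.mul_const (‖f‖ ^ 2)) ?_
      filter_upwards [hk.ae_sq_le f, (hk.memLp_apply f).coeFn_toLp] with x hx hy
      rw [hy]
      simpa [pow_two] using hx)

/-- The integral operator on `L²(ℝ₊)` with kernel `k`, for a Hilbert–Schmidt kernel `k`
(and `0` for all other kernels). -/
noncomputable def kernelOp (k : ℝ → ℝ → ℝ) : L2R →L[ℝ] L2R :=
  open Classical in if hk : HilbertSchmidtKernel k then hilbertSchmidtOp k hk else 0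

/-- The Fredholm determinant `Det(I - K)` on `L²(ℝ₊)` of the operator with kernel `K`,
`∑ₙ (-1)ⁿ / n! ∫_{ℝ₊ⁿ} det [K(xᵢ, xⱼ)] dx`; the term `n = 0` is `1`. -/
noncomputable def fredholmDet (K : ℝ → ℝ → ℝ) : ℝ :=
  ∑' n : ℕ, (-1 : ℝ) ^ n / (n.factorial : ℝ) *
    ∫ x in Set.pi univ (fun _ : Fin n => Ioi (0 : ℝ)),
      (Matrix.of fun i j : Fin n => K (x i) (x j)).det

/-! ### The operators `A_s`, `K_s` and the functions `q_p`, `u_p` -/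

/-- The additive kernel `A_s(x, y) = A(x + y + s)`. -/
def hankelKernel (A : ℝ → ℝ) (s x y : ℝ) : ℝ := A (x + y + s)

/-- The kernel `K_s(x, y) = ∫₀^∞ A(x + r + s) A(y + r + s) dr` of `A_s²`. -/
noncomputable def squareKernel (A : ℝ → ℝ) (s x y : ℝ) : ℝ :=
  ∫ r in Ioi (0 : ℝ), A (x + r + s) * A (y + r + s)

/-- The operator `A_s` on `L²(ℝ₊)`. -/
noncomputable def opA (A : ℝ → ℝ) (s : ℝ) : L2R →L[ℝ] L2R := kernelOp (hankelKernel A s)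

/-- The operator `K_s = A_s²` on `L²(ℝ₊)`. -/
noncomputable def opK (A : ℝ → ℝ) (s : ℝ) : L2R →L[ℝ] L2R := opA A s * opA A s

/-- The resolvent `(I - K_s)⁻¹` (and `0` if `I - K_s` is not invertible). -/
noncomputable def resolventK (A : ℝ → ℝ) (s : ℝ) : L2R →L[ℝ] L2R := Ring.inverse (1 - opK A s)

/-- `A_s^{(p)} |δ⟩`, the function `y ↦ ∂_s^p A(y + s)` in `L²(ℝ₊)`. -/
noncomputable def ketA (A : ℝ → ℝ) (p : ℕ) (s : ℝ) : L2R :=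
  toL2 fun y => iteratedDeriv p A (y + s)

/-- The regular part `w` of `(I - K_s)⁻¹ |δ⟩ = |δ⟩ + w`. Since
`(I - K_s)⁻¹ = I + A_s (I - K_s)⁻¹ A_s`, it is `w = A_s (I - K_s)⁻¹ A_s |δ⟩`. -/
noncomputable def regDelta (A : ℝ → ℝ) (s : ℝ) : L2R :=
  opA A s (resolventK A s (ketA A 0 s))

/-- `q_p = ⟨δ| A_s^{(p)} (I - K_s)⁻¹ |δ⟩ = ⟨δ| A_s^{(p)} (|δ⟩ + w)`, that is,
`∫_{ℝ₊} A^{(p)}(s + y) (I - K_s)⁻¹(y, 0) dy`. -/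
noncomputable def qFun (A : ℝ → ℝ) (p : ℕ) (s : ℝ) : ℝ :=
  iteratedDeriv p A s + inner ℝ (ketA A p s) (regDelta A s)

/-- `u_p = ⟨δ| A_s (I - K_s)⁻¹ A_s^{(p)} |δ⟩`, that is,
`∬ A(s + y) (I - K_s)⁻¹(y, z) A^{(p)}(z + s) dy dz`. -/
noncomputable def uFun (A : ℝ → ℝ) (p : ℕ) (s : ℝ) : ℝ :=
  inner ℝ (ketA A 0 s) (resolventK A s (ketA A p s))

/-! ### The resolvent of the derivative and the explicit formula -/

/-- The function `A_s (I - K_s)⁻¹ |δ⟩ = A_s (|δ⟩ + w)`. By the additive structure of the kernel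
`A_s(x, y) = A(x + y + s)` it is a function of `x ∈ ℝ`, not only of `x ∈ ℝ₊`. -/
noncomputable def phiFun (A : ℝ → ℝ) (s x : ℝ) : ℝ :=
  A (x + s) + ∫ y in Ioi (0 : ℝ), hankelKernel A s x y * regDelta A s y

/-- The function `A_s A_s (I - K_s)⁻¹ |δ⟩` of `x ∈ ℝ`. -/
noncomputable def psiFun (A : ℝ → ℝ) (s x : ℝ) : ℝ :=
  ∫ y in Ioi (0 : ℝ), hankelKernel A s x y * phiFun A s y

/-- The resolvent `(D + iζ)⁻¹ g` of the derivative operator on the line, for `ζ ∉ ℝ`: the solution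
`f` of `f' + iζ f = g` that is bounded on `ℝ` when `g` is. -/
noncomputable def derivResolvent (ζ : ℂ) (g : ℝ → ℝ) (x : ℝ) : ℂ :=
  if 0 < ζ.im then -∫ t in Ioi (0 : ℝ), (g (x + t) : ℂ) * Complex.exp (Complex.I * ζ * t)
  else ∫ t in Iio (0 : ℝ), (g (x + t) : ℂ) * Complex.exp (Complex.I * ζ * t)

/-- The explicit matrix function
`X(z) = I + ⟨δ| [[-(D-iz)⁻¹A_s, i(D+iz)⁻¹], [-i(D-iz)⁻¹, -(D+iz)⁻¹A_s]] A_s (I-K_s)⁻¹ |δ⟩`,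
where `⟨δ|` is evaluation at `0` and `D - iz = D + i(-z)`. -/
noncomputable def explicitX (A : ℝ → ℝ) (s : ℝ) (z : ℂ) : Matrix (Fin 2) (Fin 2) ℂ :=
  1 + !![-derivResolvent (-z) (psiFun A s) 0, Complex.I * derivResolvent z (phiFun A s) 0;
         -Complex.I * derivResolvent (-z) (phiFun A s) 0, -derivResolvent z (psiFun A s) 0]

/-! ### The Riemann–Hilbert problem -/

/-- The reflection coefficient `r(z) = -i ∫_ℝ e^{-izt} A(t) dt`. -/
noncomputable def reflection (A : ℝ → ℝ) (z : ℝ) : ℂ :=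
  -Complex.I * ∫ t : ℝ, Complex.exp (-Complex.I * z * t) * (A t : ℂ)

/-- The jump matrix `[[1 - |r(z)|², -r̄(z) e^{-isz}], [r(z) e^{isz}, 1]]`. -/
noncomputable def jumpMatrix (r : ℝ → ℂ) (s z : ℝ) : Matrix (Fin 2) (Fin 2) ℂ :=
  !![1 - ((‖r z‖ ^ 2 : ℝ) : ℂ), -(starRingEnd ℂ (r z)) * Complex.exp (-Complex.I * s * z);
     r z * Complex.exp (Complex.I * s * z), 1]

/-- `z → ∞` in `ℂ \ ℝ`. -/
noncomputable def atInfinityOffReal : Filter ℂ := Bornology.cobounded ℂ ⊓ 𝓟 {z : ℂ | z.im ≠ 0}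

/-- `X` solves the Riemann–Hilbert problem of the Zakharov–Shabat system with parameter `s` and
reflection coefficient `r`. -/
structure SolvesZakharovShabatRHP (r : ℝ → ℂ) (s : ℝ) (X : ℂ → Matrix (Fin 2) (Fin 2) ℂ) :
    Prop where
  analytic : ∀ i j, AnalyticOnNhd ℂ (fun z => X z i j) {z : ℂ | z.im ≠ 0}
  upper_extension : ∃ Y : ℂ → Matrix (Fin 2) (Fin 2) ℂ,
    ContinuousOn Y {z : ℂ | 0 ≤ z.im} ∧ EqOn Y X {z : ℂ | 0 < z.im}
  lower_extension : ∃ Y : ℂ → Matrix (Fin 2) (Fin 2) ℂ,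
    ContinuousOn Y {z : ℂ | z.im ≤ 0} ∧ EqOn Y X {z : ℂ | z.im < 0}
  jump : ∀ z : ℝ, ∃ Xplus Xminus : Matrix (Fin 2) (Fin 2) ℂ,
    Tendsto (fun ε : ℝ => X ((z : ℂ) + Complex.I * ε)) (𝓝[>] 0) (𝓝 Xplus) ∧
    Tendsto (fun ε : ℝ => X ((z : ℂ) - Complex.I * ε)) (𝓝[>] 0) (𝓝 Xminus) ∧
    Xplus = Xminus * jumpMatrix r s z
  normalization : ∃ X₁ X₂ : Matrix (Fin 2) (Fin 2) ℂ, ∀ i j,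
    (fun z => (X z - (1 + z⁻¹ • X₁ + (z⁻¹ ^ 2) • X₂)) i j) =O[atInfinityOffReal]
      fun z => z⁻¹ ^ 3

/-- `X(z) = ∑_{ℓ ≤ N} c_ℓ z^{-ℓ} + O(z^{-N-1})` for every `N`, as `z → ∞` in `ℂ \ ℝ`. -/
def HasLaurentExpansion (X : ℂ → Matrix (Fin 2) (Fin 2) ℂ)
    (c : ℕ → Matrix (Fin 2) (Fin 2) ℂ) : Prop :=
  ∀ N : ℕ, ∀ i j,
    (fun z => (X z - ∑ l ∈ Finset.range (N + 1), (z⁻¹ ^ l) • c l) i j) =O[atInfinityOffReal]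
      fun z => z⁻¹ ^ (N + 1)

/-- The coefficients `X_0 = I` and
`X_{p+1} = [[(-i)^{p+1} u_p, i^p q_p], [(-i)^p q_p, i^{p+1} u_p]]`. -/
noncomputable def laurentCoeff (A : ℝ → ℝ) (s : ℝ) : ℕ → Matrix (Fin 2) (Fin 2) ℂ
  | 0 => 1
  | p + 1 => !![(-Complex.I) ^ (p + 1) * (uFun A p s : ℂ), Complex.I ^ p * (qFun A p s : ℂ);
                (-Complex.I) ^ p * (qFun A p s : ℂ), Complex.I ^ (p + 1) * (uFun A p s : ℂ)]

/-! ### Vectors and operators on the half-line -/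

/-! Everything rests on the additivity of the kernel. Write v_x for the function y ↦ A(x+y) in
L²(ℝ₊), that is `ketA A 0 x`. Then (A_t f)(x) = ⟨v_{x+t}, f⟩ and ⟨A_t f, A_t g⟩ = ∫_t^∞ ⟨v_x,
f⟩⟨v_x, g⟩ dx (`inner_opA_opA`). The parameter enters only as the endpoint of integration, so ∂_s
K_s is the rank-one operator -|a_0⟩⟨a_0|.

Invertibility. K_s is compact, so if I - K_s is not invertible then K_s v = v for some v ≠ 0. From
‖A_t v‖ ≤ ‖v‖ = ‖A_s v‖ the formula above forces ⟨v_x, v⟩ = 0 on (t, s]. Thus A_t v is A_s v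
translated to the right, and more generally every right translate of v by a in [0, s - t] is fixed
by K_t. Such translates span an infinite-dimensional space (`eq_zero_of_forall_rightShift_mem`),
while the fixed space of the compact K_t is finite-dimensional.

Differential equations. Two identities suffice: A_s' A_s + A_s A_s' = -|a_0⟩⟨a_0|
(`derivOp_opA_add`) and A_s a_{p+1} = -A_s' a_p - A^{(p)}(s) a_0 (`opA_ketA_succ`). They give the
commutator of A_s' with the resolvent, then w' = -q_0 (I - K_s)⁻¹ a_0, and the equations for q_p and
u_p.

Riemann–Hilbert problem. On the half-line ψ = w, so φ = A_s(δ + ψ) and ψ = A_s φ. As the kernel is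
additive, the Fourier transforms of φ and ψ over the whole line are the transform of A times
one-sided transforms of δ + ψ and φ. Splitting the left sides at 0 gives boundary values of X from
the two sides, and the resulting linear relations are the jump condition. This needs w in L¹ and not
only in L² (`integrable_regDelta`). Integration by parts gives the expansion at infinity, with
coefficients φ^{(p)}(0) = q_p and ψ^{(p)}(0) = u_p.

Determinant. K_t(x, y) = ⟨v_{x+t}, v_{y+t}⟩ is a Gram kernel. Projecting the vectors to finitely
many elements of a Hilbert basis turns the Fredholm series into a matrix determinant, and Hadamard's
inequality dominates the limit. For the matrices the logarithmic derivative is a Galerkin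
approximation of u_0; invertibility and K_s ≤ I give ‖A_s‖ < 1, which makes all bounds uniform in
the projection, so the integrated identity passes to the limit. -/

lemma coeFn_toL2 {f : ℝ → ℝ} (h : MemLp f 2 halfLine) : toL2 f =ᵐ[halfLine] f := by
  rw [toL2, dif_pos h]; exact h.coeFn_toLp

lemma inner_eq_integral (f g : L2R) : inner ℝ f g = ∫ y in Ioi (0 : ℝ), f y * g y := by
  rw [L2.inner_def]
  exact integral_congr_ae (ae_of_all _ fun y => by simp [mul_comm])

lemma inner_toL2 {f : ℝ → ℝ} (h : MemLp f 2 halfLine) (g : L2R) :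
    inner ℝ (toL2 f) g = ∫ y in Ioi (0 : ℝ), f y * g y := by
  rw [inner_eq_integral]
  refine integral_congr_ae ?_
  filter_upwards [coeFn_toL2 h] with y hy
  rw [hy]

lemma inner_toL2_toL2 {f g : ℝ → ℝ} (hf : MemLp f 2 halfLine) (hg : MemLp g 2 halfLine) :
    inner ℝ (toL2 f) (toL2 g) = ∫ y in Ioi (0 : ℝ), f y * g y := by
  rw [inner_toL2 hf]
  refine integral_congr_ae ?_
  filter_upwards [coeFn_toL2 hg] with y hy
  rw [hy]

lemma norm_toL2_sq {f : ℝ → ℝ} (h : MemLp f 2 halfLine) :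
    ‖toL2 f‖ ^ 2 = ∫ y in Ioi (0 : ℝ), f y ^ 2 := by
  rw [← real_inner_self_eq_norm_sq, inner_toL2_toL2 h h]
  simp_rw [pow_two]

/-- Cauchy–Schwarz for the measure k dμ, obtained by splitting kF as k^{1/2} · k^{1/2}F. -/
lemma lintegral_mul_sq_le {α : Type*} [MeasurableSpace α] (μ : Measure α) {k F : α → ENNReal}
    (hk : AEMeasurable k μ) (hF : AEMeasurable F μ) :
    (∫⁻ y, k y * F y ∂μ) ^ 2 ≤ (∫⁻ y, k y ∂μ) * ∫⁻ y, k y * F y ^ 2 ∂μ := by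
  have e1 : ∀ a : ENNReal, (a ^ (1 / 2 : ℝ)) ^ (2 : ℝ) = a := fun a => by
    rw [← ENNReal.rpow_mul]; norm_num
  have e2 : ∀ a : ENNReal, a ^ (1 / 2 : ℝ) * a ^ (1 / 2 : ℝ) = a := fun a => by
    have := e1 a
    rw [show (2 : ℝ) = ((2 : ℕ) : ℝ) by norm_num, ENNReal.rpow_natCast, pow_two] at this
    simpa using this
  have h := ENNReal.lintegral_mul_le_Lp_mul_Lq μ Real.HolderConjugate.two_two
    (f := fun y => k y ^ (1 / 2 : ℝ)) (g := fun y => k y ^ (1 / 2 : ℝ) * F y)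
    (hk.pow_const _) ((hk.pow_const _).mul hF)
  have e3 : ∫⁻ y, ((fun y => k y ^ (1 / 2 : ℝ)) * fun y => k y ^ (1 / 2 : ℝ) * F y) y ∂μ
      = ∫⁻ y, k y * F y ∂μ := by
    refine lintegral_congr fun y => ?_
    simp only [Pi.mul_apply]
    rw [← mul_assoc, e2]
  have e4 : ∀ y, (k y ^ (1 / 2 : ℝ) * F y) ^ (2 : ℝ) = k y * F y ^ 2 := fun y => by
    rw [ENNReal.mul_rpow_of_nonneg _ _ (by norm_num), e1]
    congr 1
    rw [show (2 : ℝ) = ((2 : ℕ) : ℝ) by norm_num, ENNReal.rpow_natCast]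
  rw [e3] at h
  simp_rw [e1, e4] at h
  calc _ ≤ _ := pow_le_pow_left' h 2
    _ = _ := by rw [mul_pow, pow_two, pow_two, e2, e2]

/-- Schur's test for an additive kernel. -/
lemma lintegral_hankel_sq_le {k F : ℝ → ENNReal} (hk : Measurable k)
    (hF : AEMeasurable F halfLine) :
    ∫⁻ x in Ioi (0 : ℝ), (∫⁻ y in Ioi (0 : ℝ), k (x + y) * F y) ^ 2 ≤
      (∫⁻ t in Ioi (0 : ℝ), k t) ^ 2 * ∫⁻ y in Ioi (0 : ℝ), F y ^ 2 := by
  have h0 : ∀ x ∈ Ioi (0 : ℝ), ∫⁻ y in Ioi (0 : ℝ), k (x + y) ≤ ∫⁻ t in Ioi (0 : ℝ), k t := by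
    intro x hx
    have h1 := (measurePreserving_add_left volume x).setLIntegral_comp_preimage
      (s := Ioi x) measurableSet_Ioi hk
    have h2 : (fun y => x + y) ⁻¹' Ioi x = Ioi 0 := by ext y; simp
    rw [h2] at h1
    rw [h1]
    exact lintegral_mono_set (Ioi_subset_Ioi (le_of_lt hx))
  calc _ ≤ ∫⁻ x in Ioi (0 : ℝ), (∫⁻ t in Ioi (0 : ℝ), k t) *
        ∫⁻ y in Ioi (0 : ℝ), k (x + y) * F y ^ 2 := by
        refine setLIntegral_mono' measurableSet_Ioi fun x hx => ?_
        refine (lintegral_mul_sq_le _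
          (hk.comp (measurable_const_add x)).aemeasurable hF).trans ?_
        exact mul_le_mul' (h0 x hx) le_rfl
    _ ≤ (∫⁻ t in Ioi (0 : ℝ), k t) * ∫⁻ x in Ioi (0 : ℝ),
        ∫⁻ y in Ioi (0 : ℝ), k (x + y) * F y ^ 2 := by
        rw [lintegral_const_mul'']
        have : AEMeasurable (fun p : ℝ × ℝ => k (p.1 + p.2) * F p.2 ^ 2)
            (halfLine.prod halfLine) :=
          (hk.comp measurable_add).aemeasurable.mul (hF.comp_snd.pow_const 2)
        exact this.lintegral_prod_right'
    _ = (∫⁻ t in Ioi (0 : ℝ), k t) * ∫⁻ y in Ioi (0 : ℝ),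
        ∫⁻ x in Ioi (0 : ℝ), k (y + x) * F y ^ 2 := by
        rw [lintegral_lintegral_swap]
        · simp_rw [add_comm]
        · exact (hk.comp measurable_add).aemeasurable.mul (hF.comp_snd.pow_const 2)
    _ ≤ (∫⁻ t in Ioi (0 : ℝ), k t) * ∫⁻ y in Ioi (0 : ℝ),
        (∫⁻ t in Ioi (0 : ℝ), k t) * F y ^ 2 := by
        refine mul_le_mul' le_rfl (setLIntegral_mono' measurableSet_Ioi fun y hy => ?_)
        rw [lintegral_mul_const _ (by fun_prop)]
        exact mul_le_mul' (h0 y hy) le_rfl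
    _ = _ := by
        rw [lintegral_const_mul'' _ (hF.pow_const 2), pow_two, mul_assoc]

/-- A continuous function that is integrable and square-integrable on the line. -/
structure HankelSymbol (k : ℝ → ℝ) : Prop where
  continuous : Continuous k
  integrable : Integrable k
  memLp : MemLp k 2

namespace HankelSymbol

variable {k : ℝ → ℝ}

lemma comp_add_right (hk : HankelSymbol k) (t : ℝ) : HankelSymbol fun x => k (x + t) where
  continuous := hk.continuous.comp (by fun_prop)
  integrable := hk.integrable.comp_add_right t
  memLp := hk.memLp.comp_measurePreserving (measurePreserving_add_right volume t)

lemma memLp_shift (hk : HankelSymbol k) (t : ℝ) : MemLp (fun y => k (y + t)) 2 halfLine :=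
  (hk.comp_add_right t).memLp.restrict _

lemma sub (hk : HankelSymbol k) {l : ℝ → ℝ} (hl : HankelSymbol l) :
    HankelSymbol fun x => k x - l x where
  continuous := hk.continuous.sub hl.continuous
  integrable := hk.integrable.sub hl.integrable
  memLp := hk.memLp.sub hl.memLp

lemma const_mul (hk : HankelSymbol k) (c : ℝ) : HankelSymbol fun x => c * k x where
  continuous := continuous_const.mul hk.continuous
  integrable := hk.integrable.const_mul c
  memLp := hk.memLp.const_mul c

end HankelSymbol

/-- The class in `L²(ℝ₊)` of a translate of a function. -/
noncomputable def shiftVec (k : ℝ → ℝ) (t : ℝ) : L2R := toL2 fun y => k (y + t)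

lemma inner_shiftVec {k : ℝ → ℝ} (hk : HankelSymbol k) (t : ℝ) (f : L2R) :
    inner ℝ (shiftVec k t) f = ∫ y in Ioi (0 : ℝ), k (t + y) * f y := by
  rw [shiftVec, inner_toL2 (hk.memLp_shift t)]
  simp_rw [add_comm]

lemma eLpNorm_two_sq (f : ℝ → ℝ) (μ : Measure ℝ) :
    eLpNorm f 2 μ ^ 2 = ∫⁻ x, ‖f x‖ₑ ^ 2 ∂μ := by
  have := eLpNorm_nnreal_pow_eq_lintegral (f := f) (μ := μ) (p := 2) (by norm_num)
  simpa using this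

/-- Stated with extended norms, so that one estimate yields both membership in L² and the operator
bound. -/
lemma eLpNorm_hankel_le {k : ℝ → ℝ} (hk : HankelSymbol k) (f : L2R) :
    eLpNorm (fun x => inner ℝ (shiftVec k x) f) 2 halfLine ≤
      (∫⁻ t, ‖k t‖ₑ) * eLpNorm f 2 halfLine := by
  have h : ∫⁻ x in Ioi (0 : ℝ), ‖inner ℝ (shiftVec k x) f‖ₑ ^ 2 ≤
      (∫⁻ t, ‖k t‖ₑ) ^ 2 * ∫⁻ y in Ioi (0 : ℝ), ‖f y‖ₑ ^ 2 := by
    calc _ ≤ ∫⁻ x in Ioi (0 : ℝ), (∫⁻ y in Ioi (0 : ℝ), ‖k (x + y)‖ₑ * ‖f y‖ₑ) ^ 2 := by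
          refine lintegral_mono fun x => ?_
          simp only []
          rw [inner_shiftVec hk]
          gcongr
          refine (enorm_integral_le_lintegral_enorm _).trans (le_of_eq ?_)
          simp_rw [enorm_mul]
      _ ≤ (∫⁻ t in Ioi (0 : ℝ), ‖k t‖ₑ) ^ 2 * ∫⁻ y in Ioi (0 : ℝ), ‖f y‖ₑ ^ 2 :=
          lintegral_hankel_sq_le (k := fun t => ‖k t‖ₑ) hk.continuous.measurable.enorm
            (Lp.aestronglyMeasurable f).enorm
      _ ≤ _ := by
          gcongr
          exact Measure.restrict_le_self
  rw [← eLpNorm_two_sq, ← eLpNorm_two_sq, ← mul_pow] at h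
  exact (ENNReal.pow_le_pow_left_iff (by norm_num)).1 h

lemma aestronglyMeasurable_hankel {k : ℝ → ℝ} (hk : HankelSymbol k) (f : L2R) :
    AEStronglyMeasurable (fun x => inner ℝ (shiftVec k x) f) halfLine := by
  simp_rw [inner_shiftVec hk]
  refine AEStronglyMeasurable.integral_prod_right'
      (f := fun p : ℝ × ℝ => k (p.1 + p.2) * f p.2) ?_
  exact (hk.continuous.comp continuous_add).aestronglyMeasurable.mul
    (Lp.aestronglyMeasurable f).comp_snd

lemma lintegral_enorm_ne_top {k : ℝ → ℝ} (hk : HankelSymbol k) : ∫⁻ t, ‖k t‖ₑ ≠ ⊤ :=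
  hk.integrable.2.ne

lemma memLp_hankel {k : ℝ → ℝ} (hk : HankelSymbol k) (f : L2R) :
    MemLp (fun x => inner ℝ (shiftVec k x) f) 2 halfLine :=
  ⟨aestronglyMeasurable_hankel hk f, (eLpNorm_hankel_le hk f).trans_lt
    (ENNReal.mul_lt_top (lintegral_enorm_ne_top hk).lt_top (Lp.memLp f).2)⟩

/-- An operator on `L²(ℝ₊)` given by an additive kernel is bounded by the `L¹` norm. -/
lemma norm_le_of_ae_eq_hankel {k : ℝ → ℝ} (hk : HankelSymbol k) {f g : L2R}
    (h : g =ᵐ[halfLine] fun x => inner ℝ (shiftVec k x) f) :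
    ‖g‖ ≤ (∫ t, |k t|) * ‖f‖ := by
  have h1 : eLpNorm g 2 halfLine ≤ (∫⁻ t, ‖k t‖ₑ) * eLpNorm f 2 halfLine := by
    rw [eLpNorm_congr_ae h]; exact eLpNorm_hankel_le hk f
  rw [Lp.norm_def, Lp.norm_def]
  have h2 : ∫ t, |k t| = (∫⁻ t, ‖k t‖ₑ).toReal := by
    simp_rw [← Real.norm_eq_abs]
    exact integral_norm_eq_lintegral_enorm hk.integrable.1
  rw [h2, ← ENNReal.toReal_mul]
  exact ENNReal.toReal_mono
    (ENNReal.mul_ne_top (lintegral_enorm_ne_top hk) (Lp.memLp f).2.ne) h1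

/-- The bounded operator on `L²(ℝ₊)` with kernel `k (x + y)`. -/
noncomputable def hankelOp (k : ℝ → ℝ) (hk : HankelSymbol k) : L2R →L[ℝ] L2R :=
  LinearMap.mkContinuous
    { toFun := fun f => (memLp_hankel hk f).toLp _
      map_add' := fun f g => by
        rw [← MemLp.toLp_add]
        exact MemLp.toLp_congr _ _ (ae_of_all _ fun x => by simp [inner_add_right])
      map_smul' := fun c f => by
        rw [RingHom.id_apply, ← MemLp.toLp_const_smul]
        exact MemLp.toLp_congr _ _ (ae_of_all _ fun x => by simp [inner_smul_right]) }
    (∫ t, |k t|) (fun f => norm_le_of_ae_eq_hankel hk (memLp_hankel hk f).coeFn_toLp)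

lemma hankelOp_apply {k : ℝ → ℝ} (hk : HankelSymbol k) (f : L2R) :
    hankelOp k hk f =ᵐ[halfLine] fun x => inner ℝ (shiftVec k x) f :=
  (memLp_hankel hk f).coeFn_toLp

lemma shiftVec_comp_add (k : ℝ → ℝ) (t x : ℝ) :
    shiftVec (fun u => k (u + t)) x = shiftVec k (x + t) := by
  simp only [shiftVec, add_assoc]

lemma kernelOp_apply {k : ℝ → ℝ → ℝ} (hk : HilbertSchmidtKernel k) (f : L2R) :
    kernelOp k f =ᵐ[halfLine] fun x => ∫ y in Ioi (0 : ℝ), k x y * f y := by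
  rw [kernelOp, dif_pos hk]
  exact (hk.memLp_apply f).coeFn_toLp

lemma opA_apply {A : ℝ → ℝ} (hA : HankelSymbol A) {t : ℝ}
    (hk : HilbertSchmidtKernel (hankelKernel A t)) (f : L2R) :
    opA A t f =ᵐ[halfLine] fun x => inner ℝ (shiftVec A (x + t)) f := by
  filter_upwards [kernelOp_apply hk f] with x hx
  rw [opA, hx, inner_shiftVec hA]
  refine integral_congr_ae (ae_of_all _ fun y => ?_)
  simp only [hankelKernel]
  ring_nf

/-- A_s is thereby an operator controlled by Schur's test, on the same footing as A_s', for which no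
Hilbert–Schmidt property is assumed. -/
lemma opA_eq_hankelOp {A : ℝ → ℝ} (hA : HankelSymbol A) {t : ℝ}
    (hk : HilbertSchmidtKernel (hankelKernel A t)) :
    opA A t = hankelOp (fun x => A (x + t)) (hA.comp_add_right t) := by
  ext1 f
  refine Lp.ext ((opA_apply hA hk f).trans ?_)
  refine ((hankelOp_apply (hA.comp_add_right t) f).trans ?_).symm
  exact ae_of_all _ fun x => by simp only [shiftVec_comp_add]

lemma inner_hankelOp {k : ℝ → ℝ} (hk : HankelSymbol k) (f g : L2R) :
    inner ℝ (hankelOp k hk f) g =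
      ∫ x in Ioi (0 : ℝ), inner ℝ (shiftVec k x) f * g x := by
  rw [inner_eq_integral]
  refine integral_congr_ae ?_
  filter_upwards [hankelOp_apply hk f] with x hx
  rw [hx]

/-- The kernel k(x + y) is symmetric. Fubini is justified by Cauchy–Schwarz in x followed by Schur's
test applied to |k| and |f|. -/
lemma inner_hankelOp_left {k : ℝ → ℝ} (hk : HankelSymbol k) (f g : L2R) :
    inner ℝ (hankelOp k hk f) g = inner ℝ f (hankelOp k hk g) := by
  rw [inner_hankelOp, real_inner_comm, inner_hankelOp]
  simp_rw [inner_shiftVec hk, ← integral_mul_const]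
  rw [integral_integral_swap]
  · refine integral_congr_ae (ae_of_all _ fun x => ?_)
    refine integral_congr_ae (ae_of_all _ fun y => ?_)
    simp only [add_comm]
    ring
  · refine ⟨((hk.continuous.comp continuous_add).aestronglyMeasurable.mul
      (Lp.aestronglyMeasurable f).comp_snd).mul (Lp.aestronglyMeasurable g).comp_fst, ?_⟩
    have hm : AEMeasurable (fun p : ℝ × ℝ => ‖k (p.1 + p.2)‖ₑ * ‖f p.2‖ₑ)
        (halfLine.prod halfLine) :=
      ((hk.continuous.comp continuous_add).aestronglyMeasurable.enorm.mul
        (Lp.aestronglyMeasurable f).comp_snd.enorm)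
    rw [hasFiniteIntegral_iff_enorm, lintegral_prod]
    · have e : ∀ x, ∫⁻ y in Ioi (0 : ℝ), ‖k (x + y) * f y * g x‖ₑ =
          (∫⁻ y in Ioi (0 : ℝ), ‖k (x + y)‖ₑ * ‖f y‖ₑ) * ‖g x‖ₑ := fun x => by
        simp_rw [enorm_mul]
        rw [lintegral_mul_const'']
        exact (hk.continuous.comp (by fun_prop)).aestronglyMeasurable.enorm.mul
          (Lp.aestronglyMeasurable f).enorm
      simp only [Function.uncurry_apply_pair]
      simp_rw [e]
      refine (ENNReal.lintegral_mul_le_Lp_mul_Lq _ Real.HolderConjugate.two_two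
        hm.lintegral_prod_right' (Lp.aestronglyMeasurable g).enorm).trans_lt ?_
      simp only [show (2 : ℝ) = ((2 : ℕ) : ℝ) by norm_num, ENNReal.rpow_natCast]
      refine ENNReal.mul_lt_top (ENNReal.rpow_lt_top_of_nonneg (by norm_num) ?_)
        (ENNReal.rpow_lt_top_of_nonneg (by norm_num) ?_)
      · refine ((lintegral_hankel_sq_le (k := fun t => ‖k t‖ₑ)
          hk.continuous.measurable.enorm (Lp.aestronglyMeasurable f).enorm).trans_lt ?_).ne
        refine ENNReal.mul_lt_top (ENNReal.pow_lt_top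
          ((lintegral_mono' Measure.restrict_le_self le_rfl).trans_lt hk.integrable.2)) ?_
        rw [← eLpNorm_two_sq]
        exact ENNReal.pow_lt_top (Lp.memLp f).2
      · rw [← eLpNorm_two_sq]
        exact (ENNReal.pow_lt_top (Lp.memLp g).2).ne
    · exact (((hk.continuous.comp continuous_add).aestronglyMeasurable.mul
        (Lp.aestronglyMeasurable f).comp_snd).mul (Lp.aestronglyMeasurable g).comp_fst).enorm

/-! ### Smooth functions with integrable derivatives -/

/-- A smooth function all of whose derivatives are integrable. -/
structure SmoothIntegrable (A : ℝ → ℝ) : Prop where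
  smooth : ContDiff ℝ (⊤ : ℕ∞) A
  integrable : ∀ p : ℕ, Integrable (iteratedDeriv p A)

namespace SmoothIntegrable

variable {A : ℝ → ℝ} (hA : SmoothIntegrable A)
include hA

lemma hasDerivAt (p : ℕ) (x : ℝ) :
    HasDerivAt (iteratedDeriv p A) (iteratedDeriv (p + 1) A x) x := by
  rw [iteratedDeriv_succ]
  exact (hA.smooth.differentiable_iteratedDeriv p
    (WithTop.coe_lt_coe.2 (ENat.natCast_lt_top p)) x).hasDerivAt

lemma continuous (p : ℕ) : Continuous (iteratedDeriv p A) :=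
  continuous_iff_continuousAt.2 fun x => (hA.hasDerivAt p x).continuousAt

lemma tendsto_atTop (p : ℕ) : Tendsto (iteratedDeriv p A) atTop (𝓝 0) :=
  tendsto_zero_of_hasDerivAt_of_integrableOn_Ioi (a := 0) (fun x _ => hA.hasDerivAt p x)
    (hA.integrable (p + 1)).integrableOn (hA.integrable p).integrableOn

/-- A^{(p)}(x) = -∫_x^∞ A^{(p+1)}, because A^{(p)} and its derivative are integrable and so A^{(p)}
tends to 0. Bounded and integrable functions are square-integrable, which makes every derivative a
`HankelSymbol`. -/
lemma abs_le (p : ℕ) (x : ℝ) : |iteratedDeriv p A x| ≤ ∫ t, |iteratedDeriv (p + 1) A t| := by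
  have h := integral_Ioi_of_hasDerivAt_of_tendsto' (a := x) (fun x _ => hA.hasDerivAt p x)
    (hA.integrable (p + 1)).integrableOn (hA.tendsto_atTop p)
  rw [zero_sub] at h
  rw [← abs_neg, ← h]
  exact (abs_integral_le_integral_abs).trans
    (setIntegral_le_integral (hA.integrable (p + 1)).abs (ae_of_all _ fun _ => abs_nonneg _))

lemma hankelSymbol (p : ℕ) : HankelSymbol (iteratedDeriv p A) where
  continuous := hA.continuous p
  integrable := hA.integrable p
  memLp := by
    rw [memLp_two_iff_integrable_sq (hA.integrable p).1]
    simp_rw [pow_two]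
    exact (hA.integrable p).bdd_mul (hA.integrable p).1 (ae_of_all _ (hA.abs_le p))

lemma hankelSymbol_self : HankelSymbol A := by
  simpa only [iteratedDeriv_zero] using hA.hankelSymbol 0

end SmoothIntegrable

/-! ### Taylor remainders of translations and differentiability in s -/

lemma lintegral_enorm_sub_le {f f' : ℝ → ℝ} (hf : ∀ x, HasDerivAt f (f' x) x)
    (hc : Continuous f') (u : ℝ) :
    ∫⁻ x, ‖f (x + u) - f x‖ₑ ≤ ‖u‖ₑ * ∫⁻ x, ‖f' x‖ₑ := by
  have h1 : ∀ x, f (x + u) - f x = ∫ θ in Ioc (0 : ℝ) 1, u * f' (x + θ * u) := fun x => by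
    rw [← intervalIntegral.integral_of_le zero_le_one]
    rw [intervalIntegral.integral_eq_sub_of_hasDerivAt (f := fun θ => f (x + θ * u))]
    · simp
    · intro θ _
      have := (hf (x + θ * u)).comp θ (((hasDerivAt_id θ).mul_const u).const_add x)
      exact this.congr_deriv (by simp [mul_comm])
    · exact (by fun_prop : Continuous fun θ : ℝ => u * f' (x + θ * u)).intervalIntegrable _ _
  calc _ ≤ ∫⁻ x, ∫⁻ θ in Ioc (0 : ℝ) 1, ‖u * f' (x + θ * u)‖ₑ := by
        refine lintegral_mono fun x => ?_
        simp only [h1]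
        exact enorm_integral_le_lintegral_enorm _
    _ = ∫⁻ θ in Ioc (0 : ℝ) 1, ∫⁻ x, ‖u * f' (x + θ * u)‖ₑ := by
        refine lintegral_lintegral_swap ?_
        exact (by fun_prop :
          Continuous fun p : ℝ × ℝ => u * f' (p.1 + p.2 * u)).measurable.enorm.aemeasurable
    _ = ∫⁻ θ in Ioc (0 : ℝ) 1, ‖u‖ₑ * ∫⁻ x, ‖f' x‖ₑ := by
        refine lintegral_congr fun θ => ?_
        simp_rw [enorm_mul]
        rw [lintegral_const_mul _
          (by fun_prop : Continuous fun x => f' (x + θ * u)).measurable.enorm]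
        rw [lintegral_add_right_eq_self (fun x => ‖f' x‖ₑ)]
    _ = _ := by simp

/-- The remainder of the first order Taylor expansion of a translation. -/
noncomputable def taylorRem (f f' : ℝ → ℝ) (h x : ℝ) : ℝ := f (x + h) - f x - h * f' x

/-- The mean value inequality for u ↦ f(x+u) - u f'(x), whose derivative f'(x+u) - f'(x) is at most
M|h| between 0 and h. The factor 1/2 is not needed. -/
lemma abs_taylorRem_le {f f' f'' : ℝ → ℝ} (hf : ∀ x, HasDerivAt f (f' x) x)
    (hf' : ∀ x, HasDerivAt f' (f'' x) x) {M : ℝ} (hM : ∀ x, |f'' x| ≤ M) (h x : ℝ) :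
    |taylorRem f f' h x| ≤ M * h ^ 2 := by
  have hM0 : 0 ≤ M := (abs_nonneg _).trans (hM 0)
  have h2 : ∀ a b, |f' a - f' b| ≤ M * |a - b| := fun a b => by
    have := convex_univ.norm_image_sub_le_of_norm_hasDerivWithin_le
      (fun x _ => (hf' x).hasDerivWithinAt) (fun x _ => hM x) (mem_univ b) (mem_univ a)
    simpa using this
  have hd : ∀ u ∈ uIcc 0 h, HasDerivWithinAt (fun u => f (x + u) - u * f' x)
      (f' (x + u) - f' x) (uIcc 0 h) u := fun u _ => by
    have := ((hf (x + u)).comp u ((hasDerivAt_id u).const_add x)).sub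
      ((hasDerivAt_id u).mul_const (f' x))
    exact (this.congr_deriv (by simp)).hasDerivWithinAt
  have hb : ∀ u ∈ uIcc 0 h, ‖f' (x + u) - f' x‖ ≤ M * |h| := fun u hu => by
    refine (h2 _ _).trans (mul_le_mul_of_nonneg_left ?_ hM0)
    have := abs_sub_left_of_mem_uIcc hu
    simpa using this
  have := (convex_uIcc 0 h).norm_image_sub_le_of_norm_hasDerivWithin_le hd hb
    left_mem_uIcc right_mem_uIcc
  simp only [add_zero, zero_mul, sub_zero, Real.norm_eq_abs] at this
  rw [taylorRem, show f (x + h) - f x - h * f' x = f (x + h) - h * f' x - f x by ring]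
  refine this.trans (le_of_eq ?_)
  rw [mul_assoc, ← pow_two, sq_abs]

/-- The remainder is ∫₀¹ h (f'(x+θh) - f'(x)) dθ. Tonelli and the L¹ modulus of continuity of f'
bound it. This is the quantity that controls operator norms through Schur's test. -/
lemma integral_abs_taylorRem_le {f f' f'' : ℝ → ℝ} (hf : ∀ x, HasDerivAt f (f' x) x)
    (hf' : ∀ x, HasDerivAt f' (f'' x) x) (hc : Continuous f'') (hi : Integrable f'') (h : ℝ) :
    ∫ x, |taylorRem f f' h x| ≤ (∫ x, |f'' x|) * h ^ 2 := by
  have hcf' : Continuous f' := continuous_iff_continuousAt.2 fun x => (hf' x).continuousAt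
  have hcf : Continuous f := continuous_iff_continuousAt.2 fun x => (hf x).continuousAt
  have h1 : ∀ x, taylorRem f f' h x =
      ∫ θ in Ioc (0 : ℝ) 1, h * (f' (x + θ * h) - f' x) := fun x => by
    rw [← intervalIntegral.integral_of_le zero_le_one]
    rw [intervalIntegral.integral_eq_sub_of_hasDerivAt
      (f := fun θ => f (x + θ * h) - θ * (h * f' x))]
    · simp [taylorRem]; ring
    · intro θ _
      have := ((hf (x + θ * h)).comp θ (((hasDerivAt_id θ).mul_const h).const_add x)).sub
        ((hasDerivAt_id θ).mul_const (h * f' x))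
      refine this.congr_deriv ?_
      ring
    · exact (by fun_prop :
        Continuous fun θ : ℝ => h * (f' (x + θ * h) - f' x)).intervalIntegrable _ _
  have hm : Continuous (taylorRem f f' h) := by unfold taylorRem; fun_prop
  have h2 : ∫⁻ x, ‖taylorRem f f' h x‖ₑ ≤ ‖h‖ₑ ^ 2 * ∫⁻ x, ‖f'' x‖ₑ := by
    calc _ ≤ ∫⁻ x, ∫⁻ θ in Ioc (0 : ℝ) 1, ‖h * (f' (x + θ * h) - f' x)‖ₑ := by
          refine lintegral_mono fun x => ?_
          simp only [h1]
          exact enorm_integral_le_lintegral_enorm _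
      _ = ∫⁻ θ in Ioc (0 : ℝ) 1, ∫⁻ x, ‖h * (f' (x + θ * h) - f' x)‖ₑ := by
          refine lintegral_lintegral_swap ?_
          exact (by fun_prop : Continuous fun p : ℝ × ℝ =>
            h * (f' (p.1 + p.2 * h) - f' p.1)).measurable.enorm.aemeasurable
      _ ≤ ∫⁻ θ in Ioc (0 : ℝ) 1, ‖h‖ₑ * (‖h‖ₑ * ∫⁻ x, ‖f'' x‖ₑ) := by
          refine setLIntegral_mono' measurableSet_Ioc fun θ hθ => ?_
          simp_rw [enorm_mul]
          rw [lintegral_const_mul _ (by fun_prop)]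
          gcongr
          refine (lintegral_enorm_sub_le hf' hc (θ * h)).trans ?_
          gcongr
          rw [enorm_mul]
          refine mul_le_of_le_one_left (by positivity) ?_
          rw [Real.enorm_eq_ofReal hθ.1.le]
          simpa using hθ.2
      _ = _ := by simp [pow_two, mul_assoc]
  have e : ∀ g : ℝ → ℝ, Continuous g → ∫ x, |g x| = (∫⁻ x, ‖g x‖ₑ).toReal := fun g hg => by
    simp_rw [← Real.norm_eq_abs]
    exact integral_norm_eq_lintegral_enorm hg.aestronglyMeasurable
  rw [e _ hm, e _ hc]
  refine (ENNReal.toReal_mono (ENNReal.mul_ne_top (by simp) hi.2.ne) h2).trans (le_of_eq ?_)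
  rw [ENNReal.toReal_mul]
  simp [mul_comm]

lemma hasDerivAt_of_norm_sub_le_sq {E : Type*} [NormedAddCommGroup E] [NormedSpace ℝ E]
    {F : ℝ → E} {F' : E} {s C : ℝ}
    (h : ∀ t, ‖F t - F s - (t - s) • F'‖ ≤ C * (t - s) ^ 2) : HasDerivAt F F' s := by
  rw [hasDerivAt_iff_isLittleO]
  have h1 : (fun t => F t - F s - (t - s) • F') =O[𝓝 s] fun t => (t - s) ^ 2 :=
    IsBigO.of_bound C (Eventually.of_forall fun t => by simpa using h t)
  refine h1.trans_isLittleO ?_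
  have h2 : Tendsto (fun t : ℝ => t - s) (𝓝 s) (𝓝 0) := by
    have : Continuous fun t : ℝ => t - s := by fun_prop
    simpa using this.tendsto s
  exact (isLittleO_pow_id one_lt_two).comp_tendsto h2

namespace SmoothIntegrable

variable {A : ℝ → ℝ} (hA : SmoothIntegrable A)
include hA

lemma hankelSymbol_taylorRem (p : ℕ) (h : ℝ) :
    HankelSymbol (taylorRem (iteratedDeriv p A) (iteratedDeriv (p + 1) A) h) :=
  (((hA.hankelSymbol p).comp_add_right h).sub (hA.hankelSymbol p)).sub
    ((hA.hankelSymbol (p + 1)).const_mul h)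

omit hA in
lemma ketA_eq (p : ℕ) (t : ℝ) : ketA A p t = shiftVec (iteratedDeriv p A) t := rfl

/-- The point x = 0 serves the differentiation of the vector itself; general x gives the kernel of
the remainder A_t - A_s - (t-s) A_s'. -/
lemma inner_ketA_taylor (p : ℕ) (s t x : ℝ) (f : L2R) :
    inner ℝ (ketA A p (x + t) - ketA A p (x + s) - (t - s) • ketA A (p + 1) (x + s)) f =
      inner ℝ (shiftVec (fun u => taylorRem (iteratedDeriv p A) (iteratedDeriv (p + 1) A) (t - s)
        (u + s)) x) f := by
  have i : ∀ (q : ℕ) (r : ℝ), Integrable (fun y => iteratedDeriv q A (r + y) * f y) halfLine :=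
    fun q r => by
      have : Integrable (fun y => iteratedDeriv q A (y + r) * f y) halfLine :=
        ((hA.hankelSymbol q).memLp_shift r).integrable_mul (Lp.memLp f)
      simpa only [add_comm r] using this
  have i2 : Integrable (fun y => iteratedDeriv p A (x + t + y) * f y -
      iteratedDeriv p A (x + s + y) * f y) halfLine := (i _ _).sub (i _ _)
  rw [inner_sub_left, inner_sub_left, real_inner_smul_left, ketA_eq, ketA_eq, ketA_eq,
    inner_shiftVec (hA.hankelSymbol _), inner_shiftVec (hA.hankelSymbol _),
    inner_shiftVec (hA.hankelSymbol _),
    inner_shiftVec ((hA.hankelSymbol_taylorRem p (t - s)).comp_add_right s),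
    ← integral_const_mul, ← integral_sub (i _ _) (i _ _), ← integral_sub i2 ((i _ _).const_mul _)]
  refine integral_congr_ae (ae_of_all _ fun y => ?_)
  simp only [taylorRem]
  rw [show x + y + s + (t - s) = x + t + y by ring, show x + y + s = x + s + y by ring]
  ring

/-- The Taylor remainder r satisfies ‖r‖₂² ≤ ‖r‖_∞ ‖r‖₁, and both factors are O((t-s)²); hence ‖r‖₂
itself is O((t-s)²). -/
lemma hasDerivAt_ketA (p : ℕ) (s : ℝ) : HasDerivAt (ketA A p) (ketA A (p + 1) s) s := by
  set M := ∫ t, |iteratedDeriv (p + 2 + 1) A t|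
  set L := ∫ t, |iteratedDeriv (p + 2) A t|
  have hM : 0 ≤ M := integral_nonneg fun _ => abs_nonneg _
  have hL : 0 ≤ L := integral_nonneg fun _ => abs_nonneg _
  refine hasDerivAt_of_norm_sub_le_sq (C := Real.sqrt (M * L)) fun t => ?_
  set r := taylorRem (iteratedDeriv p A) (iteratedDeriv (p + 1) A) (t - s)
  have hr := hA.hankelSymbol_taylorRem p (t - s)
  have e : ketA A p t - ketA A p s - (t - s) • ketA A (p + 1) s = shiftVec r s := by
    refine ext_inner_right ℝ fun f => ?_
    have := hA.inner_ketA_taylor p s t 0 f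
    rw [shiftVec_comp_add, zero_add, zero_add] at this
    exact this
  have hb : ∀ x, |r x| ≤ M * (t - s) ^ 2 :=
    abs_taylorRem_le (hA.hasDerivAt p) (hA.hasDerivAt (p + 1)) (hA.abs_le (p + 2)) (t - s)
  rw [e]
  refine abs_le_of_sq_le_sq' ?_ (by positivity) |>.2
  rw [shiftVec, norm_toL2_sq (hr.memLp_shift s), mul_pow, Real.sq_sqrt (by positivity)]
  calc ∫ y in Ioi (0 : ℝ), r (y + s) ^ 2
      ≤ ∫ y in Ioi (0 : ℝ), M * (t - s) ^ 2 * |r (y + s)| := by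
        refine integral_mono ?_ ?_ fun y => ?_
        · exact (memLp_two_iff_integrable_sq (hr.memLp_shift s).1).1 (hr.memLp_shift s)
        · exact ((hr.comp_add_right s).integrable.abs.const_mul _).restrict
        · simp only [← sq_abs (r (y + s))]
          rw [pow_two]
          gcongr
          exact hb _
    _ ≤ ∫ y, M * (t - s) ^ 2 * |r (y + s)| := by
        refine setIntegral_le_integral ((hr.comp_add_right s).integrable.abs.const_mul _)
          (ae_of_all _ fun y => by positivity)
    _ = M * (t - s) ^ 2 * ∫ y, |r y| := by
        rw [integral_const_mul, integral_add_right_eq_self (fun y => |r y|)]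
    _ ≤ M * (t - s) ^ 2 * (L * (t - s) ^ 2) := by
        gcongr
        exact integral_abs_taylorRem_le (hA.hasDerivAt p) (hA.hasDerivAt (p + 1))
          (hA.continuous (p + 2)) (hA.integrable (p + 2)) (t - s)
    _ = _ := by ring

lemma continuous_ketA (p : ℕ) : Continuous (ketA A p) :=
  continuous_iff_continuousAt.2 fun s => (hA.hasDerivAt_ketA p s).continuousAt

lemma inner_ketA (p : ℕ) (t : ℝ) (f : L2R) :
    inner ℝ (ketA A p t) f = ∫ y in Ioi (0 : ℝ), iteratedDeriv p A (t + y) * f y :=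
  inner_shiftVec (hA.hankelSymbol p) t f

omit hA in
lemma shiftVec_eq_ketA (t : ℝ) : shiftVec A t = ketA A 0 t := by
  rw [ketA_eq, iteratedDeriv_zero]

lemma norm_ketA_zero_sq (t : ℝ) : ‖ketA A 0 t‖ ^ 2 = ∫ y in Ioi (0 : ℝ), A (y + t) ^ 2 := by
  rw [← shiftVec_eq_ketA, shiftVec, norm_toL2_sq (hA.hankelSymbol_self.memLp_shift t)]

/-- By Tonelli and a shift, the squared Hilbert–Schmidt norm of A_t is ∫_t^∞ ‖v_x‖² dx with v_x =
`ketA A 0 x`. As x ↦ v_x is continuous, finiteness does not depend on t. -/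
lemma hilbertSchmidt_iff (t : ℝ) : HilbertSchmidtKernel (hankelKernel A t) ↔
    IntegrableOn (fun x => ‖ketA A 0 x‖ ^ 2) (Ioi t) := by
  have hc : Continuous fun p : ℝ × ℝ => hankelKernel A t p.1 p.2 := by
    have := hA.hankelSymbol_self.continuous
    unfold hankelKernel
    fun_prop
  have e1 : ∀ x, ∫ y in Ioi (0 : ℝ), ‖hankelKernel A t x y ^ 2‖ = ‖ketA A 0 (x + t)‖ ^ 2 := by
    intro x
    rw [hA.norm_ketA_zero_sq]
    refine integral_congr_ae (ae_of_all _ fun y => ?_)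
    simp only [hankelKernel, norm_pow, Real.norm_eq_abs, sq_abs]
    ring_nf
  rw [HilbertSchmidtKernel, memLp_two_iff_integrable_sq hc.aestronglyMeasurable,
    integrable_prod_iff (f := fun p : ℝ × ℝ => hankelKernel A t p.1 p.2 ^ 2)
      (hc.pow 2).aestronglyMeasurable]
  simp_rw [e1]
  have h2 : Integrable (fun x => ‖ketA A 0 (x + t)‖ ^ 2) halfLine ↔
      IntegrableOn (fun x => ‖ketA A 0 x‖ ^ 2) (Ioi t) := by
    have := (measurePreserving_add_right volume t).integrableOn_comp_preimage
      (measurableEmbedding_addRight t) (f := fun x => ‖ketA A 0 x‖ ^ 2) (s := Ioi t)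
    rw [← this]
    have e : (fun x => x + t) ⁻¹' Ioi t = Ioi 0 := by ext x; simp
    rw [e]
    rfl
  rw [h2]
  refine and_iff_right (ae_of_all _ fun x => ?_)
  have := (memLp_two_iff_integrable_sq (hA.hankelSymbol_self.memLp_shift (x + t)).1).1
    (hA.hankelSymbol_self.memLp_shift (x + t))
  refine this.congr (ae_of_all _ fun y => ?_)
  simp only [hankelKernel]
  ring_nf

lemma hilbertSchmidt_of {s : ℝ} (h : HilbertSchmidtKernel (hankelKernel A s)) (t : ℝ) :
    HilbertSchmidtKernel (hankelKernel A t) := by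
  rw [hA.hilbertSchmidt_iff] at h ⊢
  have hc : Continuous fun x => ‖ketA A 0 x‖ ^ 2 := (hA.continuous_ketA 0).norm.pow 2
  refine ((hc.integrableOn_Icc (a := t) (b := s)).union h).mono_set fun x hx => ?_
  rcases le_or_gt x s with hs | hs
  · exact Or.inl ⟨le_of_lt hx, hs⟩
  · exact Or.inr hs

/-- The operator with kernel `A' (x + y + s)`. -/
noncomputable def derivOp (hA : SmoothIntegrable A) (s : ℝ) : L2R →L[ℝ] L2R :=
  hankelOp _ ((hA.hankelSymbol 1).comp_add_right s)

lemma derivOp_apply (s : ℝ) (f : L2R) :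
    hA.derivOp s f =ᵐ[halfLine] fun x => inner ℝ (ketA A 1 (x + s)) f := by
  refine (hankelOp_apply _ f).trans (ae_of_all _ fun x => ?_)
  simp only [shiftVec_comp_add]
  rfl

/-- The remainder is the Hankel operator whose symbol is the Taylor remainder of A, so its operator
norm is at most the L¹ norm of that remainder. -/
lemma hasDerivAt_opA (hHS : ∀ t, HilbertSchmidtKernel (hankelKernel A t)) (s : ℝ) :
    HasDerivAt (opA A) (hA.derivOp s) s := by
  refine hasDerivAt_of_norm_sub_le_sq (C := ∫ t, |iteratedDeriv 2 A t|) fun t => ?_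
  refine ContinuousLinearMap.opNorm_le_bound _ (by positivity) fun f => ?_
  have hr := (hA.hankelSymbol_taylorRem 0 (t - s)).comp_add_right s
  have key := norm_le_of_ae_eq_hankel hr (f := f)
    (g := (opA A t - opA A s - (t - s) • hA.derivOp s) f) ?_
  · refine key.trans (mul_le_mul_of_nonneg_right ?_ (norm_nonneg _))
    rw [integral_add_right_eq_self
      (fun x => |taylorRem (iteratedDeriv 0 A) (iteratedDeriv (0 + 1) A) (t - s) x|)]
    exact integral_abs_taylorRem_le (hA.hasDerivAt 0) (hA.hasDerivAt 1)
      (hA.continuous 2) (hA.integrable 2) (t - s)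
  · have e : (opA A t - opA A s - (t - s) • hA.derivOp s) f =
        opA A t f - opA A s f - (t - s) • hA.derivOp s f := by simp
    rw [e]
    filter_upwards [Lp.coeFn_sub (opA A t f - opA A s f) ((t - s) • hA.derivOp s f),
      Lp.coeFn_sub (opA A t f) (opA A s f), Lp.coeFn_smul (t - s) (hA.derivOp s f),
      opA_apply hA.hankelSymbol_self (hHS t) f, opA_apply hA.hankelSymbol_self (hHS s) f,
      hA.derivOp_apply s f] with x h1 h2 h3 h4 h5 h6
    rw [h1, Pi.sub_apply, h2, Pi.sub_apply, h3, Pi.smul_apply, h4, h5, h6,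
      ← hA.inner_ketA_taylor 0 s t x f, inner_sub_left, inner_sub_left, real_inner_smul_left,
      shiftVec_eq_ketA, shiftVec_eq_ketA, smul_eq_mul]

end SmoothIntegrable

/-! ### The differential equations for `q_p` and `u_p` -/

namespace SmoothIntegrable

variable {A : ℝ → ℝ} (hA : SmoothIntegrable A)
include hA

lemma inner_ketA_ketA (p q : ℕ) (a b : ℝ) : inner ℝ (ketA A p a) (ketA A q b) =
    ∫ y in Ioi (0 : ℝ), iteratedDeriv p A (y + a) * iteratedDeriv q A (y + b) :=
  inner_toL2_toL2 ((hA.hankelSymbol p).memLp_shift a) ((hA.hankelSymbol q).memLp_shift b)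

/-- Integration by parts on the half-line; the boundary term at infinity vanishes because the
product and its derivative are integrable. -/
lemma inner_ketA_succ_add (p q : ℕ) (a b : ℝ) :
    inner ℝ (ketA A (p + 1) a) (ketA A q b) + inner ℝ (ketA A p a) (ketA A (q + 1) b) =
      -(iteratedDeriv p A a * iteratedDeriv q A b) := by
  have i : ∀ p q, Integrable (fun y => iteratedDeriv p A (y + a) * iteratedDeriv q A (y + b))
      halfLine := fun p q =>
    ((hA.hankelSymbol p).memLp_shift a).integrable_mul ((hA.hankelSymbol q).memLp_shift b)
  have hd : ∀ x ∈ Ici (0 : ℝ),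
      HasDerivAt (fun y => iteratedDeriv p A (y + a) * iteratedDeriv q A (y + b))
      (iteratedDeriv (p + 1) A (x + a) * iteratedDeriv q A (x + b) +
        iteratedDeriv p A (x + a) * iteratedDeriv (q + 1) A (x + b)) x := fun x _ =>
    ((hA.hasDerivAt p (x + a)).comp_add_const x a).mul
      ((hA.hasDerivAt q (x + b)).comp_add_const x b)
  rw [hA.inner_ketA_ketA, hA.inner_ketA_ketA, ← integral_add (i _ _) (i _ _),
    integral_Ioi_of_hasDerivAt_of_tendsto' hd ((i _ _).add (i _ _))
      (m := 0)]
  · simp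
  · exact tendsto_zero_of_hasDerivAt_of_integrableOn_Ioi (a := 0)
      (fun x hx => hd x (mem_Ici.2 (le_of_lt hx))) ((i _ _).add (i _ _)) (i _ _)

lemma opA_apply_ae {t : ℝ} (h : HilbertSchmidtKernel (hankelKernel A t)) (f : L2R) :
    opA A t f =ᵐ[halfLine] fun x => inner ℝ (ketA A 0 (x + t)) f := by
  simpa only [shiftVec_eq_ketA] using opA_apply hA.hankelSymbol_self h f

lemma inner_opA_left {t : ℝ} (h : HilbertSchmidtKernel (hankelKernel A t)) (f g : L2R) :
    inner ℝ (opA A t f) g = inner ℝ f (opA A t g) := by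
  rw [opA_eq_hankelOp hA.hankelSymbol_self h, inner_hankelOp_left]

omit hA in
lemma integral_Ioi_zero_comp_add (g : ℝ → ℝ) (t : ℝ) :
    ∫ x in Ioi (0 : ℝ), g (x + t) = ∫ x in Ioi t, g x := by
  have := (measurePreserving_add_right volume t).setIntegral_preimage_emb
    (measurableEmbedding_addRight t) g (Ioi t)
  rw [← this]
  have e : (fun x => x + t) ⁻¹' Ioi t = Ioi 0 := by ext x; simp
  rw [e]

/-- The substitution x + t ↦ x leaves t only in the endpoint of integration. Both the rank-one
derivative of K_t and the rigidity argument for eigenvectors come from this. -/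
lemma inner_opA_opA {t : ℝ} (h : HilbertSchmidtKernel (hankelKernel A t)) (f g : L2R) :
    inner ℝ (opA A t f) (opA A t g) =
      ∫ x in Ioi t, inner ℝ (ketA A 0 x) f * inner ℝ (ketA A 0 x) g := by
  rw [← integral_Ioi_zero_comp_add (fun x => inner ℝ (ketA A 0 x) f * inner ℝ (ketA A 0 x) g),
    inner_eq_integral]
  refine integral_congr_ae ?_
  filter_upwards [hA.opA_apply_ae h f, hA.opA_apply_ae h g] with x h1 h2
  rw [h1, h2]

omit hA in
lemma hasDerivAt_integral_Ioi {g : ℝ → ℝ} (hg : Continuous g)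
    (hi : ∀ t, IntegrableOn g (Ioi t)) (s : ℝ) :
    HasDerivAt (fun t => ∫ x in Ioi t, g x) (-g s) s := by
  have e : ∀ t, ∫ x in Ioi t, g x = (∫ x in Ioi s, g x) - ∫ x in s..t, g x := fun t => by
    rw [← intervalIntegral.integral_Ioi_sub_Ioi' (hi s) (hi t)]; ring
  rw [funext e]
  exact (intervalIntegral.integral_hasDerivAt_right (hg.intervalIntegrable _ _)
    hg.stronglyMeasurable.stronglyMeasurableAtFilter hg.continuousAt).const_sub _

lemma integrableOn_inner_mul_inner {t : ℝ} (h : HilbertSchmidtKernel (hankelKernel A t))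
    (f g : L2R) :
    IntegrableOn (fun x => inner ℝ (ketA A 0 x) f * inner ℝ (ketA A 0 x) g) (Ioi t) := by
  have hc := hA.continuous_ketA 0
  refine (((hA.hilbertSchmidt_iff t).1 h).mul_const (‖f‖ * ‖g‖)).mono'
    (by fun_prop : Continuous fun x =>
      inner ℝ (ketA A 0 x) f * inner ℝ (ketA A 0 x) g).aestronglyMeasurable
    (ae_of_all _ fun x => ?_)
  rw [norm_mul, pow_two]
  calc _ ≤ (‖ketA A 0 x‖ * ‖f‖) * (‖ketA A 0 x‖ * ‖g‖) := by
        gcongr <;> exact norm_inner_le_norm _ _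
    _ = _ := by ring

variable (hHS : ∀ t, HilbertSchmidtKernel (hankelKernel A t))
include hHS

lemma hasDerivAt_inner_opA_opA (s : ℝ) (f g : L2R) :
    HasDerivAt (fun t => inner ℝ (opA A t f) (opA A t g))
      (-(inner ℝ (ketA A 0 s) f * inner ℝ (ketA A 0 s) g)) s := by
  simp_rw [fun t => hA.inner_opA_opA (hHS t) f g]
  have hc := hA.continuous_ketA 0
  exact hasDerivAt_integral_Ioi (by fun_prop)
    (fun t => hA.integrableOn_inner_mul_inner (hHS t) f g) s

omit hHS in
lemma inner_derivOp_left (s : ℝ) (f g : L2R) :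
    inner ℝ (hA.derivOp s f) g = inner ℝ f (hA.derivOp s g) :=
  inner_hankelOp_left _ f g

/-- Two computations of ∂_s⟨A_s g, A_s f⟩ are compared: the fundamental theorem of calculus in the
endpoint gives a rank-one form, the product rule gives the left side. -/
lemma derivOp_opA_add (s : ℝ) (f : L2R) :
    hA.derivOp s (opA A s f) + opA A s (hA.derivOp s f) =
      -(inner ℝ (ketA A 0 s) f • ketA A 0 s) := by
  refine ext_inner_left ℝ fun g => ?_
  have h1 := hA.hasDerivAt_inner_opA_opA hHS s g f
  have h2 := ((hA.hasDerivAt_opA hHS s).clm_apply (hasDerivAt_const s g)).inner ℝ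
    ((hA.hasDerivAt_opA hHS s).clm_apply (hasDerivAt_const s f))
  have h3 := h1.unique h2
  simp only [map_zero, add_zero] at h3
  rw [inner_add_right, inner_neg_right, inner_smul_right,
    ← hA.inner_derivOp_left s g (opA A s f), ← hA.inner_opA_left (hHS s) g,
    real_inner_comm (ketA A 0 s) g]
  linarith

/-- Integration by parts moves a derivative from the vector to the kernel; the boundary term at 0 is
a multiple of a_0. -/
lemma opA_ketA_succ (s : ℝ) (p : ℕ) :
    opA A s (ketA A (p + 1) s) =
      -hA.derivOp s (ketA A p s) - iteratedDeriv p A s • ketA A 0 s := by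
  refine Lp.ext ?_
  filter_upwards [Lp.coeFn_sub (-hA.derivOp s (ketA A p s)) (iteratedDeriv p A s • ketA A 0 s),
    Lp.coeFn_neg (hA.derivOp s (ketA A p s)), Lp.coeFn_smul (iteratedDeriv p A s) (ketA A 0 s),
    hA.opA_apply_ae (hHS s) (ketA A (p + 1) s), hA.derivOp_apply s (ketA A p s),
    coeFn_toL2 ((hA.hankelSymbol 0).memLp_shift s)] with x h1 h2 h3 h4 h5 h6
  rw [h1, Pi.sub_apply, h2, h3, Pi.neg_apply, Pi.smul_apply, h4, h5, smul_eq_mul]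
  have h7 : (ketA A 0 s) x = iteratedDeriv 0 A (x + s) := h6
  have := hA.inner_ketA_succ_add 0 p (x + s) s
  rw [zero_add] at this
  rw [h7]
  linarith

/-! ### Resolvent identities and the evolution in s -/

variable {s : ℝ} (hu : IsUnit (1 - opK A s))
include hu

omit hA hHS in
lemma sub_opK_resolventK (v : L2R) :
    resolventK A s v - opA A s (opA A s (resolventK A s v)) = v := by
  have h := DFunLike.congr_fun (Ring.mul_inverse_cancel _ hu) v
  simpa [resolventK, opK] using h

omit hA hHS in
lemma resolventK_sub_opK (v : L2R) :
    resolventK A s (v - opA A s (opA A s v)) = v := by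
  have h := DFunLike.congr_fun (Ring.inverse_mul_cancel _ hu) v
  simpa [resolventK, opK] using h

omit hA hHS in
lemma resolventK_opA (v : L2R) :
    resolventK A s (opA A s v) = opA A s (resolventK A s v) := by
  conv_lhs => rw [← sub_opK_resolventK hu v]
  have := resolventK_sub_opK hu (opA A s (resolventK A s v))
  rwa [← map_sub] at this

omit hA hHS in
lemma resolventK_eq (v : L2R) :
    resolventK A s v = v + opA A s (resolventK A s (opA A s v)) := by
  rw [resolventK_opA hu]
  exact sub_eq_iff_eq_add.1 (sub_opK_resolventK hu v)

lemma inner_resolventK_left (f g : L2R) :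
    inner ℝ (resolventK A s f) g = inner ℝ f (resolventK A s g) := by
  conv_lhs => rw [← sub_opK_resolventK hu g]
  conv_rhs => rw [← sub_opK_resolventK hu f]
  rw [inner_sub_right, inner_sub_left, hA.inner_opA_left (hHS s), hA.inner_opA_left (hHS s)]

omit hA hHS in
lemma regDelta_eq : regDelta A s = resolventK A s (opA A s (ketA A 0 s)) := by
  rw [resolventK_opA hu]; rfl

lemma inner_ketA_resolventK (v : L2R) :
    inner ℝ (ketA A 0 s) (resolventK A s v) =
      inner ℝ (resolventK A s (ketA A 0 s)) v :=
  (hA.inner_resolventK_left hHS hu _ _).symm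

lemma inner_regDelta (v : L2R) :
    inner ℝ (ketA A 0 s) (opA A s (resolventK A s v)) = inner ℝ (regDelta A s) v := by
  rw [← hA.inner_opA_left (hHS s), ← hA.inner_resolventK_left hHS hu, regDelta_eq hu]

lemma uFun_eq (p : ℕ) :
    uFun A p s = inner ℝ (resolventK A s (ketA A 0 s)) (ketA A p s) :=
  hA.inner_ketA_resolventK hHS hu _

omit hA hHS in
lemma opA_regDelta :
    opA A s (regDelta A s) = resolventK A s (ketA A 0 s) - ketA A 0 s := by
  conv_rhs => rw [resolventK_eq hu, resolventK_opA hu]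
  rw [regDelta, add_sub_cancel_left]

/-- The commutator of the derivative of `A_s` with the resolvent. -/
lemma derivOp_resolventK (v : L2R) :
    hA.derivOp s (resolventK A s v) = resolventK A s (hA.derivOp s v) +
      inner ℝ (resolventK A s (ketA A 0 s)) v • regDelta A s -
      inner ℝ (regDelta A s) v • resolventK A s (ketA A 0 s) := by
  set u := resolventK A s v with hu_def
  have hv : v = u - opA A s (opA A s u) := (sub_opK_resolventK hu v).symm
  have h1 := hA.derivOp_opA_add hHS s u
  have h2 := hA.derivOp_opA_add hHS s (opA A s u)
  have e1 : opA A s (hA.derivOp s u) =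
      -(inner ℝ (ketA A 0 s) u • ketA A 0 s) - hA.derivOp s (opA A s u) :=
    eq_sub_of_add_eq' h1
  have e2 : hA.derivOp s (opA A s (opA A s u)) =
      -(inner ℝ (ketA A 0 s) (opA A s u) • ketA A 0 s) - opA A s (hA.derivOp s (opA A s u)) :=
    eq_sub_of_add_eq h2
  -- A_s' anticommutes with A_s up to rank one. Passing it through both factors of A_s² restores the
  -- sign, and each passage leaves one rank-one term.
  have key : hA.derivOp s u - opA A s (opA A s (hA.derivOp s u)) = hA.derivOp s v +
      inner ℝ (ketA A 0 s) u • opA A s (ketA A 0 s) -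
      inner ℝ (ketA A 0 s) (opA A s u) • ketA A 0 s := by
    rw [e1]
    conv_rhs => rw [hv, map_sub, e2]
    rw [map_sub, map_neg, map_smul]
    abel
  have := congrArg (resolventK A s) key
  rw [resolventK_sub_opK hu, map_sub, map_add, map_smul, map_smul, ← regDelta_eq hu,
    hu_def, hA.inner_ketA_resolventK hHS hu, hA.inner_regDelta hHS hu] at this
  exact this

omit hu in
lemma hasDerivAt_opK : HasDerivAt (opK A) (hA.derivOp s * opA A s + opA A s * hA.derivOp s) s :=
  (hA.hasDerivAt_opA hHS s).mul (hA.hasDerivAt_opA hHS s)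

lemma hasDerivAt_resolventK : HasDerivAt (resolventK A)
    (resolventK A s * (hA.derivOp s * opA A s + opA A s * hA.derivOp s) * resolventK A s) s := by
  obtain ⟨x, hx⟩ := hu
  have h1 := hasFDerivAt_ringInverse (𝕜 := ℝ) x
  rw [hx] at h1
  have h2 := h1.comp_hasDerivAt s ((hA.hasDerivAt_opK hHS (s := s)).const_sub 1)
  have h3 : (↑x⁻¹ : L2R →L[ℝ] L2R) = resolventK A s := by
    rw [resolventK, ← hx, Ring.inverse_unit]
  refine h2.congr_deriv ?_
  simp only [neg_apply, ContinuousLinearMap.mulLeftRight_apply, h3]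
  noncomm_ring

/-- The derivative of the resolvent is R K_s' R with R = (I - K_s)⁻¹ and K_s' = -|a_0⟩⟨a_0|; the
scalar ⟨a_0, R a_p⟩ is u_p. -/
lemma hasDerivAt_resolventK_apply (p : ℕ) : HasDerivAt (fun t => resolventK A t (ketA A p t))
    (resolventK A s (ketA A (p + 1) s) -
      uFun A p s • resolventK A s (ketA A 0 s)) s := by
  refine ((hA.hasDerivAt_resolventK hHS hu).clm_apply (hA.hasDerivAt_ketA p s)).congr_deriv ?_
  have e : (resolventK A s * (hA.derivOp s * opA A s + opA A s * hA.derivOp s) *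
      resolventK A s) (ketA A p s) = resolventK A s
        (hA.derivOp s (opA A s (resolventK A s (ketA A p s))) +
          opA A s (hA.derivOp s (resolventK A s (ketA A p s)))) := rfl
  rw [e, hA.derivOp_opA_add hHS, map_neg, map_smul, uFun]
  abel

/-- With R = (I - K_s)⁻¹, w' = A_s' R a_0 + A_s R a_1 - u_0 w. The commutator rewrites A_s' R a_0,
integration by parts rewrites R A_s a_1, and the terms R A_s' a_0 and u_0 w cancel. The coefficient
left in front of R a_0 is -(A(s) + ⟨w, a_0⟩) = -q_0. -/
lemma hasDerivAt_regDelta : HasDerivAt (regDelta A)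
    (-(qFun A 0 s • resolventK A s (ketA A 0 s))) s := by
  refine ((hA.hasDerivAt_opA hHS s).clm_apply
    (hA.hasDerivAt_resolventK_apply hHS hu 0)).congr_deriv ?_
  rw [map_sub, map_smul, ← resolventK_opA hu, hA.opA_ketA_succ hHS, map_sub, map_neg, map_smul,
    hA.derivOp_resolventK hHS hu, hA.uFun_eq hHS hu, qFun, add_smul,
    real_inner_comm (regDelta A s) (ketA A 0 s)]
  simp only [regDelta]
  abel

lemma hasDerivAt_qFun (p : ℕ) :
    HasDerivAt (qFun A p) (qFun A (p + 1) s - qFun A 0 s * uFun A p s) s := by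
  refine ((hA.hasDerivAt p s).add ((hA.hasDerivAt_ketA p s).inner ℝ
    (hA.hasDerivAt_regDelta hHS hu))).congr_deriv ?_
  rw [inner_neg_right, inner_smul_right, hA.uFun_eq hHS hu,
    real_inner_comm (resolventK A s (ketA A 0 s)) (ketA A p s)]
  simp only [qFun]
  ring

lemma hasDerivAt_uFun (p : ℕ) :
    HasDerivAt (uFun A p) (-(qFun A 0 s * qFun A p s)) s := by
  refine ((hA.hasDerivAt_ketA 0 s).inner ℝ
    (hA.hasDerivAt_resolventK_apply hHS hu p)).congr_deriv ?_
  set a := ketA A 0 s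
  set ap := ketA A p s
  set f := resolventK A s a with hf
  set w := regDelta A s
  -- The two terms containing A_s' that arise from differentiating u_p combine into rank-one terms.
  have e1 : hA.derivOp s (resolventK A s (opA A s ap)) + opA A s (resolventK A s (hA.derivOp s ap))
      = inner ℝ w ap • w - inner ℝ f ap • f := by
    rw [hA.derivOp_resolventK hHS hu, ← resolventK_opA hu]
    have e2 : opA A s (hA.derivOp s ap) =
        -(inner ℝ a ap • a) - hA.derivOp s (opA A s ap) :=
      eq_sub_of_add_eq' (hA.derivOp_opA_add hHS s ap)
    have e3 : inner ℝ f (opA A s ap) = inner ℝ w ap := (hA.inner_opA_left (hHS s) _ _).symm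
    have e4 : inner ℝ w (opA A s ap) = inner ℝ f ap - inner ℝ a ap := by
      rw [← hA.inner_opA_left (hHS s), opA_regDelta hu, inner_sub_left]
    rw [e2, e3, e4, map_sub, map_neg, map_smul, sub_smul]
    simp only [hf]
    abel
  have e5 := congrArg (inner ℝ a) e1
  rw [inner_add_right, inner_sub_right, inner_smul_right, inner_smul_right,
    ← hA.inner_derivOp_left, ← hA.inner_opA_left (hHS s)] at e5
  -- The resolvent is expanded as I + A_s (I - K_s)⁻¹ A_s so that the highest derivative meets A_s
  -- and can be integrated by parts; likewise in `e7`.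
  have e6 : inner ℝ (ketA A (0 + 1) s) (resolventK A s ap) =
      inner ℝ (ketA A (0 + 1) s) ap - inner ℝ (hA.derivOp s a) (resolventK A s (opA A s ap))
        - A s * inner ℝ w ap := by
    rw [resolventK_eq hu, inner_add_right, ← hA.inner_opA_left (hHS s), hA.opA_ketA_succ hHS,
      inner_sub_left, inner_neg_left, real_inner_smul_left, iteratedDeriv_zero,
      resolventK_opA hu ap, hA.inner_regDelta hHS hu]
    ring
  have e7 : inner ℝ a (resolventK A s (ketA A (p + 1) s)) =
      inner ℝ a (ketA A (p + 1) s) - inner ℝ (opA A s a) (resolventK A s (hA.derivOp s ap))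
        - iteratedDeriv p A s * inner ℝ w a := by
    rw [resolventK_eq hu, inner_add_right, ← hA.inner_opA_left (hHS s), hA.opA_ketA_succ hHS,
      map_sub, map_neg, map_smul, inner_sub_right, inner_neg_right, inner_smul_right,
      hA.inner_opA_left (hHS s) a (resolventK A s a), hA.inner_regDelta hHS hu]
    ring
  have e8 := hA.inner_ketA_succ_add 0 p s s
  rw [iteratedDeriv_zero] at e8
  have e11 : uFun A p s = inner ℝ f ap := hA.uFun_eq hHS hu p
  rw [inner_sub_right, inner_smul_right, e11, qFun, qFun, e6, e7,
    iteratedDeriv_zero, real_inner_comm w ap, real_inner_comm w a]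
  have e10 : inner ℝ a w = inner ℝ w a := real_inner_comm _ _
  -- The terms u_0 u_p cancel, and the remaining four form the product -(A(s) + ⟨a_0, w⟩)(A^{(p)}(s)
  -- + ⟨a_p, w⟩).
  linear_combination e8 - e5 - inner ℝ w ap * e10

end SmoothIntegrable

/-! ### Integrability of the solutions of the Hankel equation -/

lemma lintegral_hankel_le {k F : ℝ → ENNReal} (hk : Measurable k)
    (hF : AEMeasurable F halfLine) :
    ∫⁻ x in Ioi (0 : ℝ), ∫⁻ y in Ioi (0 : ℝ), k (x + y) * F y ≤
      (∫⁻ t in Ioi (0 : ℝ), k t) * ∫⁻ y in Ioi (0 : ℝ), F y := by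
  rw [lintegral_lintegral_swap
    ((hk.comp measurable_add).aemeasurable.mul hF.comp_snd), ← lintegral_const_mul'' _ hF]
  refine setLIntegral_mono' measurableSet_Ioi fun y hy => ?_
  rw [lintegral_mul_const _ (by fun_prop)]
  refine mul_le_mul' ?_ le_rfl
  have h1 := (measurePreserving_add_right volume y).setLIntegral_comp_preimage
    (s := Ioi y) measurableSet_Ioi hk
  have h2 : (fun x => x + y) ⁻¹' Ioi y = Ioi 0 := by ext x; simp
  rw [h2] at h1
  rw [h1]
  exact lintegral_mono_set (Ioi_subset_Ioi (le_of_lt hy))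

lemma aemeasurable_hankel {k F : ℝ → ENNReal} (hk : Measurable k)
    (hF : AEMeasurable F halfLine) :
    AEMeasurable (fun x => ∫⁻ y in Ioi (0 : ℝ), k (x + y) * F y) halfLine := by
  have : AEMeasurable (fun p : ℝ × ℝ => k (p.1 + p.2) * F p.2) (halfLine.prod halfLine) :=
    (hk.comp measurable_add).aemeasurable.mul hF.comp_snd
  exact this.lintegral_prod_right'

/-- The inequality F ≤ b + HF is iterated, with H of norm at most 1/2 on both L¹ and L². The
accumulated part B stays below 2‖b‖₁ in L¹ and the error E shrinks like 2⁻ⁿ in L². One cannot simply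
absorb ‖HF‖₁ ≤ ‖F‖₁/2, since ‖F‖₁ is not yet known to be finite. -/
lemma exists_decomposition_of_le_add_hankel {k F b : ℝ → ENNReal} (hk : Measurable k)
    (hk2 : ∫⁻ t in Ioi (0 : ℝ), k t ≤ 2⁻¹) (hF : AEMeasurable F halfLine)
    (hb : AEMeasurable b halfLine)
    (h : ∀ᵐ x ∂halfLine, F x ≤ b x + ∫⁻ y in Ioi (0 : ℝ), k (x + y) * F y) (n : ℕ) :
    ∃ B E : ℝ → ENNReal, AEMeasurable B halfLine ∧ AEMeasurable E halfLine ∧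
      (∀ᵐ x ∂halfLine, F x ≤ B x + E x) ∧
      ∫⁻ x in Ioi (0 : ℝ), B x ≤ 2 * ∫⁻ x in Ioi (0 : ℝ), b x ∧
      ∫⁻ x in Ioi (0 : ℝ), E x ^ 2 ≤ (2⁻¹ ^ 2) ^ n * ∫⁻ x in Ioi (0 : ℝ), F x ^ 2 := by
  induction n with
  | zero =>
    refine ⟨0, F, aemeasurable_const, hF, ae_of_all _ fun x => ?_, ?_, ?_⟩ <;> simp
  | succ n ih =>
    obtain ⟨B, E, hB, hE, hle, h1, h2⟩ := ih
    refine ⟨fun x => b x + ∫⁻ y in Ioi (0 : ℝ), k (x + y) * B y,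
      fun x => ∫⁻ y in Ioi (0 : ℝ), k (x + y) * E y,
      hb.add (aemeasurable_hankel hk hB), aemeasurable_hankel hk hE, ?_, ?_, ?_⟩
    · filter_upwards [h] with x hx
      refine hx.trans ?_
      rw [add_assoc, ← lintegral_add_left' (f := fun y => k (x + y) * B y) ((by fun_prop :
        Measurable fun y => k (x + y)).aemeasurable.mul hB)]
      refine add_le_add le_rfl (lintegral_mono_ae ?_)
      filter_upwards [hle] with y hy
      rw [← mul_add]
      exact mul_le_mul' le_rfl hy
    · rw [lintegral_add_left' hb]
      calc _ ≤ (∫⁻ x in Ioi (0 : ℝ), b x) + 2⁻¹ * (2 * ∫⁻ x in Ioi (0 : ℝ), b x) := by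
            refine add_le_add le_rfl ((lintegral_hankel_le hk hB).trans (mul_le_mul' hk2 h1))
        _ = _ := by
            rw [← mul_assoc, ENNReal.inv_mul_cancel (by norm_num) (by norm_num), one_mul, two_mul]
    · refine (lintegral_hankel_sq_le hk hE).trans ?_
      rw [pow_succ' (2⁻¹ ^ 2), mul_assoc]
      exact mul_le_mul' (pow_le_pow_left' hk2 2) h2

/-- On (0, N] the L² error is also small in L¹, by Cauchy–Schwarz with constant N. The iteration
count goes to infinity first, then N. -/
lemma lintegral_le_of_le_add_hankel {k F b : ℝ → ENNReal} (hk : Measurable k)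
    (hk2 : ∫⁻ t in Ioi (0 : ℝ), k t ≤ 2⁻¹) (hF : AEMeasurable F halfLine)
    (hF2 : ∫⁻ x in Ioi (0 : ℝ), F x ^ 2 ≠ ⊤) (hb : AEMeasurable b halfLine)
    (h : ∀ᵐ x ∂halfLine, F x ≤ b x + ∫⁻ y in Ioi (0 : ℝ), k (x + y) * F y) :
    ∫⁻ x in Ioi (0 : ℝ), F x ≤ 2 * ∫⁻ x in Ioi (0 : ℝ), b x := by
  set Q := ∫⁻ x in Ioi (0 : ℝ), F x ^ 2
  have hN : ∀ N : ℕ, ∫⁻ x in Ioc (0 : ℝ) N, F x ≤ 2 * ∫⁻ x in Ioi (0 : ℝ), b x := by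
    intro N
    have hsub : Ioc (0 : ℝ) N ⊆ Ioi 0 := Ioc_subset_Ioi_self
    have hres : (volume.restrict (Ioc (0 : ℝ) N)) ≤ halfLine := Measure.restrict_mono hsub le_rfl
    have hn : ∀ n : ℕ, ∫⁻ x in Ioc (0 : ℝ) N, F x ≤
        2 * (∫⁻ x in Ioi (0 : ℝ), b x) + ((N : ENNReal) * ((2⁻¹ ^ 2) ^ n * Q)) ^ (2⁻¹ : ℝ) := by
      intro n
      obtain ⟨B, E, hB, hE, hle, h1, h2⟩ :=
        exists_decomposition_of_le_add_hankel hk hk2 hF hb h n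
      calc _ ≤ ∫⁻ x in Ioc (0 : ℝ) N, (B x + E x) :=
            lintegral_mono_ae (ae_mono hres hle)
        _ = (∫⁻ x in Ioc (0 : ℝ) N, B x) + ∫⁻ x in Ioc (0 : ℝ) N, E x :=
            lintegral_add_left' (hB.mono_measure hres) _
        _ ≤ _ := by
            refine add_le_add ((lintegral_mono_set hsub).trans h1) ?_
            have h3 := lintegral_mul_sq_le (volume.restrict (Ioc (0 : ℝ) N)) (k := fun _ => 1)
              aemeasurable_const (hE.mono_measure hres)
            simp only [one_mul, lintegral_const, Measure.restrict_apply_univ, Real.volume_Ioc,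
              sub_zero, ENNReal.ofReal_natCast] at h3
            have h4 : (∫⁻ x in Ioc (0 : ℝ) N, E x) ^ 2 ≤ N * ((2⁻¹ ^ 2) ^ n * Q) :=
              h3.trans (mul_le_mul' le_rfl ((lintegral_mono_set hsub).trans h2))
            rw [ENNReal.le_rpow_inv_iff (by norm_num)]
            simpa using h4
    refine ge_of_tendsto' (x := atTop) ?_ hn
    have h5 : Tendsto (fun n : ℕ => ((2⁻¹ : ENNReal) ^ 2) ^ n) atTop (𝓝 0) := by
      refine ENNReal.tendsto_pow_atTop_nhds_zero_of_lt_one ?_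
      rw [pow_two, ← ENNReal.mul_inv (by norm_num) (by norm_num)]
      norm_num
    have h6 : Tendsto (fun n : ℕ => ((N : ENNReal) * ((2⁻¹ ^ 2) ^ n * Q)) ^ (2⁻¹ : ℝ)) atTop
        (𝓝 (((N : ENNReal) * (0 * Q)) ^ (2⁻¹ : ℝ))) := by
      refine (ENNReal.continuous_rpow_const.tendsto _).comp ?_
      exact ENNReal.Tendsto.const_mul (ENNReal.Tendsto.mul_const h5 (Or.inr hF2))
        (Or.inr (ENNReal.natCast_ne_top N))
    have h7 := h6.const_add (2 * ∫⁻ x in Ioi (0 : ℝ), b x)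
    simpa using h7
  have hU : Ioi (0 : ℝ) = ⋃ N : ℕ, Ioc (0 : ℝ) N := by
    ext x
    simp only [mem_Ioi, mem_iUnion, mem_Ioc, exists_and_left]
    exact ⟨fun hx => ⟨hx, exists_nat_ge x⟩, fun hx => hx.1⟩
  conv_lhs => rw [hU]
  rw [setLIntegral_iUnion_of_directed]
  · exact iSup_le hN
  · exact (monotone_nat_of_le_succ fun n => Ioc_subset_Ioc_right
      (by exact_mod_cast Nat.le_succ n)).directed_le

/-- A square-integrable solution `g` of `g = a + H g`, for a Hankel operator `H` with integrable
symbol and integrable `a`, is integrable. -/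
lemma integrable_of_eq_add_hankel {k a : ℝ → ℝ} (hk : HankelSymbol k)
    (ha : Integrable a halfLine) {g : L2R}
    (h : g =ᵐ[halfLine] fun x => a x + inner ℝ (shiftVec k x) g) : Integrable g halfLine := by
  have hkm : Measurable fun t => ‖k t‖ₑ := hk.continuous.measurable.enorm
  have hgm : AEMeasurable (fun y => ‖g y‖ₑ) halfLine := (Lp.aestronglyMeasurable g).enorm
  obtain ⟨T, hT⟩ : ∃ T : ℝ, ∫⁻ t in Ioi T, ‖k t‖ₑ ≤ 2⁻¹ := by
    have h1 : Tendsto (fun n : ℕ => ∫⁻ t in Ioi (n : ℝ), ‖k t‖ₑ) atTop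
        (𝓝 (∫⁻ t in ⋂ n : ℕ, Ioi (n : ℝ), ‖k t‖ₑ)) := by
      have := tendsto_measure_iInter_atTop (μ := volume.withDensity fun t => ‖k t‖ₑ)
        (s := fun n : ℕ => Ioi (n : ℝ)) (fun n => measurableSet_Ioi.nullMeasurableSet)
        (fun m n hmn => Ioi_subset_Ioi (by exact_mod_cast hmn)) ⟨0, ?_⟩
      · rw [withDensity_apply _ (MeasurableSet.iInter fun n => measurableSet_Ioi)] at this
        refine this.congr fun n => ?_
        rw [Function.comp_apply, withDensity_apply _ measurableSet_Ioi]
      · rw [withDensity_apply _ measurableSet_Ioi]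
        exact ((setLIntegral_le_lintegral _ _).trans_lt hk.integrable.2).ne
    have h2 : ⋂ n : ℕ, Ioi (n : ℝ) = ∅ := by
      ext x
      simp only [mem_iInter, mem_Ioi, mem_empty_iff_false, iff_false, not_forall, not_lt]
      exact exists_nat_ge x
    rw [h2, setLIntegral_empty] at h1
    obtain ⟨n, hn⟩ := (h1.eventually_lt_const (show (0 : ENNReal) < 2⁻¹ by simp)).exists
    exact ⟨n, hn.le⟩
  -- The tail of k beyond T has mass at most 1/2 and drives the iteration. The part of k up to T
  -- meets only the values of g on (0, T], where L² is contained in L¹, so it joins the integrable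
  -- inhomogeneity b.
  set k₁ : ℝ → ENNReal := (Ioi T).indicator fun t => ‖k t‖ₑ with hk₁
  set k₂ : ℝ → ENNReal := (Iic T).indicator fun t => ‖k t‖ₑ with hk₂
  have hm₁ : Measurable k₁ := hkm.indicator measurableSet_Ioi
  have hm₂ : Measurable k₂ := hkm.indicator measurableSet_Iic
  have hsplit : ∀ t, ‖k t‖ₑ = k₁ t + k₂ t := fun t => by
    rcases lt_or_ge T t with ht | ht
    · rw [hk₁, hk₂, indicator_of_mem (mem_Ioi.2 ht), indicator_of_notMem (by simpa using ht),
        add_zero]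
    · rw [hk₁, hk₂, indicator_of_notMem (by simpa using ht), indicator_of_mem (mem_Iic.2 ht),
        zero_add]
  have hk1 : ∫⁻ t in Ioi (0 : ℝ), k₁ t ≤ 2⁻¹ := by
    refine (setLIntegral_le_lintegral _ _).trans ?_
    rw [hk₁, lintegral_indicator measurableSet_Ioi]
    exact hT
  set b : ℝ → ENNReal := fun x => ‖a x‖ₑ + ∫⁻ y in Ioi (0 : ℝ), k₂ (x + y) * ‖g y‖ₑ with hb
  have hbm : AEMeasurable b halfLine := ha.1.enorm.add (aemeasurable_hankel hm₂ hgm)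
  have hg2 : ∫⁻ x in Ioi (0 : ℝ), ‖g x‖ₑ ^ 2 ≠ ⊤ := by
    rw [← eLpNorm_two_sq]
    exact (ENNReal.pow_lt_top (Lp.memLp g).2).ne
  have hineq : ∀ᵐ x ∂halfLine, ‖g x‖ₑ ≤ b x + ∫⁻ y in Ioi (0 : ℝ), k₁ (x + y) * ‖g y‖ₑ := by
    filter_upwards [h] with x hx
    rw [hx, hb]
    refine (enorm_add_le _ _).trans ?_
    simp only []
    rw [add_assoc, ← lintegral_add_left' (f := fun y => k₂ (x + y) * ‖g y‖ₑ) ((by fun_prop :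
        Measurable fun y => k₂ (x + y)).aemeasurable.mul hgm), inner_shiftVec hk]
    refine add_le_add le_rfl ((enorm_integral_le_lintegral_enorm _).trans (le_of_eq ?_))
    refine lintegral_congr fun y => ?_
    rw [enorm_mul, hsplit]
    ring
  have hgT : ∫⁻ y in Ioc (0 : ℝ) T, ‖g y‖ₑ < ⊤ := by
    have h1 : MemLp g 2 (volume.restrict (Ioc (0 : ℝ) T)) :=
      (Lp.memLp g).mono_measure (Measure.restrict_mono Ioc_subset_Ioi_self le_rfl)
    exact (h1.integrable (by norm_num)).2
  have hb1 : ∫⁻ x in Ioi (0 : ℝ), b x < ⊤ := by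
    rw [hb, lintegral_add_left' ha.1.enorm]
    refine ENNReal.add_lt_top.2 ⟨ha.2, ?_⟩
    rw [lintegral_lintegral_swap
      ((hm₂.comp measurable_add).aemeasurable.mul hgm.comp_snd)]
    calc _ ≤ ∫⁻ y in Ioi (0 : ℝ), (Iic T).indicator (fun y => (∫⁻ t, ‖k t‖ₑ) * ‖g y‖ₑ) y := by
          refine setLIntegral_mono' measurableSet_Ioi fun y hy => ?_
          rw [lintegral_mul_const _ (by fun_prop)]
          rcases lt_or_ge T y with hyT | hyT
          · rw [indicator_of_notMem (by simpa using hyT)]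
            refine le_of_eq (mul_eq_zero.2 (Or.inl ?_))
            rw [setLIntegral_congr_fun measurableSet_Ioi (g := fun _ => 0), lintegral_zero]
            intro x hx
            simp only [hk₂]
            rw [indicator_of_notMem]
            simp only [mem_Iic, not_le]
            have : (0 : ℝ) < x := hx
            linarith
          · rw [indicator_of_mem (mem_Iic.2 hyT)]
            refine mul_le_mul' ?_ le_rfl
            refine (setLIntegral_le_lintegral _ _).trans ?_
            rw [lintegral_add_right_eq_self k₂]
            exact lintegral_mono fun t => indicator_le_self _ _ t
      _ = (∫⁻ t, ‖k t‖ₑ) * ∫⁻ y in Ioc (0 : ℝ) T, ‖g y‖ₑ := by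
          rw [lintegral_indicator measurableSet_Iic, Measure.restrict_restrict measurableSet_Iic,
            Iic_inter_Ioi, lintegral_const_mul'']
          exact hgm.mono_measure (Measure.restrict_mono Ioc_subset_Ioi_self le_rfl)
      _ < ⊤ := ENNReal.mul_lt_top hk.integrable.2 hgT
  refine ⟨Lp.aestronglyMeasurable g, ?_⟩
  exact (lintegral_le_of_le_add_hankel hm₁ hk1 hgm hg2 hbm hineq).trans_lt
    (ENNReal.mul_lt_top (by simp) hb1)

/-! ### The functions `φ` and `ψ` on the line -/

/-- The function `x ↦ ∫₀^∞ k (x + y + s) v(y) dy` on the line. -/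
noncomputable def halfConv (k : ℝ → ℝ) (s : ℝ) (v : ℝ → ℝ) (x : ℝ) : ℝ :=
  ∫ y in Ioi (0 : ℝ), k (x + y + s) * v y

lemma integrable_prod_halfConv {k v : ℝ → ℝ} (hk : HankelSymbol k) (hv : Integrable v halfLine)
    (s : ℝ) : Integrable (fun p : ℝ × ℝ => k (p.1 + p.2 + s) * v p.2) (volume.prod halfLine) := by
  have hm : AEStronglyMeasurable (fun p : ℝ × ℝ => k (p.1 + p.2 + s) * v p.2)
      (volume.prod halfLine) :=
    (hk.continuous.comp (by fun_prop : Continuous fun p : ℝ × ℝ =>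
      p.1 + p.2 + s)).aestronglyMeasurable.mul hv.1.comp_snd
  rw [integrable_prod_iff' hm]
  have e : ∀ y, ∫ x, ‖k (x + y + s) * v y‖ = (∫ x, ‖k x‖) * ‖v y‖ := fun y => by
    simp_rw [norm_mul, add_assoc]
    rw [integral_mul_const, integral_add_right_eq_self (fun x => ‖k x‖)]
  refine ⟨ae_of_all _ fun y => ?_, ?_⟩
  · simp only [add_assoc]
    exact (hk.integrable.comp_add_right (y + s)).mul_const _
  · simp_rw [e]
    exact hv.norm.const_mul _

lemma integrable_halfConv {k v : ℝ → ℝ} (hk : HankelSymbol k) (hv : Integrable v halfLine)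
    (s : ℝ) : Integrable (halfConv k s v) :=
  (integrable_prod_halfConv hk hv s).integral_prod_left

/-- Because the kernel depends on x + y + s only, writing e^{izx} = e^{-isz} e^{-izy} e^{iz(x+y+s)}
and applying Fubini factors the transform. This factorization is the source of the jump. -/
lemma integral_halfConv_mul_exp {k v : ℝ → ℝ} (hk : HankelSymbol k) (hv : Integrable v halfLine)
    (s z : ℝ) :
    ∫ x, (halfConv k s v x : ℂ) * Complex.exp (Complex.I * z * x) =
      Complex.exp (-Complex.I * s * z) * (∫ t, (k t : ℂ) * Complex.exp (Complex.I * z * t)) *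
        ∫ y in Ioi (0 : ℝ), (v y : ℂ) * Complex.exp (-Complex.I * z * y) := by
  have hi : Integrable (fun p : ℝ × ℝ => ((k (p.1 + p.2 + s) * v p.2 : ℝ) : ℂ) *
      Complex.exp (Complex.I * z * p.1)) (volume.prod halfLine) := by
    refine (integrable_prod_halfConv hk hv s).ofReal.mul_bdd (c := 1)
      (by fun_prop : Continuous fun p : ℝ × ℝ =>
        Complex.exp (Complex.I * z * p.1)).aestronglyMeasurable (ae_of_all _ fun p => ?_)
    rw [show Complex.I * z * p.1 = ((z * p.1 : ℝ) : ℂ) * Complex.I by push_cast; ring,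
      Complex.norm_exp_ofReal_mul_I]
  have e1 : ∀ x : ℝ, (halfConv k s v x : ℂ) * Complex.exp (Complex.I * z * x) =
      ∫ y in Ioi (0 : ℝ), ((k (x + y + s) * v y : ℝ) : ℂ) * Complex.exp (Complex.I * z * x) :=
    fun x => by rw [integral_mul_const, halfConv]; congr 1; exact integral_ofReal.symm
  simp_rw [e1]
  rw [integral_integral_swap (f := fun (x y : ℝ) => ((k (x + y + s) * v y : ℝ) : ℂ) *
    Complex.exp (Complex.I * z * x)) hi, ← integral_const_mul]
  refine integral_congr_ae (ae_of_all _ fun y => ?_)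
  simp only []
  have e2 := integral_add_right_eq_self (μ := volume)
    (fun t : ℝ => (k t : ℂ) * Complex.exp (Complex.I * z * t)) (y + s)
  rw [← e2, mul_assoc, mul_comm (∫ _, _) _, ← mul_assoc, ← integral_const_mul]
  refine integral_congr_ae (ae_of_all _ fun x => ?_)
  simp only []
  have e3 : Complex.exp (Complex.I * z * x) = Complex.exp (-Complex.I * s * z) *
      Complex.exp (-Complex.I * z * y) * Complex.exp (Complex.I * z * ((x + (y + s) : ℝ) : ℂ)) := by
    rw [← Complex.exp_add, ← Complex.exp_add]
    congr 1
    push_cast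
    ring
  rw [e3, add_assoc]
  push_cast
  ring

namespace SmoothIntegrable

variable {A : ℝ → ℝ} (hA : SmoothIntegrable A)
include hA

lemma hasDerivAt_halfConv {v : ℝ → ℝ} (hv : Integrable v halfLine) (s : ℝ) (p : ℕ) (x : ℝ) :
    HasDerivAt (halfConv (iteratedDeriv p A) s v) (halfConv (iteratedDeriv (p + 1) A) s v x) x := by
  have hm : ∀ p x, AEStronglyMeasurable (fun y => iteratedDeriv p A (x + y + s) * v y) halfLine :=
    fun p x => ((hA.continuous p).comp (by fun_prop)).aestronglyMeasurable.mul hv.1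
  have hb : ∀ p x y, ‖iteratedDeriv p A (x + y + s) * v y‖ ≤
      (∫ t, |iteratedDeriv (p + 1) A t|) * ‖v y‖ := fun p x y => by
    rw [norm_mul]
    exact mul_le_mul_of_nonneg_right (hA.abs_le p _) (norm_nonneg _)
  refine (hasDerivAt_integral_of_dominated_loc_of_deriv_le (μ := halfLine)
    (F := fun x y => iteratedDeriv p A (x + y + s) * v y)
    (F' := fun x y => iteratedDeriv (p + 1) A (x + y + s) * v y) (x₀ := x)
    (bound := fun y => (∫ t, |iteratedDeriv (p + 1 + 1) A t|) * ‖v y‖) univ_mem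
    (Eventually.of_forall fun x => hm p x) ?_ (hm (p + 1) x)
    (ae_of_all _ fun y x _ => hb (p + 1) x y) (hv.norm.const_mul _)
    (ae_of_all _ fun y x _ => ?_)).2
  · exact (hv.norm.const_mul _).mono' (hm p x) (ae_of_all _ fun y => hb p x y)
  · refine HasDerivAt.mul_const ?_ _
    have := (hA.hasDerivAt p (x + y + s))
    simp only [add_assoc] at this ⊢
    exact this.comp_add_const x (y + s)

lemma integrable_ketA (p : ℕ) (s : ℝ) : Integrable (ketA A p s) halfLine := by
  have h1 : Integrable (fun y => iteratedDeriv p A (y + s)) halfLine :=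
    ((hA.integrable p).comp_add_right s).restrict
  exact h1.congr (coeFn_toL2 ((hA.hankelSymbol p).memLp_shift s)).symm

variable {s : ℝ} (hHS : HilbertSchmidtKernel (hankelKernel A s)) (hu : IsUnit (1 - opK A s))
include hHS hu

/-- With f = (I - K_s)⁻¹ a_0 one has f = a_0 + A_s w and w = A_s f. Hence f ± w solve g = a_0 ± A_s
g, equations with an integrable Hankel symbol, and w is half the difference. -/
lemma integrable_regDelta : Integrable (regDelta A s) halfLine := by
  set f := resolventK A s (ketA A 0 s) with hf
  set w := regDelta A s with hw
  have e1 : f = ketA A 0 s + opA A s w := by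
    rw [hw, opA_regDelta hu, ← hf]; abel
  have e2 : w = opA A s f := rfl
  have hk := hA.hankelSymbol_self.comp_add_right s
  have key : ∀ c : ℝ, c * c = 1 → Integrable (f + c • w : L2R) halfLine := by
    intro c hc
    have e3 : f + c • w = ketA A 0 s + c • opA A s (f + c • w) := by
      rw [map_add, map_smul, smul_add, smul_smul, hc, one_smul, ← e2]
      nth_rw 1 [e1]
      abel
    refine integrable_of_eq_add_hankel (hk.const_mul c) (hA.integrable_ketA 0 s) ?_
    generalize f + c • w = g at e3
    have e4 := Lp.coeFn_add (ketA A 0 s) (c • opA A s g)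
    rw [← e3] at e4
    filter_upwards [e4, Lp.coeFn_smul c (opA A s g), opA_apply hA.hankelSymbol_self hHS g]
      with x h1 h2 h3
    rw [h1, Pi.add_apply, h2, Pi.smul_apply, h3, smul_eq_mul, inner_shiftVec (hk.const_mul c),
      inner_shiftVec hA.hankelSymbol_self, ← integral_const_mul]
    congr 1
    refine integral_congr_ae (ae_of_all _ fun y => ?_)
    simp only [mul_assoc]
    rw [add_right_comm]
  have h1 := key 1 (by norm_num)
  have h2 := key (-1) (by norm_num)
  refine ((h1.sub h2).const_mul (1 / 2)).congr ?_
  filter_upwards [Lp.coeFn_add f ((1 : ℝ) • w), Lp.coeFn_add f ((-1 : ℝ) • w),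
    Lp.coeFn_smul (1 : ℝ) w, Lp.coeFn_smul (-1 : ℝ) w] with x h3 h4 h5 h6
  simp only [Pi.sub_apply]
  rw [h3, h4, Pi.add_apply, Pi.add_apply, h5, h6]
  simp only [Pi.smul_apply, smul_eq_mul]
  ring

omit hHS hu in
lemma halfConv_eq_inner (p : ℕ) (s : ℝ) (v : L2R) (x : ℝ) :
    halfConv (iteratedDeriv p A) s v x = inner ℝ (ketA A p (x + s)) v := by
  rw [hA.inner_ketA, halfConv]
  simp_rw [add_right_comm]

/-- The derivatives of `φ`. -/
noncomputable def phiDeriv (A : ℝ → ℝ) (s : ℝ) (p : ℕ) (x : ℝ) : ℝ :=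
  iteratedDeriv p A (x + s) + halfConv (iteratedDeriv p A) s (regDelta A s) x

/-- The derivatives of `ψ`. -/
noncomputable def psiDeriv (A : ℝ → ℝ) (s : ℝ) (p : ℕ) : ℝ → ℝ :=
  halfConv (iteratedDeriv p A) s (phiFun A s)

omit hA hHS hu in
lemma phiDeriv_zero : phiDeriv A s 0 = phiFun A s := by
  ext x; simp only [phiDeriv, phiFun, iteratedDeriv_zero]; rfl

omit hA hHS hu in
lemma psiDeriv_zero : psiDeriv A s 0 = psiFun A s := by
  ext x; simp only [psiDeriv, psiFun, iteratedDeriv_zero]; rfl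

lemma hasDerivAt_phiDeriv (p : ℕ) (x : ℝ) :
    HasDerivAt (phiDeriv A s p) (phiDeriv A s (p + 1) x) x :=
  ((hA.hasDerivAt p (x + s)).comp_add_const x s).add
    (hA.hasDerivAt_halfConv (hA.integrable_regDelta hHS hu) s p x)

lemma integrable_phiDeriv (p : ℕ) : Integrable (phiDeriv A s p) :=
  ((hA.integrable p).comp_add_right s).add
    (integrable_halfConv (hA.hankelSymbol p) (hA.integrable_regDelta hHS hu) s)

lemma integrable_phiFun : Integrable (phiFun A s) := by
  rw [← phiDeriv_zero]; exact hA.integrable_phiDeriv hHS hu 0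

lemma hasDerivAt_psiDeriv (p : ℕ) (x : ℝ) :
    HasDerivAt (psiDeriv A s p) (psiDeriv A s (p + 1) x) x :=
  hA.hasDerivAt_halfConv (hA.integrable_phiFun hHS hu).restrict s p x

lemma integrable_psiDeriv (p : ℕ) : Integrable (psiDeriv A s p) :=
  integrable_halfConv (hA.hankelSymbol p) (hA.integrable_phiFun hHS hu).restrict s

lemma integrable_psiFun : Integrable (psiFun A s) := by
  rw [← psiDeriv_zero]; exact hA.integrable_psiDeriv hHS hu 0

lemma phiFun_ae_eq : phiFun A s =ᵐ[halfLine] resolventK A s (ketA A 0 s) := by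
  have e1 : resolventK A s (ketA A 0 s) = ketA A 0 s + opA A s (regDelta A s) := by
    rw [opA_regDelta hu]; abel
  rw [e1]
  filter_upwards [Lp.coeFn_add (ketA A 0 s) (opA A s (regDelta A s)),
    coeFn_toL2 ((hA.hankelSymbol 0).memLp_shift s),
    hA.opA_apply_ae hHS (regDelta A s)] with x h1 h2 h3
  have h4 : (ketA A 0 s) x = iteratedDeriv 0 A (x + s) := h2
  rw [h1, Pi.add_apply, h3, h4, ← phiDeriv_zero, phiDeriv, hA.halfConv_eq_inner]

lemma psiDeriv_eq_inner (p : ℕ) (x : ℝ) :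
    psiDeriv A s p x = inner ℝ (ketA A p (x + s)) (resolventK A s (ketA A 0 s)) := by
  rw [← hA.halfConv_eq_inner, psiDeriv, halfConv, halfConv]
  refine integral_congr_ae ?_
  filter_upwards [hA.phiFun_ae_eq hHS hu] with y hy
  rw [hy]

/-- This closes the system: φ is A_s applied to δ + w, so its Fourier transform contains the
one-sided transform of ψ itself. -/
lemma psiFun_ae_eq : psiFun A s =ᵐ[halfLine] regDelta A s := by
  filter_upwards [hA.opA_apply_ae hHS (resolventK A s (ketA A 0 s))] with x h
  rw [← psiDeriv_zero, hA.psiDeriv_eq_inner hHS hu, ← h]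
  rfl

omit hHS hu in
lemma phiDeriv_apply_zero (p : ℕ) : phiDeriv A s p 0 = qFun A p s := by
  rw [phiDeriv, hA.halfConv_eq_inner, zero_add, qFun]

lemma psiDeriv_apply_zero (p : ℕ) : psiDeriv A s p 0 = uFun A p s := by
  rw [hA.psiDeriv_eq_inner hHS hu, zero_add,
    hA.uFun_eq (hA.hilbertSchmidt_of hHS) hu, real_inner_comm]

end SmoothIntegrable

/-! ### The one-sided Fourier transform -/

/-- The transform `∫₀^∞ g(t) e^{iζt} dt`. -/
noncomputable def halfFourier (g : ℝ → ℝ) (ζ : ℂ) : ℂ :=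
  ∫ t in Ioi (0 : ℝ), (g t : ℂ) * Complex.exp (Complex.I * ζ * t)

lemma norm_exp_I_mul (ζ : ℂ) (t : ℝ) :
    ‖Complex.exp (Complex.I * ζ * t)‖ = Real.exp (-(ζ.im * t)) := by
  rw [Complex.norm_exp]
  congr 1
  simp [Complex.mul_re]

lemma norm_exp_I_mul_le {ζ : ℂ} (hζ : 0 ≤ ζ.im) {t : ℝ} (ht : t ∈ Ioi (0 : ℝ)) :
    ‖Complex.exp (Complex.I * ζ * t)‖ ≤ 1 := by
  rw [norm_exp_I_mul, Real.exp_le_one_iff]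
  have := mul_nonneg hζ (le_of_lt ht)
  linarith

section HalfFourier

variable {g : ℝ → ℝ} (hg : Integrable g halfLine)
include hg

lemma aestronglyMeasurable_halfFourier (ζ : ℂ) :
    AEStronglyMeasurable (fun t : ℝ => (g t : ℂ) * Complex.exp (Complex.I * ζ * t)) halfLine :=
  hg.ofReal.1.mul (by fun_prop : Continuous fun t : ℝ =>
    Complex.exp (Complex.I * ζ * t)).aestronglyMeasurable

omit hg in
lemma norm_halfFourier_integrand_le {ζ : ℂ} (hζ : 0 ≤ ζ.im) :
    ∀ᵐ t ∂halfLine, ‖(g t : ℂ) * Complex.exp (Complex.I * ζ * t)‖ ≤ |g t| := by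
  filter_upwards [ae_restrict_mem measurableSet_Ioi] with t ht
  rw [norm_mul, Complex.norm_real, Real.norm_eq_abs]
  exact mul_le_of_le_one_right (abs_nonneg _) (norm_exp_I_mul_le hζ ht)

lemma integrable_halfFourier {ζ : ℂ} (hζ : 0 ≤ ζ.im) :
    Integrable (fun t : ℝ => (g t : ℂ) * Complex.exp (Complex.I * ζ * t)) halfLine :=
  hg.abs.mono' (aestronglyMeasurable_halfFourier hg ζ) (norm_halfFourier_integrand_le hζ)

lemma norm_halfFourier_le {ζ : ℂ} (hζ : 0 ≤ ζ.im) :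
    ‖halfFourier g ζ‖ ≤ ∫ t in Ioi (0 : ℝ), |g t| :=
  norm_integral_le_of_norm_le hg.abs (norm_halfFourier_integrand_le hζ)

lemma continuousOn_halfFourier : ContinuousOn (halfFourier g) {ζ : ℂ | 0 ≤ ζ.im} := by
  refine continuousOn_of_dominated (bound := fun t => |g t|)
    (fun ζ _ => aestronglyMeasurable_halfFourier hg ζ)
    (fun ζ hζ => norm_halfFourier_integrand_le hζ) hg.abs (ae_of_all _ fun t => ?_)
  fun_prop

lemma differentiableAt_halfFourier {ζ : ℂ} (hζ : 0 < ζ.im) :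
    DifferentiableAt ℂ (halfFourier g) ζ := by
  set δ := ζ.im / 2 with hδ
  have hδ0 : 0 < δ := by positivity
  have hs : {ξ : ℂ | δ < ξ.im} ∈ 𝓝 ζ :=
    (isOpen_lt continuous_const Complex.continuous_im).mem_nhds
      (show δ < ζ.im by rw [hδ]; linarith)
  refine (hasDerivAt_integral_of_dominated_loc_of_deriv_le (μ := halfLine)
    (F := fun (ξ : ℂ) (t : ℝ) => (g t : ℂ) * Complex.exp (Complex.I * ξ * t))
    (F' := fun (ξ : ℂ) (t : ℝ) => (g t : ℂ) *
      (Complex.exp (Complex.I * ξ * t) * (Complex.I * t)))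
    (x₀ := ζ) (bound := fun t => |g t| * δ⁻¹) hs
    (Eventually.of_forall fun ξ => aestronglyMeasurable_halfFourier hg ξ)
    (integrable_halfFourier hg hζ.le) ?_ ?_ (hg.abs.mul_const _)
    (ae_of_all _ fun t ξ _ => ?_)).2.differentiableAt
  · exact hg.ofReal.1.mul (by fun_prop : Continuous fun t : ℝ =>
      Complex.exp (Complex.I * ζ * t) * (Complex.I * t)).aestronglyMeasurable
  · filter_upwards [ae_restrict_mem measurableSet_Ioi] with t ht ξ hξ
    have ht0 : (0 : ℝ) < t := ht
    have hξ0 : δ < ξ.im := hξ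
    rw [norm_mul, norm_mul, Complex.norm_real, Real.norm_eq_abs, norm_exp_I_mul, norm_mul,
      Complex.norm_I, one_mul, Complex.norm_real, Real.norm_eq_abs, abs_of_pos ht0]
    gcongr
    rw [Real.exp_neg, inv_mul_le_iff₀ (Real.exp_pos _), ← div_eq_mul_inv, le_div_iff₀ hδ0]
    calc t * δ ≤ ξ.im * t := by rw [mul_comm]; gcongr
      _ ≤ ξ.im * t + 1 := by linarith
      _ ≤ _ := Real.add_one_le_exp _
  · refine HasDerivAt.const_mul _ ?_
    have := (((hasDerivAt_id ξ).const_mul Complex.I).mul_const (t : ℂ)).cexp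
    simpa using this

end HalfFourier

/-- Integration by parts, valid up to the real axis since the integrand and its derivative are
integrable there as well. -/
lemma I_mul_halfFourier {g g' : ℝ → ℝ} (hd : ∀ x, HasDerivAt g (g' x) x)
    (hg : Integrable g halfLine) (hg' : Integrable g' halfLine) {ζ : ℂ} (hζ : 0 ≤ ζ.im) :
    Complex.I * ζ * halfFourier g ζ = -(g 0 : ℂ) - halfFourier g' ζ := by
  have i1 := integrable_halfFourier hg hζ
  have i2 := integrable_halfFourier hg' hζ
  have hd' : ∀ x ∈ Ici (0 : ℝ), HasDerivAt
      (fun t : ℝ => (g t : ℂ) * Complex.exp (Complex.I * ζ * t))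
      ((g' x : ℂ) * Complex.exp (Complex.I * ζ * x) +
        Complex.I * ζ * ((g x : ℂ) * Complex.exp (Complex.I * ζ * x))) x := fun x _ => by
    have h1 : HasDerivAt (fun t : ℝ => Complex.exp (Complex.I * ζ * t))
        (Complex.exp (Complex.I * ζ * x) * (Complex.I * ζ)) x := by
      have := ((hasDerivAt_id (x : ℂ)).const_mul (Complex.I * ζ)).cexp.comp_ofReal
      simpa using this
    exact ((hd x).ofReal_comp.mul h1).congr_deriv (by ring)
  have i3 := i2.add (i1.const_mul (Complex.I * ζ))
  have h := integral_Ioi_of_hasDerivAt_of_tendsto' hd' i3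
    (tendsto_zero_of_hasDerivAt_of_integrableOn_Ioi (a := 0)
      (fun x hx => hd' x (mem_Ici.2 (le_of_lt hx))) i3 i1)
  rw [integral_add i2 (i1.const_mul _), integral_const_mul] at h
  simp only [Complex.ofReal_zero, mul_zero, Complex.exp_zero, mul_one, zero_sub] at h
  change halfFourier g' ζ + Complex.I * ζ * halfFourier g ζ = _ at h
  linear_combination h

lemma integral_Iio_eq_halfFourier (g : ℝ → ℝ) (ζ : ℂ) :
    ∫ t in Iio (0 : ℝ), (g t : ℂ) * Complex.exp (Complex.I * ζ * t) =
      halfFourier (fun t => g (-t)) (-ζ) := by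
  rw [halfFourier, ← integral_Iic_eq_integral_Iio]
  have := integral_comp_neg_Ioi (0 : ℝ)
    (fun t : ℝ => (g t : ℂ) * Complex.exp (Complex.I * ζ * t))
  rw [neg_zero] at this
  rw [← this]
  refine integral_congr_ae (ae_of_all _ fun t => ?_)
  simp

lemma derivResolvent_of_pos {ζ : ℂ} (hζ : 0 < ζ.im) (g : ℝ → ℝ) :
    derivResolvent ζ g 0 = -halfFourier g ζ := by
  simp only [derivResolvent, if_pos hζ, zero_add, halfFourier]

/-- Real ζ falls into the second branch of the definition. Including it here frees the later
estimates from conditions on Im ζ. -/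
lemma derivResolvent_of_nonpos {ζ : ℂ} (hζ : ζ.im ≤ 0) (g : ℝ → ℝ) :
    derivResolvent ζ g 0 = halfFourier (fun t => g (-t)) (-ζ) := by
  simp only [derivResolvent, if_neg hζ.not_gt, zero_add]
  exact integral_Iio_eq_halfFourier g ζ

lemma integral_mul_exp_eq {g : ℝ → ℝ} (hg : Integrable g) (z : ℝ) :
    ∫ t, (g t : ℂ) * Complex.exp (Complex.I * z * t) =
      halfFourier g z + halfFourier (fun t => g (-t)) (-z) := by
  have hi : Integrable (fun t : ℝ => (g t : ℂ) * Complex.exp (Complex.I * z * t)) := by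
    refine hg.ofReal.mul_bdd (c := 1) (by fun_prop : Continuous fun t : ℝ =>
        Complex.exp (Complex.I * z * t)).aestronglyMeasurable (ae_of_all _ fun t => ?_)
    rw [norm_exp_I_mul]
    simp
  have h := setIntegral_union (Iic_disjoint_Ioi (le_refl (0 : ℝ))) measurableSet_Ioi
    hi.integrableOn hi.integrableOn
  rw [Iic_union_Ioi, setIntegral_univ] at h
  rw [← integral_Iio_eq_halfFourier, ← integral_Iic_eq_integral_Iio, add_comm, halfFourier, h]

/-! ### Asymptotic expansion of the resolvent of the derivative -/

lemma norm_derivResolvent_le {g : ℝ → ℝ} (hg : Integrable g) (ζ : ℂ) :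
    ‖derivResolvent ζ g 0‖ ≤ ∫ t, |g t| := by
  rcases lt_or_ge 0 ζ.im with h | h
  · rw [derivResolvent_of_pos h, norm_neg]
    exact (norm_halfFourier_le hg.restrict h.le).trans
      (setIntegral_le_integral hg.abs (ae_of_all _ fun _ => abs_nonneg _))
  · rw [derivResolvent_of_nonpos h, ← integral_neg_eq_self (fun t => |g t|)]
    exact (norm_halfFourier_le hg.comp_neg.restrict (by simpa using h)).trans
      (setIntegral_le_integral hg.comp_neg.abs (ae_of_all _ fun _ => abs_nonneg _))

lemma I_mul_derivResolvent {g g' : ℝ → ℝ} (hd : ∀ x, HasDerivAt g (g' x) x)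
    (hg : Integrable g) (hg' : Integrable g') (ζ : ℂ) :
    Complex.I * ζ * derivResolvent ζ g 0 = g 0 - derivResolvent ζ g' 0 := by
  rcases lt_or_ge 0 ζ.im with h | h
  · rw [derivResolvent_of_pos h, derivResolvent_of_pos h]
    linear_combination -I_mul_halfFourier hd hg.restrict hg'.restrict h.le
  · rw [derivResolvent_of_nonpos h, derivResolvent_of_nonpos h]
    have h1 := I_mul_halfFourier (g := fun t => g (-t)) (g' := fun t => -g' (-t)) (fun x =>
      ((hd (-x)).comp x (hasDerivAt_neg x)).congr_deriv (by simp)) hg.comp_neg.restrict hg'.comp_neg.neg.restrict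
      (ζ := -ζ) (by simpa using h)
    have h2 : halfFourier (fun t => -g' (-t)) (-ζ) = -halfFourier (fun t => g' (-t)) (-ζ) := by
      simp only [halfFourier, Complex.ofReal_neg, neg_mul, integral_neg]
    rw [h2, neg_zero] at h1
    linear_combination -h1

lemma derivResolvent_eq_sum_add {g : ℕ → ℝ → ℝ} (hd : ∀ p x, HasDerivAt (g p) (g (p + 1) x) x)
    (hg : ∀ p, Integrable (g p)) {ζ : ℂ} (hζ : ζ ≠ 0) (N : ℕ) :
    derivResolvent ζ (g 0) 0 =
      -(∑ p ∈ Finset.range N, (Complex.I * ζ⁻¹) ^ (p + 1) * (g p 0 : ℂ)) +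
        (Complex.I * ζ⁻¹) ^ N * derivResolvent ζ (g N) 0 := by
  induction N with
  | zero => simp
  | succ N ih =>
    have h1 : derivResolvent ζ (g N) 0 =
        Complex.I * ζ⁻¹ * (derivResolvent ζ (g (N + 1)) 0 - g N 0) := by
      have := I_mul_derivResolvent (hd N) (hg N) (hg (N + 1)) ζ
      have h2 : derivResolvent ζ (g (N + 1)) 0 - g N 0 =
        -(Complex.I * ζ * derivResolvent ζ (g N) 0) := by rw [this]; ring
      rw [h2]
      field_simp
      rw [Complex.I_sq]
      ring
    rw [ih, h1, Finset.sum_range_succ]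
    ring

lemma norm_derivResolvent_add_sum_le {g : ℕ → ℝ → ℝ}
    (hd : ∀ p x, HasDerivAt (g p) (g (p + 1) x) x)
    (hg : ∀ p, Integrable (g p)) {ζ : ℂ} (hζ : ζ ≠ 0) (N : ℕ) :
    ‖derivResolvent ζ (g 0) 0 +
      ∑ p ∈ Finset.range N, (Complex.I * ζ⁻¹) ^ (p + 1) * (g p 0 : ℂ)‖ ≤
      (|g N 0| + ∫ t, |g (N + 1) t|) * ‖ζ⁻¹ ^ (N + 1)‖ := by
  -- The expansion is taken one term further than claimed: that extra term and the remainder are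
  -- both of order ζ^{-N-1}, which accounts for the two summands of the constant.
  rw [derivResolvent_eq_sum_add hd hg hζ (N + 1), Finset.sum_range_succ]
  have e : ∀ a b c : ℂ, -(a + b) + c + a = -b + c := fun a b c => by ring
  rw [e]
  refine (norm_add_le _ _).trans ?_
  rw [norm_neg, norm_mul, norm_mul, mul_pow, norm_mul, norm_pow, Complex.norm_I, one_pow, one_mul,
    Complex.norm_real, Real.norm_eq_abs, add_mul, mul_comm _ |g N 0|, mul_comm _ ‖derivResolvent _ _ _‖]
  gcongr
  exact norm_derivResolvent_le (hg _) ζ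

/-! ### The Riemann–Hilbert problem -/

namespace SmoothIntegrable

/-- The extension of `X` to the closed upper half-plane. -/
noncomputable def upperX (A : ℝ → ℝ) (s : ℝ) (z : ℂ) : Matrix (Fin 2) (Fin 2) ℂ :=
  !![1 - halfFourier (fun t => psiFun A s (-t)) z, -(Complex.I * halfFourier (phiFun A s) z);
     -(Complex.I * halfFourier (fun t => phiFun A s (-t)) z), 1 + halfFourier (psiFun A s) z]

/-- The extension of `X` to the closed lower half-plane. -/
noncomputable def lowerX (A : ℝ → ℝ) (s : ℝ) (z : ℂ) : Matrix (Fin 2) (Fin 2) ℂ :=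
  !![1 + halfFourier (psiFun A s) (-z), Complex.I * halfFourier (fun t => phiFun A s (-t)) (-z);
     Complex.I * halfFourier (phiFun A s) (-z), 1 - halfFourier (fun t => psiFun A s (-t)) (-z)]

lemma explicitX_eq (A : ℝ → ℝ) (s : ℝ) (z : ℂ) : explicitX A s z =
    !![1 - derivResolvent (-z) (psiFun A s) 0, Complex.I * derivResolvent z (phiFun A s) 0;
       -(Complex.I * derivResolvent (-z) (phiFun A s) 0),
       1 - derivResolvent z (psiFun A s) 0] := by
  rw [explicitX, Matrix.one_fin_two]
  ext i j
  fin_cases i <;> fin_cases j <;> simp [sub_eq_add_neg]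

lemma explicitX_of_pos (A : ℝ → ℝ) (s : ℝ) {z : ℂ} (hz : 0 < z.im) :
    explicitX A s z = upperX A s z := by
  have h : (-z).im ≤ 0 := by simpa using hz.le
  rw [explicitX_eq, upperX, derivResolvent_of_pos hz, derivResolvent_of_pos hz,
    derivResolvent_of_nonpos h, derivResolvent_of_nonpos h, neg_neg, mul_neg, sub_neg_eq_add]

lemma explicitX_of_neg (A : ℝ → ℝ) (s : ℝ) {z : ℂ} (hz : z.im < 0) :
    explicitX A s z = lowerX A s z := by
  have h : 0 < (-z).im := by simpa using hz
  rw [explicitX_eq, lowerX, derivResolvent_of_pos h, derivResolvent_of_pos h,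
    derivResolvent_of_nonpos hz.le, derivResolvent_of_nonpos hz.le, mul_neg, neg_neg,
    sub_neg_eq_add]

variable {A : ℝ → ℝ} (hA : SmoothIntegrable A) {s : ℝ}
  (hHS : HilbertSchmidtKernel (hankelKernel A s)) (hu : IsUnit (1 - opK A s))
include hA hHS hu

lemma continuousOn_upperX : ContinuousOn (upperX A s) {z : ℂ | 0 ≤ z.im} := by
  have h1 := continuousOn_halfFourier (hA.integrable_phiFun hHS hu).restrict
  have h2 := continuousOn_halfFourier (hA.integrable_psiFun hHS hu).restrict
  have h3 := continuousOn_halfFourier (hA.integrable_phiFun hHS hu).comp_neg.restrict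
  have h4 := continuousOn_halfFourier (hA.integrable_psiFun hHS hu).comp_neg.restrict
  refine continuousOn_pi.2 fun i => continuousOn_pi.2 fun j => ?_
  fin_cases i <;> fin_cases j
  · exact continuousOn_const.sub h4
  · exact (continuousOn_const.mul h1).neg
  · exact (continuousOn_const.mul h3).neg
  · exact continuousOn_const.add h2

lemma continuousOn_lowerX : ContinuousOn (lowerX A s) {z : ℂ | z.im ≤ 0} := by
  have hm : MapsTo (fun z : ℂ => -z) {z : ℂ | z.im ≤ 0} {z : ℂ | 0 ≤ z.im} :=
    fun z hz => by simpa using hz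
  have h1 := (continuousOn_halfFourier (hA.integrable_phiFun hHS hu).restrict).comp
    continuous_neg.continuousOn hm
  have h2 := (continuousOn_halfFourier (hA.integrable_psiFun hHS hu).restrict).comp
    continuous_neg.continuousOn hm
  have h3 := (continuousOn_halfFourier (hA.integrable_phiFun hHS hu).comp_neg.restrict).comp
    continuous_neg.continuousOn hm
  have h4 := (continuousOn_halfFourier (hA.integrable_psiFun hHS hu).comp_neg.restrict).comp
    continuous_neg.continuousOn hm
  refine continuousOn_pi.2 fun i => continuousOn_pi.2 fun j => ?_
  fin_cases i <;> fin_cases j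
  · exact continuousOn_const.add h2
  · exact continuousOn_const.mul h3
  · exact continuousOn_const.mul h1
  · exact continuousOn_const.sub h4

lemma differentiableAt_upperX {z : ℂ} (hz : 0 < z.im) (i j : Fin 2) :
    DifferentiableAt ℂ (fun z => upperX A s z i j) z := by
  have h1 := differentiableAt_halfFourier (hA.integrable_phiFun hHS hu).restrict hz
  have h2 := differentiableAt_halfFourier (hA.integrable_psiFun hHS hu).restrict hz
  have h3 := differentiableAt_halfFourier (hA.integrable_phiFun hHS hu).comp_neg.restrict hz
  have h4 := differentiableAt_halfFourier (hA.integrable_psiFun hHS hu).comp_neg.restrict hz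
  fin_cases i <;> fin_cases j
  · exact (differentiableAt_const _).sub h4
  · exact ((differentiableAt_const _).mul h1).neg
  · exact ((differentiableAt_const _).mul h3).neg
  · exact (differentiableAt_const _).add h2

lemma differentiableAt_lowerX {z : ℂ} (hz : z.im < 0) (i j : Fin 2) :
    DifferentiableAt ℂ (fun z => lowerX A s z i j) z := by
  have hz' : 0 < (-z).im := by simpa using hz
  have hn : DifferentiableAt ℂ (fun z : ℂ => -z) z := by fun_prop
  have h1 := (differentiableAt_halfFourier (hA.integrable_phiFun hHS hu).restrict hz').comp z hn
  have h2 := (differentiableAt_halfFourier (hA.integrable_psiFun hHS hu).restrict hz').comp z hn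
  have h3 := (differentiableAt_halfFourier
    (hA.integrable_phiFun hHS hu).comp_neg.restrict hz').comp z hn
  have h4 := (differentiableAt_halfFourier
    (hA.integrable_psiFun hHS hu).comp_neg.restrict hz').comp z hn
  fin_cases i <;> fin_cases j
  · exact (differentiableAt_const _).add h2
  · exact (differentiableAt_const _).mul h3
  · exact (differentiableAt_const _).mul h1
  · exact (differentiableAt_const _).sub h4

lemma analyticOnNhd_explicitX (i j : Fin 2) :
    AnalyticOnNhd ℂ (fun z => explicitX A s z i j) {z : ℂ | z.im ≠ 0} := by
  have ho : IsOpen {z : ℂ | z.im ≠ 0} := isOpen_ne_fun Complex.continuous_im continuous_const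
  refine DifferentiableOn.analyticOnNhd (fun z hz => DifferentiableAt.differentiableWithinAt ?_) ho
  rcases lt_or_gt_of_ne (show z.im ≠ 0 from hz) with h | h
  · refine (hA.differentiableAt_lowerX hHS hu h i j).congr_of_eventuallyEq ?_
    filter_upwards [(isOpen_lt Complex.continuous_im continuous_const).mem_nhds h] with ξ hξ
    rw [explicitX_of_neg A s hξ]
  · refine (hA.differentiableAt_upperX hHS hu h i j).congr_of_eventuallyEq ?_
    filter_upwards [(isOpen_lt continuous_const Complex.continuous_im).mem_nhds h] with ξ hξ
    rw [explicitX_of_pos A s hξ]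

/-- The summand 1 comes from δ, the other from w, which may be replaced by ψ under the half-line
integral. -/
lemma integral_phiFun_mul_exp (z : ℝ) :
    ∫ t, (phiFun A s t : ℂ) * Complex.exp (Complex.I * z * t) =
      Complex.exp (-Complex.I * s * z) * (∫ t, (A t : ℂ) * Complex.exp (Complex.I * z * t)) *
        (1 + halfFourier (psiFun A s) (-z)) := by
  have hk := hA.hankelSymbol_self
  have hw := hA.integrable_regDelta hHS hu
  have hb : ∀ g : ℝ → ℝ, Integrable g →
      Integrable (fun t : ℝ => (g t : ℂ) * Complex.exp (Complex.I * z * t)) := fun g hg => by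
    refine hg.ofReal.mul_bdd (c := 1) (by fun_prop : Continuous fun t : ℝ =>
        Complex.exp (Complex.I * z * t)).aestronglyMeasurable (ae_of_all _ fun t => ?_)
    rw [norm_exp_I_mul]
    simp
  have e1 : ∀ t : ℝ, (phiFun A s t : ℂ) * Complex.exp (Complex.I * z * t) =
      (A (t + s) : ℂ) * Complex.exp (Complex.I * z * t) +
        (halfConv A s (regDelta A s) t : ℂ) * Complex.exp (Complex.I * z * t) := fun t => by
    rw [← add_mul, ← Complex.ofReal_add]; rfl
  simp_rw [e1]
  rw [integral_add (hb _ (hk.integrable.comp_add_right s)) (hb _ (integrable_halfConv hk hw s)),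
    integral_halfConv_mul_exp hk hw, mul_add, mul_one]
  congr 1
  · rw [← integral_const_mul, ← integral_add_right_eq_self (fun t : ℝ =>
      Complex.exp (-Complex.I * s * z) * ((A t : ℂ) * Complex.exp (Complex.I * z * t))) s]
    refine integral_congr_ae (ae_of_all _ fun t => ?_)
    simp only []
    have : Complex.exp (Complex.I * z * t) = Complex.exp (-Complex.I * s * z) *
        Complex.exp (Complex.I * z * ((t + s : ℝ) : ℂ)) := by
      rw [← Complex.exp_add]
      congr 1
      push_cast
      ring
    rw [this]
    ring
  · congr 1
    rw [halfFourier]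
    refine integral_congr_ae ?_
    filter_upwards [hA.psiFun_ae_eq hHS hu] with y hy
    rw [hy]
    congr 2
    ring

lemma integral_psiFun_mul_exp (z : ℝ) :
    ∫ t, (psiFun A s t : ℂ) * Complex.exp (Complex.I * z * t) =
      Complex.exp (-Complex.I * s * z) * (∫ t, (A t : ℂ) * Complex.exp (Complex.I * z * t)) *
        halfFourier (phiFun A s) (-z) := by
  have := integral_halfConv_mul_exp hA.hankelSymbol_self (hA.integrable_phiFun hHS hu).restrict s z
  refine Eq.trans this ?_
  congr 1
  rw [halfFourier]
  refine integral_congr_ae (ae_of_all _ fun y => ?_)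
  simp only []
  congr 2
  ring

omit hA hHS hu in
lemma conj_reflection (z : ℝ) : starRingEnd ℂ (reflection A z) =
    Complex.I * ∫ t, (A t : ℂ) * Complex.exp (Complex.I * z * t) := by
  rw [reflection, map_mul, map_neg, Complex.conj_I, neg_neg, ← integral_conj]
  congr 1
  refine integral_congr_ae (ae_of_all _ fun t => ?_)
  simp only [map_mul, Complex.conj_ofReal, ← Complex.exp_conj, map_neg, Complex.conj_I, neg_neg]
  ring

/-- Each full-line transform is the sum of a boundary value from above and one from below. The
transforms of φ and ψ at z and at -z give four scalar relations, which imply the four entries of the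
matrix identity. -/
lemma upperX_eq_lowerX_mul (z : ℝ) :
    upperX A s z = lowerX A s z * jumpMatrix (reflection A) s z := by
  set P := halfFourier (phiFun A s) z with hP
  set P' := halfFourier (fun t => phiFun A s (-t)) z with hP'
  set S := halfFourier (psiFun A s) z with hS
  set S' := halfFourier (fun t => psiFun A s (-t)) z with hS'
  set Q := halfFourier (phiFun A s) (-z) with hQ
  set Q' := halfFourier (fun t => phiFun A s (-t)) (-z) with hQ'
  set T := halfFourier (psiFun A s) (-z) with hT
  set T' := halfFourier (fun t => psiFun A s (-t)) (-z) with hT'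
  set F := Complex.exp (-Complex.I * s * z) * ∫ t, (A t : ℂ) * Complex.exp (Complex.I * z * t)
    with hF
  set G := Complex.exp (Complex.I * s * z) * ∫ t, (A t : ℂ) * Complex.exp (-Complex.I * z * t)
    with hG
  have hφ := hA.integrable_phiFun hHS hu
  have hψ := hA.integrable_psiFun hHS hu
  have c : ((-z : ℝ) : ℂ) = -z := by push_cast; rfl
  have e1 : P + Q' = F * (1 + T) := by
    rw [hP, hQ', ← integral_mul_exp_eq hφ, hA.integral_phiFun_mul_exp hHS hu]
  have e2 : S + T' = F * Q := by
    rw [hS, hT', ← integral_mul_exp_eq hψ, hA.integral_psiFun_mul_exp hHS hu]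
  have e3 : Q + P' = G * (1 + S) := by
    have h1 := integral_mul_exp_eq hφ (-z)
    rw [hA.integral_phiFun_mul_exp hHS hu] at h1
    simp only [c, neg_neg, mul_neg, neg_mul] at h1 hG
    rw [hQ, hP', ← h1, hG, hS]
  have e4 : T + S' = G * P := by
    have h1 := integral_mul_exp_eq hψ (-z)
    rw [hA.integral_psiFun_mul_exp hHS hu] at h1
    simp only [c, neg_neg, mul_neg, neg_mul] at h1 hG
    rw [hT, hS', ← h1, hG, hP]
  -- F and G are the transforms of A at z and at -z with the phases e^{∓isz}. In these terms the
  -- jump matrix is [[1 - FG, -iF], [-iG, 1]].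
  have r1 : starRingEnd ℂ (reflection A z) * Complex.exp (-Complex.I * s * z) =
      Complex.I * F := by rw [conj_reflection, hF]; ring
  have r2 : reflection A z * Complex.exp (Complex.I * s * z) = -(Complex.I * G) := by
    rw [hG, reflection]
    simp_rw [mul_comm (Complex.exp _) (A _ : ℂ)]
    ring
  have r3 : ((‖reflection A z‖ ^ 2 : ℝ) : ℂ) = F * G := by
    have h0 : Complex.exp (-Complex.I * s * z) * Complex.exp (Complex.I * s * z) = 1 := by
      rw [← Complex.exp_add]; simp
    have h1 : ((‖reflection A z‖ ^ 2 : ℝ) : ℂ) = reflection A z * starRingEnd ℂ (reflection A z) := by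
      rw [Complex.mul_conj, Complex.normSq_eq_norm_sq]
    have h2 : reflection A z * starRingEnd ℂ (reflection A z) =
      (reflection A z * Complex.exp (Complex.I * s * z)) *
        (starRingEnd ℂ (reflection A z) * Complex.exp (-Complex.I * s * z)) := by
      linear_combination -(reflection A z * starRingEnd ℂ (reflection A z)) * h0
    rw [h1, h2, r1, r2]
    linear_combination -(F * G) * Complex.I_sq
  rw [jumpMatrix, r3, neg_mul, r1, r2, upperX, lowerX, Matrix.mul_fin_two]
  have hI := Complex.I_sq
  congr 1
  ext i j
  fin_cases i <;> fin_cases j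
  · change 1 - S' = (1 + T) * (1 - F * G) + Complex.I * Q' * -(Complex.I * G)
    linear_combination -e4 + (-G) * e1 + Q' * G * hI
  · change -(Complex.I * P) = (1 + T) * -(Complex.I * F) + Complex.I * Q' * 1
    linear_combination -Complex.I * e1
  · change -(Complex.I * P') = Complex.I * Q * (1 - F * G) + (1 - T') * -(Complex.I * G)
    linear_combination -Complex.I * e3 - Complex.I * G * e2
  · change 1 + S = Complex.I * Q * -(Complex.I * F) + (1 - T') * 1
    linear_combination e2 + Q * F * hI

/-! ### The expansion at infinity and verification of the Riemann–Hilbert problem -/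

lemma hasLaurentExpansion_explicitX : HasLaurentExpansion (explicitX A s) (laurentCoeff A s) := by
  intro N
  have hφ : ∀ ζ : ℂ, ζ ≠ 0 → _ := fun ζ hζ => norm_derivResolvent_add_sum_le
    (hA.hasDerivAt_phiDeriv hHS hu) (hA.integrable_phiDeriv hHS hu) hζ N
  have hψ : ∀ ζ : ℂ, ζ ≠ 0 → _ := fun ζ hζ => norm_derivResolvent_add_sum_le
    (hA.hasDerivAt_psiDeriv hHS hu) (hA.integrable_psiDeriv hHS hu) hζ N
  simp_rw [hA.phiDeriv_apply_zero, phiDeriv_zero] at hφ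
  simp_rw [hA.psiDeriv_apply_zero hHS hu, psiDeriv_zero] at hψ
  -- The first column of X involves the resolvent at ζ = -z and the second at ζ = z, whence the
  -- powers of -i in one and of i in the other.
  have key : ∀ i j, ∃ C : ℝ, ∀ z : ℂ, z ≠ 0 →
      ‖(explicitX A s z - ∑ l ∈ Finset.range (N + 1), (z⁻¹ ^ l) • laurentCoeff A s l) i j‖ ≤
        C * ‖z⁻¹ ^ (N + 1)‖ := by
    have e : ∀ (z : ℂ) i j, (∑ l ∈ Finset.range (N + 1), (z⁻¹ ^ l) • laurentCoeff A s l) i j =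
        (∑ p ∈ Finset.range N, z⁻¹ ^ (p + 1) * laurentCoeff A s (p + 1) i j) +
          (1 : Matrix (Fin 2) (Fin 2) ℂ) i j := fun z i j => by
      rw [Finset.sum_range_succ', Matrix.add_apply, Matrix.sum_apply]
      simp [laurentCoeff]
    have hn : ∀ z : ℂ, ‖(-z)⁻¹ ^ (N + 1)‖ = ‖z⁻¹ ^ (N + 1)‖ := fun z => by
      rw [norm_pow, norm_pow, inv_neg, norm_neg]
    intro i j
    fin_cases i <;> fin_cases j
    · refine ⟨_, fun z hz => (le_of_eq ?_).trans ((hψ (-z) (neg_ne_zero.2 hz)).trans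
        (le_of_eq (by rw [hn])))⟩
      rw [Matrix.sub_apply, e, explicitX_eq, ← norm_neg]
      congr 1
      change -((1 : ℂ) - _ - (_ + 1)) = _
      rw [sub_add_eq_sub_sub, neg_sub, sub_sub_eq_add_sub, sub_sub_eq_add_sub]
      rw [show ∀ a b : ℂ, 1 + b + a - 1 = a + b from fun a b => by ring]
      congr 1
      refine Finset.sum_congr rfl fun p _ => ?_
      change _ * ((-Complex.I) ^ (p + 1) * (uFun A p s : ℂ)) = _
      rw [inv_neg, ← mul_assoc, ← mul_pow]
      ring
    · refine ⟨_, fun z hz => (le_of_eq ?_).trans (hφ z hz)⟩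
      rw [Matrix.sub_apply, e, explicitX_eq]
      change ‖Complex.I * _ - (_ + 0)‖ = _
      rw [add_zero, ← one_mul ‖derivResolvent _ _ _ + _‖, ← Complex.norm_I, ← norm_mul, mul_add,
        sub_eq_add_neg, ← Finset.sum_neg_distrib, Finset.mul_sum]
      congr 2
      refine Finset.sum_congr rfl fun p _ => ?_
      change -(_ * (Complex.I ^ p * (qFun A p s : ℂ))) = _
      rw [mul_pow, pow_succ Complex.I]
      linear_combination -(z⁻¹ ^ (p + 1) * Complex.I ^ p * (qFun A p s : ℂ)) * Complex.I_sq
    · refine ⟨_, fun z hz => (le_of_eq ?_).trans ((hφ (-z) (neg_ne_zero.2 hz)).trans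
        (le_of_eq (by rw [hn])))⟩
      rw [Matrix.sub_apply, e, explicitX_eq, ← norm_neg]
      change ‖-(-(Complex.I * _) - (_ + 0))‖ = _
      rw [add_zero, ← one_mul ‖derivResolvent _ _ _ + _‖, ← Complex.norm_I, ← norm_mul, mul_add,
        neg_sub, sub_neg_eq_add, add_comm, Finset.mul_sum]
      congr 2
      refine Finset.sum_congr rfl fun p _ => ?_
      change _ * ((-Complex.I) ^ p * (qFun A p s : ℂ)) = _
      rw [inv_neg, mul_neg, ← neg_mul, mul_pow, pow_succ (-Complex.I)]
      linear_combination (z⁻¹ ^ (p + 1) * (-Complex.I) ^ p * (qFun A p s : ℂ)) * Complex.I_sq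
    · refine ⟨_, fun z hz => (le_of_eq ?_).trans (hψ z hz)⟩
      rw [Matrix.sub_apply, e, explicitX_eq, ← norm_neg]
      congr 1
      change -((1 : ℂ) - _ - (_ + 1)) = _
      rw [sub_add_eq_sub_sub, neg_sub, sub_sub_eq_add_sub, sub_sub_eq_add_sub]
      rw [show ∀ a b : ℂ, 1 + b + a - 1 = a + b from fun a b => by ring]
      congr 1
      refine Finset.sum_congr rfl fun p _ => ?_
      change _ * (Complex.I ^ (p + 1) * (uFun A p s : ℂ)) = _
      ring
  intro i j
  obtain ⟨C, hC⟩ := key i j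
  refine IsBigO.of_bound C (mem_inf_of_right fun z hz => hC z ?_)
  rintro rfl
  exact hz rfl

lemma solvesRHP_explicitX : SolvesZakharovShabatRHP (reflection A) s (explicitX A s) where
  analytic := hA.analyticOnNhd_explicitX hHS hu
  upper_extension := ⟨upperX A s, hA.continuousOn_upperX hHS hu,
    fun _ hz => (explicitX_of_pos A s hz).symm⟩
  lower_extension := ⟨lowerX A s, hA.continuousOn_lowerX hHS hu,
    fun _ hz => (explicitX_of_neg A s hz).symm⟩
  jump := fun z => by
    refine ⟨upperX A s z, lowerX A s z, ?_, ?_, hA.upperX_eq_lowerX_mul hHS hu z⟩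
    · have h1 : Tendsto (fun ε : ℝ => (z : ℂ) + Complex.I * ε) (𝓝[>] 0)
          (𝓝[{w : ℂ | 0 ≤ w.im}] (z : ℂ)) := by
        refine tendsto_nhdsWithin_iff.2 ⟨?_, ?_⟩
        · have : Continuous fun ε : ℝ => (z : ℂ) + Complex.I * ε := by fun_prop
          simpa using (this.tendsto 0).mono_left nhdsWithin_le_nhds
        · filter_upwards [self_mem_nhdsWithin] with ε hε
          simpa using le_of_lt hε
      refine (((hA.continuousOn_upperX hHS hu) z (by simp)).tendsto.comp h1).congr' ?_
      filter_upwards [self_mem_nhdsWithin] with ε hε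
      exact (explicitX_of_pos A s (by simpa using hε)).symm
    · have h1 : Tendsto (fun ε : ℝ => (z : ℂ) - Complex.I * ε) (𝓝[>] 0)
          (𝓝[{w : ℂ | w.im ≤ 0}] (z : ℂ)) := by
        refine tendsto_nhdsWithin_iff.2 ⟨?_, ?_⟩
        · have : Continuous fun ε : ℝ => (z : ℂ) - Complex.I * ε := by fun_prop
          simpa using (this.tendsto 0).mono_left nhdsWithin_le_nhds
        · filter_upwards [self_mem_nhdsWithin] with ε hε
          simpa using le_of_lt hε
      refine (((hA.continuousOn_lowerX hHS hu) z (by simp)).tendsto.comp h1).congr' ?_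
      filter_upwards [self_mem_nhdsWithin] with ε hε
      exact (explicitX_of_neg A s (by simpa using hε)).symm
  normalization := ⟨laurentCoeff A s 1, laurentCoeff A s 2, fun i j => by
    have := hA.hasLaurentExpansion_explicitX hHS hu 2 i j
    simpa [Finset.sum_range_succ, laurentCoeff] using this⟩

end SmoothIntegrable

/-! ### Finite-rank projections -/

/-- Orthonormal vectors are at distance √2, so balls of radius 1/2 about them are disjoint, and
separability allows only countably many. Countability makes the filter of finite index sets
countably generated, as dominated convergence requires. -/
lemma exists_countable_hilbertBasis (E : Type*) [NormedAddCommGroup E] [InnerProductSpace ℝ E]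
    [CompleteSpace E] [SecondCountableTopology E] :
    ∃ (w : Set E) (_ : HilbertBasis w ℝ E), Countable w := by
  obtain ⟨w, b, hb⟩ := exists_hilbertBasis ℝ E
  refine ⟨w, b, ?_⟩
  have ho : Orthonormal ℝ ((↑) : w → E) := hb ▸ b.orthonormal
  have hd : (univ : Set w).PairwiseDisjoint fun x : w => Metric.ball (x : E) (1 / 2) := by
    intro x _ y _ hxy
    refine Metric.ball_disjoint_ball ?_
    have h1 : ‖(x : E) - y‖ ^ 2 = 2 := by
      rw [norm_sub_sq_real, ho.2 hxy, ho.1, ho.1]; norm_num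
    rw [dist_eq_norm]
    nlinarith [norm_nonneg ((x : E) - y)]
  have := hd.countable_of_isOpen (fun x _ => Metric.isOpen_ball)
    (fun x _ => ⟨x, Metric.mem_ball_self (by norm_num)⟩)
  exact countable_univ_iff.1 this

section FinProj

variable {E ι : Type*} [NormedAddCommGroup E] [InnerProductSpace ℝ E]

/-- The orthogonal projection on the span of finitely many vectors of a Hilbert basis. -/
noncomputable def finProj (b : HilbertBasis ι ℝ E) (F : Finset ι) : E →L[ℝ] E :=
  ∑ k ∈ F, (innerSL ℝ (b k)).smulRight (b k)

variable (b : HilbertBasis ι ℝ E)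

lemma finProj_apply (F : Finset ι) (u : E) :
    finProj b F u = ∑ k ∈ F, inner ℝ (b k) u • b k := by
  simp [finProj]

lemma tendsto_finProj (u : E) : Tendsto (fun F => finProj b F u) atTop (𝓝 u) := by
  have h := b.hasSum_repr u
  simp only [b.repr_apply_apply] at h
  simp_rw [finProj_apply]
  exact h

lemma inner_finProj (F : Finset ι) (u v : E) :
    inner ℝ (finProj b F u) v = ∑ k ∈ F, inner ℝ (b k) u * inner ℝ (b k) v := by
  rw [finProj_apply, sum_inner]
  simp_rw [real_inner_smul_left]

lemma inner_basis_finProj {F : Finset ι} {k : ι} (hk : k ∈ F) (u : E) :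
    inner ℝ (b k) (finProj b F u) = inner ℝ (b k) u := by
  classical
  rw [finProj_apply, inner_sum]
  simp_rw [inner_smul_right, orthonormal_iff_ite.1 b.orthonormal]
  simp [hk]

lemma inner_finProj_finProj (F : Finset ι) (u v : E) :
    inner ℝ (finProj b F u) (finProj b F v) = inner ℝ (finProj b F u) v := by
  rw [inner_finProj, inner_finProj]
  exact Finset.sum_congr rfl fun k hk => by rw [inner_basis_finProj b hk]

lemma norm_finProj_le (F : Finset ι) (u : E) : ‖finProj b F u‖ ≤ ‖u‖ := by
  have h1 : ‖finProj b F u‖ * ‖finProj b F u‖ ≤ ‖finProj b F u‖ * ‖u‖ := by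
    rw [← pow_two, ← real_inner_self_eq_norm_sq, inner_finProj_finProj]
    exact real_inner_le_norm _ _
  rcases eq_or_lt_of_le (norm_nonneg (finProj b F u)) with h | h
  · rw [← h]; exact norm_nonneg u
  · exact le_of_mul_le_mul_left h1 h

lemma isCompactOperator_finProj (F : Finset ι) : IsCompactOperator (finProj b F) := by
  classical
  induction F using Finset.induction_on with
  | empty => simpa [finProj] using isCompactOperator_zero
  | insert k F hk ih =>
    have h1 : IsCompactOperator ((innerSL ℝ (b k)).smulRight (b k)) :=
      (isCompactOperator_of_locallyCompactSpace_rng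
        (ContinuousLinearMap.toSpanSingleton ℝ (b k))).comp_clm (innerSL ℝ (b k))
    have h2 : finProj b (insert k F) = (innerSL ℝ (b k)).smulRight (b k) + finProj b F := by
      rw [finProj, Finset.sum_insert hk, finProj]
    rw [h2]
    exact h1.add ih

end FinProj

/-! ### Compactness and the spectral gap -/

lemma norm_sq_eq_integral (f : L2R) : ‖f‖ ^ 2 = ∫ x in Ioi (0 : ℝ), f x ^ 2 := by
  rw [← real_inner_self_eq_norm_sq, inner_eq_integral]
  simp_rw [pow_two]

namespace SmoothIntegrable

variable {A : ℝ → ℝ} (hA : SmoothIntegrable A) {t : ℝ}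
  (hHS : HilbertSchmidtKernel (hankelKernel A t))
include hA hHS

/-- The difference has rows v_x - P v_x with P the finite projection; the bound is its
Hilbert–Schmidt norm. -/
lemma norm_opA_sub_comp_le {ι : Type*} (b : HilbertBasis ι ℝ L2R) (F : Finset ι) :
    ‖opA A t - opA A t ∘L finProj b F‖ ≤
      Real.sqrt (∫ x in Ioi t, ‖ketA A 0 x - finProj b F (ketA A 0 x)‖ ^ 2) := by
  have hc : Continuous fun x => ketA A 0 x - finProj b F (ketA A 0 x) :=
    (hA.continuous_ketA 0).sub ((finProj b F).continuous.comp (hA.continuous_ketA 0))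
  have hi : IntegrableOn (fun x => ‖ketA A 0 x - finProj b F (ketA A 0 x)‖ ^ 2) (Ioi t) := by
    refine (((hA.hilbertSchmidt_iff t).1 hHS).const_mul 4).mono'
      (hc.norm.pow 2).aestronglyMeasurable (ae_of_all _ fun x => ?_)
    rw [Real.norm_eq_abs, abs_of_nonneg (sq_nonneg _), show (4 : ℝ) = 2 ^ 2 by norm_num, ← mul_pow]
    gcongr
    refine (norm_sub_le _ _).trans ?_
    linarith [norm_finProj_le b F (ketA A 0 x)]
  refine ContinuousLinearMap.opNorm_le_bound _ (Real.sqrt_nonneg _) fun f => ?_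
  refine abs_le_of_sq_le_sq' ?_ (by positivity) |>.2
  rw [mul_pow, Real.sq_sqrt (integral_nonneg fun _ => sq_nonneg _), norm_sq_eq_integral]
  have e : (opA A t - opA A t ∘L finProj b F) f =ᵐ[halfLine]
      fun x => inner ℝ (ketA A 0 (x + t) - finProj b F (ketA A 0 (x + t))) f := by
    have e1 : (opA A t - opA A t ∘L finProj b F) f = opA A t f - opA A t (finProj b F f) := rfl
    rw [e1]
    filter_upwards [Lp.coeFn_sub (opA A t f) (opA A t (finProj b F f)), hA.opA_apply_ae hHS f,
      hA.opA_apply_ae hHS (finProj b F f)] with x h1 h2 h3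
    rw [h1, Pi.sub_apply, h2, h3, inner_sub_left, inner_finProj,
      real_inner_comm (finProj b F f), inner_finProj]
    congr 1
    exact Finset.sum_congr rfl fun k _ => mul_comm _ _
  calc _ = ∫ x in Ioi (0 : ℝ),
        inner ℝ (ketA A 0 (x + t) - finProj b F (ketA A 0 (x + t))) f ^ 2 := by
        refine integral_congr_ae ?_
        filter_upwards [e] with x hx
        rw [hx]
    _ = ∫ x in Ioi t, inner ℝ (ketA A 0 x - finProj b F (ketA A 0 x)) f ^ 2 :=
        integral_Ioi_zero_comp_add
          (fun x => inner ℝ (ketA A 0 x - finProj b F (ketA A 0 x)) f ^ 2) t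
    _ ≤ ∫ x in Ioi t, ‖ketA A 0 x - finProj b F (ketA A 0 x)‖ ^ 2 * ‖f‖ ^ 2 := by
        refine integral_mono_of_nonneg (ae_of_all _ fun _ => sq_nonneg _) (hi.mul_const _)
          (ae_of_all _ fun x => ?_)
        simp only []
        rw [← mul_pow, ← sq_abs]
        gcongr
        exact abs_real_inner_le_norm _ _
    _ = _ := integral_mul_const _ _

/-- A_t is the norm limit of the finite-rank operators A_t P: the Hilbert–Schmidt error tends to 0
by dominated convergence, with majorant 4‖v_x‖² from ‖v - Pv‖ ≤ 2‖v‖. -/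
lemma isCompactOperator_opA : IsCompactOperator (opA A t) := by
  have : Fact ((2 : ENNReal) ≠ ⊤) := ⟨ENNReal.ofNat_ne_top⟩
  obtain ⟨w, b, hw⟩ := exists_countable_hilbertBasis L2R
  have h1 : Tendsto (fun F => ∫ x in Ioi t, ‖ketA A 0 x - finProj b F (ketA A 0 x)‖ ^ 2) atTop
      (𝓝 (∫ x in Ioi t, (0 : ℝ))) := by
    refine tendsto_integral_filter_of_dominated_convergence
      (fun x => 4 * ‖ketA A 0 x‖ ^ 2) (Eventually.of_forall fun F => ?_)
      (Eventually.of_forall fun F => ae_of_all _ fun x => ?_)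
      (((hA.hilbertSchmidt_iff t).1 hHS).const_mul 4) (ae_of_all _ fun x => ?_)
    · exact (((hA.continuous_ketA 0).sub
        ((finProj b F).continuous.comp (hA.continuous_ketA 0))).norm.pow 2).aestronglyMeasurable
    · rw [Real.norm_eq_abs, abs_of_nonneg (sq_nonneg _), show (4 : ℝ) = 2 ^ 2 by norm_num,
        ← mul_pow]
      gcongr
      refine (norm_sub_le _ _).trans ?_
      linarith [norm_finProj_le b F (ketA A 0 x)]
    · have := ((tendsto_finProj b (ketA A 0 x)).const_sub (ketA A 0 x)).norm.pow 2
      simpa using this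
  have h2 : Tendsto (fun F => opA A t ∘L finProj b F) atTop (𝓝 (opA A t)) := by
    rw [tendsto_iff_norm_sub_tendsto_zero]
    refine squeeze_zero (fun _ => norm_nonneg _) (fun F => ?_)
      (by simpa using (Real.continuous_sqrt.tendsto _).comp h1)
    rw [norm_sub_rev]
    exact hA.norm_opA_sub_comp_le hHS b F
  exact isCompactOperator_of_tendsto h2
    (Eventually.of_forall fun F => (isCompactOperator_finProj b F).clm_comp (opA A t))

lemma isCompactOperator_opK : IsCompactOperator (opK A t) :=
  (hA.isCompactOperator_opA hHS).clm_comp (opA A t)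

lemma norm_opA_apply_le (hK : opK A t ≤ 1) (f : L2R) : ‖opA A t f‖ ≤ ‖f‖ := by
  have h := ((ContinuousLinearMap.le_def _ _).1 hK).2 f
  have e : (1 - opK A t).reApplyInnerSelf f = ‖f‖ ^ 2 - ‖opA A t f‖ ^ 2 := by
    rw [ContinuousLinearMap.reApplyInnerSelf_apply]
    have : (1 - opK A t) f = f - opA A t (opA A t f) := rfl
    rw [this, inner_sub_left, hA.inner_opA_left hHS, real_inner_self_eq_norm_sq,
      real_inner_self_eq_norm_sq]
    rfl
  rw [e] at h
  exact abs_le_of_sq_le_sq' (by linarith) (norm_nonneg _) |>.2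

/-- For g = (I - K_t) f, expanding the square and using ‖A_t² f‖ ≤ ‖A_t f‖ gives ‖g‖² ≤ ‖f‖² - ‖A_t
f‖². Invertibility bounds ‖g‖ below by ‖f‖/M, so ‖A_t‖² ≤ 1 - M⁻². -/
lemma norm_opA_lt_one (hK : opK A t ≤ 1) (hu : IsUnit (1 - opK A t)) : ‖opA A t‖ < 1 := by
  -- The maximum with 1 keeps 1 - M⁻² nonnegative under the square root.
  set M := max ‖resolventK A t‖ 1 with hM
  have hM1 : 1 ≤ M := le_max_right _ _
  have hM0 : 0 < M := by linarith
  have key : ∀ f, ‖opA A t f‖ ^ 2 ≤ (1 - (M⁻¹) ^ 2) * ‖f‖ ^ 2 := fun f => by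
    set g := f - opA A t (opA A t f) with hg
    have h1 : ‖f‖ ≤ M * ‖g‖ := by
      have : f = resolventK A t g := (resolventK_sub_opK hu f).symm
      conv_lhs => rw [this]
      exact ((resolventK A t).le_opNorm g).trans (by gcongr; exact le_max_left _ _)
    have h2 : ‖g‖ ^ 2 ≤ ‖f‖ ^ 2 - ‖opA A t f‖ ^ 2 := by
      have h3 := hA.norm_opA_apply_le hHS hK (opA A t f)
      have h4 : inner ℝ f (opA A t (opA A t f)) = ‖opA A t f‖ ^ 2 := by
        rw [← hA.inner_opA_left hHS, real_inner_self_eq_norm_sq]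
      rw [hg, norm_sub_sq_real, h4]
      nlinarith [norm_nonneg (opA A t (opA A t f))]
    have h5 : (M⁻¹) ^ 2 * ‖f‖ ^ 2 ≤ ‖g‖ ^ 2 := by
      rw [← mul_pow]
      gcongr
      rwa [inv_mul_le_iff₀ hM0]
    linarith
  have h6 : ‖opA A t‖ ≤ Real.sqrt (1 - (M⁻¹) ^ 2) := by
    refine ContinuousLinearMap.opNorm_le_bound _ (Real.sqrt_nonneg _) fun f => ?_
    have h7 : 0 ≤ 1 - (M⁻¹) ^ 2 := by
      have : (M⁻¹) ^ 2 ≤ 1 := pow_le_one₀ (by positivity) (inv_le_one_of_one_le₀ hM1)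
      linarith
    refine abs_le_of_sq_le_sq' ?_ (by positivity) |>.2
    rw [mul_pow, Real.sq_sqrt h7]
    exact key f
  refine h6.trans_lt ?_
  rw [Real.sqrt_lt' one_pos]
  have : 0 < (M⁻¹) ^ 2 := by positivity
  linarith

omit hA hHS in
lemma isUnit_of_norm_opA_lt_one (h : ‖opA A t‖ < 1) : IsUnit (1 - opK A t) := by
  refine isUnit_one_sub_of_norm_lt_one ?_
  refine (norm_mul_le _ _).trans_lt ?_
  nlinarith [norm_nonneg (opA A t)]

end SmoothIntegrable

/-! ### Invertibility of `I - K_s` -/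

/-- The right translate of a function on the half-line. -/
noncomputable def rightShift (a : ℝ) (v : L2R) : L2R :=
  toL2 fun x => (Ioi (0 : ℝ)).indicator v (x - a)

lemma memLp_rightShift (a : ℝ) (v : L2R) :
    MemLp (fun x => (Ioi (0 : ℝ)).indicator v (x - a)) 2 := by
  have h1 : MemLp ((Ioi (0 : ℝ)).indicator v) 2 :=
    (memLp_indicator_iff_restrict measurableSet_Ioi).2 (Lp.memLp v)
  exact h1.comp_measurePreserving (measurePreserving_sub_right volume a)

lemma coeFn_rightShift (a : ℝ) (v : L2R) :
    rightShift a v =ᵐ[halfLine] fun x => (Ioi (0 : ℝ)).indicator v (x - a) :=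
  coeFn_toL2 ((memLp_rightShift a v).restrict _)

lemma ae_comp_sub_of_ae_Ioi {P : ℝ → Prop} {c d a : ℝ} (h : ∀ᵐ x, c < x → P x)
    (hcd : c + a ≤ d) : ∀ᵐ x, d < x → P (x - a) := by
  have := (measurePreserving_sub_right volume a).quasiMeasurePreserving.ae h
  filter_upwards [this] with x hx hd
  exact hx (by linarith)

namespace SmoothIntegrable

variable {A : ℝ → ℝ} (hA : SmoothIntegrable A)
include hA

/-- By additivity of the kernel, translating v to the right translates A v to the left. -/
lemma inner_ketA_rightShift {a : ℝ} (ha : 0 ≤ a) (x : ℝ) (v : L2R) :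
    inner ℝ (ketA A 0 x) (rightShift a v) = inner ℝ (ketA A 0 (x + a)) v := by
  rw [hA.inner_ketA, hA.inner_ketA]
  have e1 : ∫ y in Ioi (0 : ℝ), iteratedDeriv 0 A (x + y) * rightShift a v y =
      ∫ y in Ioi (0 : ℝ), iteratedDeriv 0 A (x + y) * (Ioi (0 : ℝ)).indicator v (y - a) := by
    refine integral_congr_ae ?_
    filter_upwards [coeFn_rightShift a v] with y hy
    rw [hy]
  have e2 : ∫ y in Ioi (0 : ℝ), iteratedDeriv 0 A (x + y) * (Ioi (0 : ℝ)).indicator v (y - a) =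
      ∫ y, iteratedDeriv 0 A (x + y) * (Ioi (0 : ℝ)).indicator v (y - a) := by
    refine setIntegral_eq_integral_of_forall_compl_eq_zero fun y hy => ?_
    have hy0 : y ≤ 0 := by simpa using hy
    rw [indicator_of_notMem (by simp only [mem_Ioi, not_lt]; linarith), mul_zero]
  rw [e1, e2, ← integral_add_right_eq_self _ a, ← integral_indicator measurableSet_Ioi]
  refine integral_congr_ae (ae_of_all _ fun y => ?_)
  simp only [add_sub_cancel_right]
  by_cases hy : y ∈ Ioi (0 : ℝ)
  · rw [indicator_of_mem hy, indicator_of_mem hy]; ring_nf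
  · rw [indicator_of_notMem hy, indicator_of_notMem hy, mul_zero]

variable (hHS : ∀ t, HilbertSchmidtKernel (hankelKernel A t)) {s t : ℝ} (hts : t < s)
  (hK : opK A t ≤ 1)
include hHS hts hK

/-- If `A_s` does not decrease the norm of `v`, then the function `A_s v` on `(t - s, ∞)` vanishes
outside the half-line. -/
lemma ae_inner_ketA_eq {v : L2R} (hv : ‖v‖ ≤ ‖opA A s v‖) :
    ∀ᵐ x, t - s < x → inner ℝ (ketA A 0 (x + s)) v = (Ioi (0 : ℝ)).indicator (opA A s v) x := by
  set g : ℝ → ℝ := fun x => inner ℝ (ketA A 0 x) v * inner ℝ (ketA A 0 x) v with hg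
  -- This reads ‖A_t v‖² ≤ ‖v‖² ≤ ‖A_s v‖². The left integral is over the larger domain and g ≥ 0,
  -- so g must vanish almost everywhere on (t, s].
  have h1 : ∫ x in Ioi t, g x ≤ ∫ x in Ioi s, g x := by
    rw [hg, ← hA.inner_opA_opA (hHS t), ← hA.inner_opA_opA (hHS s), real_inner_self_eq_norm_sq,
      real_inner_self_eq_norm_sq]
    have := (hA.norm_opA_apply_le (hHS t) hK v).trans hv
    gcongr
  have hi := hA.integrableOn_inner_mul_inner (hHS t) v v
  have h2 : ∫ x in Ioc t s, g x = 0 := by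
    have h3 : ∫ x in Ioi t, g x = (∫ x in Ioc t s, g x) + ∫ x in Ioi s, g x := by
      rw [← Ioc_union_Ioi_eq_Ioi hts.le]
      exact setIntegral_union (Ioc_disjoint_Ioi le_rfl) measurableSet_Ioi
        (hi.mono_set Ioc_subset_Ioi_self) (hi.mono_set (Ioi_subset_Ioi hts.le))
    have h4 : 0 ≤ ∫ x in Ioc t s, g x := integral_nonneg fun x => mul_self_nonneg _
    linarith
  rw [integral_eq_zero_iff_of_nonneg (fun x => mul_self_nonneg _)
    (hi.mono_set Ioc_subset_Ioi_self)] at h2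
  have h5 : ∀ᵐ x, x ∈ Ioc t s → g x = 0 := (ae_restrict_iff' measurableSet_Ioc).1 h2
  have h6 := (measurePreserving_add_right volume s).quasiMeasurePreserving.ae h5
  have h7 : ∀ᵐ x, x ∈ Ioi (0 : ℝ) → opA A s v x = inner ℝ (ketA A 0 (x + s)) v :=
    (ae_restrict_iff' measurableSet_Ioi).1 (hA.opA_apply_ae (hHS s) v)
  filter_upwards [h6, h7] with x h8 h9 hx
  by_cases hx0 : x ∈ Ioi (0 : ℝ)
  · rw [indicator_of_mem hx0, h9 hx0]
  · rw [indicator_of_notMem hx0]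
    simp only [mem_Ioi, not_lt] at hx0
    exact mul_self_eq_zero.1 (h8 ⟨by linarith, by linarith⟩)

/-- (A v) evaluated at x + t + a is A_s v at x - (s - t - a), and the previous vanishing says that
this is 0 where the argument is not positive. -/
lemma opA_rightShift {v : L2R} (hv : ‖v‖ ≤ ‖opA A s v‖) {a : ℝ} (ha : 0 ≤ a) :
    opA A t (rightShift a v) = rightShift (s - t - a) (opA A s v) := by
  refine Lp.ext ?_
  have h1 := ae_comp_sub_of_ae_Ioi (d := 0) (a := s - t - a)
    (hA.ae_inner_ketA_eq hHS hts hK hv) (by linarith)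
  filter_upwards [hA.opA_apply_ae (hHS t) (rightShift a v),
    coeFn_rightShift (s - t - a) (opA A s v), ae_restrict_of_ae h1,
    ae_restrict_mem measurableSet_Ioi] with x h2 h3 h4 h5
  rw [h2, h3, ← h4 h5, hA.inner_ketA_rightShift ha]
  congr 2
  ring

/-- Two applications of A_t change the shift a into s - t - a and back to a; both shifts must be
nonnegative. -/
lemma opK_rightShift {v : L2R} (hv : opK A s v = v) {a : ℝ} (ha : 0 ≤ a) (ha' : a ≤ s - t) :
    opK A t (rightShift a v) = rightShift a v := by
  have h1 : ‖opA A s v‖ = ‖v‖ := by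
    have : ‖opA A s v‖ ^ 2 = ‖v‖ ^ 2 := by
      rw [← real_inner_self_eq_norm_sq, hA.inner_opA_left (hHS s), ← real_inner_self_eq_norm_sq]
      congr 1
    exact (sq_eq_sq₀ (norm_nonneg _) (norm_nonneg _)).1 this
  have h2 : opA A s (opA A s v) = v := hv
  change opA A t (opA A t (rightShift a v)) = _
  rw [hA.opA_rightShift hHS hts hK h1.ge ha,
    hA.opA_rightShift hHS hts hK (by rw [h2, h1]) (by linarith), h2, sub_sub_cancel]

end SmoothIntegrable

/-- The functions in `L²(ℝ₊)` that vanish on `(0, c)`. -/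
noncomputable def vanishBelow (c : ℝ) : Submodule ℝ L2R where
  carrier := {g | ∀ᵐ x ∂halfLine, x < c → g x = 0}
  add_mem' := fun {f g} hf hg => by
    filter_upwards [hf, hg, Lp.coeFn_add f g] with x h1 h2 h3 hx
    rw [h3, Pi.add_apply, h1 hx, h2 hx, add_zero]
  zero_mem' := by
    filter_upwards [Lp.coeFn_zero ℝ 2 halfLine] with x hx _
    rw [hx]; rfl
  smul_mem' := fun r f hf => by
    filter_upwards [hf, Lp.coeFn_smul r f] with x h1 h2 hx
    rw [h2, Pi.smul_apply, h1 hx, smul_zero]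

lemma mem_vanishBelow {c : ℝ} {g : L2R} :
    g ∈ vanishBelow c ↔ ∀ᵐ x ∂halfLine, x < c → g x = 0 := Iff.rfl

lemma rightShift_mem_vanishBelow {a c d : ℝ} (had : d ≤ c + a) {v : L2R}
    (hv : v ∈ vanishBelow c) : rightShift a v ∈ vanishBelow d := by
  rw [mem_vanishBelow, ae_restrict_iff' measurableSet_Ioi] at hv
  have h1 := (measurePreserving_sub_right volume a).quasiMeasurePreserving.ae hv
  filter_upwards [coeFn_rightShift a v, ae_restrict_of_ae h1] with x h2 h3 hx
  rw [h2]
  by_cases h4 : x - a ∈ Ioi (0 : ℝ)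
  · rw [indicator_of_mem h4]; exact h3 h4 (by linarith)
  · exact indicator_of_notMem h4 _

lemma mem_vanishBelow_of_rightShift {a c : ℝ} (ha : 0 ≤ a) {v : L2R}
    (hv : rightShift a v ∈ vanishBelow (c + a)) : v ∈ vanishBelow c := by
  rw [mem_vanishBelow, ae_restrict_iff' measurableSet_Ioi] at hv
  have h0 := (ae_restrict_iff' measurableSet_Ioi).1 (coeFn_rightShift a v)
  have h1 := (measurePreserving_add_right volume a).quasiMeasurePreserving.ae (hv.and h0)
  filter_upwards [ae_restrict_of_ae h1, ae_restrict_mem measurableSet_Ioi] with x h2 h3 hx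
  have h4 : x + a ∈ Ioi (0 : ℝ) := add_pos_of_pos_of_nonneg h3 ha
  have h5 := h2.2 h4
  rw [h2.1 h4 (by linarith), add_sub_cancel_right, indicator_of_mem h3] at h5
  exact h5.symm

lemma eq_zero_of_forall_mem_vanishBelow {v : L2R} {δ : ℝ} (hδ : 0 < δ)
    (h : ∀ n : ℕ, v ∈ vanishBelow (n * δ)) : v = 0 := by
  refine Lp.ext ?_
  have h1 := ae_all_iff.2 fun n : ℕ => mem_vanishBelow.1 (h n)
  filter_upwards [h1, Lp.coeFn_zero ℝ 2 halfLine] with x hx h0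
  obtain ⟨n, hn⟩ := exists_nat_gt (x / δ)
  rw [h0, hx n (by rwa [div_lt_iff₀ hδ] at hn)]
  rfl

/-- A function all of whose small right translates lie in a finite-dimensional space is zero. -/
lemma eq_zero_of_forall_rightShift_mem {E : Submodule ℝ L2R} [FiniteDimensional ℝ E] {v : L2R}
    {h : ℝ} (hh : 0 < h) (hE : ∀ a, 0 ≤ a → a ≤ h → rightShift a v ∈ E) : v = 0 := by
  -- A strictly increasing sequence in [0, h]. The spans of the translates by a in [c n, h] decrease
  -- inside the finite-dimensional E, so two consecutive ones coincide, and the translate by c n is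
  -- a combination of translates by at least c (n+1).
  set c : ℕ → ℝ := fun n => h * (1 - ((n : ℝ) + 1)⁻¹) with hc
  have hc_mono : StrictMono c := by
    refine strictMono_nat_of_lt_succ fun n => ?_
    simp only [hc]
    gcongr
    linarith
  have hc0 : ∀ n, 0 ≤ c n := fun n => mul_nonneg hh.le (sub_nonneg.2
    (inv_le_one_of_one_le₀ (by linarith [n.cast_nonneg (α := ℝ)])))
  have hch : ∀ n, c n ≤ h := fun n => by
    have : 0 ≤ ((n : ℝ) + 1)⁻¹ := by positivity
    simp only [hc]
    nlinarith
  set U : ℕ → Submodule ℝ L2R := fun n =>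
    Submodule.span ℝ ((fun a => rightShift a v) '' Icc (c n) h) with hU
  have hU_anti : Antitone U := fun m n hmn =>
    Submodule.span_mono (image_mono (Icc_subset_Icc_left (hc_mono.monotone hmn)))
  obtain ⟨n, hn⟩ := IsArtinian.monotone_stabilizes (R := ℝ) (M := E)
    ⟨fun n => OrderDual.toDual ((U n).comap E.subtype),
      fun m n hmn => OrderDual.toDual_le_toDual.2 (Submodule.comap_mono (hU_anti hmn))⟩
  have h1 : (U n).comap E.subtype = (U (n + 1)).comap E.subtype := hn (n + 1) n.le_succ
  have h2 : rightShift (c n) v ∈ U (n + 1) := by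
    have h3 : (⟨_, hE (c n) (hc0 n) (hch n)⟩ : E) ∈ (U n).comap E.subtype :=
      Submodule.subset_span ⟨c n, ⟨le_rfl, hch n⟩, rfl⟩
    rw [h1] at h3
    exact h3
  set δ := c (n + 1) - c n with hδ
  have hδ0 : 0 < δ := sub_pos.2 (hc_mono n.lt_succ_self)
  -- If v vanishes below mδ, all those larger translates vanish below mδ + c (n+1). So does the
  -- translate by c n, which means that v vanishes below (m+1)δ.
  refine eq_zero_of_forall_mem_vanishBelow hδ0 fun m => ?_
  induction m with
  | zero =>
    rw [mem_vanishBelow]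
    filter_upwards [ae_restrict_mem measurableSet_Ioi] with x hx hx'
    simp only [Nat.cast_zero, zero_mul] at hx'
    exact absurd hx' (not_lt.2 (le_of_lt hx))
  | succ m ih =>
    refine mem_vanishBelow_of_rightShift (hc0 n) ?_
    refine (Submodule.span_le.2 ?_ : U (n + 1) ≤ _) h2
    rintro _ ⟨a, ha, rfl⟩
    refine rightShift_mem_vanishBelow ?_ ih
    have := ha.1
    push_cast
    linarith

/-- T restricts to the identity of its fixed space, so that identity is compact, and Riesz's theorem
applies. -/
lemma finiteDimensional_ker_one_sub {E : Type*} [NormedAddCommGroup E] [NormedSpace ℝ E]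
    [CompleteSpace E] {T : E →L[ℝ] E} (hT : IsCompactOperator T) :
    FiniteDimensional ℝ (1 - T).ker := by
  have hV : ∀ v ∈ (1 - T).ker, (T : E →ₗ[ℝ] E) v ∈ (1 - T).ker := fun v hv => by
    have : T v = v := by
      have h : v - T v = 0 := hv
      exact (sub_eq_zero.1 h).symm
    rwa [ContinuousLinearMap.coe_coe, this]
  have h1 := IsCompactOperator.restrict (f := (T : E →ₗ[ℝ] E)) hT hV
    (ContinuousLinearMap.isClosed_ker _)
  refine FiniteDimensional.of_isCompactOperator_id (𝕜 := ℝ) ?_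
  have e : (id : (1 - T).ker → (1 - T).ker) = (T : E →ₗ[ℝ] E).restrict hV :=
    funext fun v => Subtype.ext (by
      have h : (v : E) - T v = 0 := v.2
      exact sub_eq_zero.1 h)
  rw [e]
  exact h1

theorem SmoothIntegrable.isUnit_one_sub_opK {A : ℝ → ℝ} (hA : SmoothIntegrable A)
    (hHS : ∀ t, HilbertSchmidtKernel (hankelKernel A t)) {s t : ℝ} (hts : t < s)
    (hK : opK A t ≤ 1) : IsUnit (1 - opK A s) := by
  by_contra hu
  have h1 : (1 : ℝ) ∈ spectrum ℝ (opK A s) := by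
    rw [spectrum.mem_iff, map_one]; exact hu
  obtain ⟨v, hv⟩ := (((hA.isCompactOperator_opK (hHS s)).hasEigenvalue_iff_mem_spectrum
    one_ne_zero).2 h1).exists_hasEigenvector
  have hv1 : opK A s v = v := by simpa using hv.apply_eq_smul
  have := finiteDimensional_ker_one_sub (hA.isCompactOperator_opK (hHS t))
  refine hv.2 (eq_zero_of_forall_rightShift_mem (E := (1 - opK A t).ker) (sub_pos.2 hts)
    fun a ha ha' => ?_)
  have h2 := hA.opK_rightShift hHS hts hK hv1 ha ha'
  change rightShift a v - opK A t (rightShift a v) = 0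
  rw [h2, sub_self]

/-! ### Gram determinants -/

/-- The eigenvalues satisfy 0 ≤ λ ≤ e^{λ-1}, and the product of the right sides depends only on the
trace. -/
lemma Matrix.PosSemidef.det_le_one {n : Type*} [Fintype n] [DecidableEq n]
    {M : Matrix n n ℝ} (hM : M.PosSemidef) (htr : M.trace ≤ Fintype.card n) : M.det ≤ 1 := by
  have h1 : M.det = ∏ i, hM.isHermitian.eigenvalues i := by
    simpa using hM.isHermitian.det_eq_prod_eigenvalues
  have h2 : M.trace = ∑ i, hM.isHermitian.eigenvalues i := by
    simpa using hM.isHermitian.trace_eq_sum_eigenvalues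
  rw [h1]
  calc _ ≤ ∏ i, Real.exp (hM.isHermitian.eigenvalues i - 1) :=
        Finset.prod_le_prod (fun i _ => hM.eigenvalues_nonneg i)
          (fun i _ => by linarith [Real.add_one_le_exp (hM.isHermitian.eigenvalues i - 1)])
    _ = Real.exp (M.trace - Fintype.card n) := by
        rw [← Real.exp_sum, Finset.sum_sub_distrib, ← h2]; simp
    _ ≤ 1 := Real.exp_le_one_iff.2 (by linarith)

section Gram

variable {E : Type*} [NormedAddCommGroup E] [InnerProductSpace ℝ E]
  {n : Type*} [Fintype n] [DecidableEq n]

lemma det_gram_nonneg (v : n → E) : 0 ≤ (Matrix.of fun i j => inner ℝ (v i) (v j)).det :=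
  (Matrix.posSemidef_gram (𝕜 := ℝ) v).det_nonneg

/-- Hadamard's inequality for Gram determinants. -/
lemma det_gram_le (v : n → E) :
    (Matrix.of fun i j => inner ℝ (v i) (v j)).det ≤ ∏ i, ‖v i‖ ^ 2 := by
  by_cases h : ∃ i, v i = 0
  · obtain ⟨i, hi⟩ := h
    rw [Matrix.det_eq_zero_of_row_eq_zero i (fun j => by simp [hi])]
    positivity
  · push Not at h
    -- Normalized vectors give a Gram matrix with unit diagonal, whose trace is the size of the
    -- matrix.
    set e : n → E := fun i => ‖v i‖⁻¹ • v i with he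
    have h1 : (Matrix.of fun i j => inner ℝ (v i) (v j)) =
        Matrix.of fun i j => ‖v i‖ * (Matrix.of fun i j =>
          ‖v j‖ * (Matrix.of fun i j => inner ℝ (e i) (e j)) i j) i j := by
      ext i j
      have hi := norm_ne_zero_iff.2 (h i)
      have hj := norm_ne_zero_iff.2 (h j)
      simp only [Matrix.of_apply, he, real_inner_smul_left, inner_smul_right]
      field_simp
    rw [h1, Matrix.det_mul_column, Matrix.det_mul_row, ← mul_assoc, ← Finset.prod_mul_distrib]
    simp_rw [← pow_two]
    refine mul_le_of_le_one_right (by positivity) ?_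
    refine (Matrix.posSemidef_gram (𝕜 := ℝ) e).det_le_one (le_of_eq ?_)
    have : ∀ i, ‖e i‖ = 1 := fun i => by
      rw [he, norm_smul, norm_inv, norm_norm, inv_mul_cancel₀ (norm_ne_zero_iff.2 (h i))]
    simp [Matrix.trace, Matrix.gram_apply, this]

lemma abs_det_gram_le (v : n → E) :
    |(Matrix.of fun i j => inner ℝ (v i) (v j)).det| ≤ ∏ i, ‖v i‖ ^ 2 := by
  rw [abs_of_nonneg (det_gram_nonneg v)]
  exact det_gram_le v

end Gram

/-! ### Principal minors -/

section Minors

variable {ι : Type*} [Fintype ι] [DecidableEq ι]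

/-- A tuple with a repeated index gives two equal rows. An n-element subset has n! enumerations, all
with the same principal minor. -/
lemma sum_det_submatrix_eq (G : Matrix ι ι ℝ) (n : ℕ) :
    ∑ k : Fin n → ι, (G.submatrix k k).det = (n.factorial : ℝ) *
      ∑ S ∈ (Finset.univ : Finset ι).powersetCard n,
        (G.submatrix (Subtype.val : S → ι) (Subtype.val : S → ι)).det := by
  have h1 : ∑ k : Fin n → ι, (G.submatrix k k).det =
      ∑ k : Fin n → ι with Function.Injective k, (G.submatrix k k).det := by
    refine (Finset.sum_filter_of_ne fun k _ hk => ?_).symm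
    intro i j hij
    by_contra hne
    refine hk (Matrix.det_zero_of_row_eq hne ?_)
    ext l
    simp [hij]
  have h2 : ∀ k ∈ (Finset.univ : Finset (Fin n → ι)).filter Function.Injective,
      Finset.univ.image k ∈ (Finset.univ : Finset ι).powersetCard n := fun k hk => by
    rw [Finset.mem_powersetCard]
    refine ⟨Finset.subset_univ _, ?_⟩
    rw [Finset.card_image_of_injective _ (Finset.mem_filter.1 hk).2]
    simp
  rw [h1, ← Finset.sum_fiberwise_of_maps_to h2, Finset.mul_sum]
  refine Finset.sum_congr rfl fun S hS => ?_
  have hcard : S.card = n := (Finset.mem_powersetCard.1 hS).2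
  have h3 : ∑ k : Fin n → ι with Function.Injective k ∧ Finset.univ.image k = S,
      (G.submatrix k k).det = ∑ e : Fin n ≃ S,
        (G.submatrix (Subtype.val : S → ι) (Subtype.val : S → ι)).det := by
    refine (Finset.sum_bij (fun (e : Fin n ≃ S) _ => fun i => ((e i : S) : ι)) ?_ ?_ ?_ ?_).symm
    · intro e _
      rw [Finset.mem_filter]
      refine ⟨Finset.mem_univ _, Subtype.val_injective.comp e.injective, ?_⟩
      ext x
      simp only [Finset.mem_image, Finset.mem_univ, true_and]
      exact ⟨fun ⟨i, hi⟩ => hi ▸ (e i).2, fun hx => ⟨e.symm ⟨x, hx⟩, by simp⟩⟩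
    · intro e _ e' _ h
      ext i
      exact congrFun h i
    · intro k hk
      obtain ⟨-, hinj, himg⟩ := Finset.mem_filter.1 hk
      have hmem : ∀ i, k i ∈ S := fun i => himg ▸ Finset.mem_image_of_mem k (Finset.mem_univ i)
      refine ⟨Equiv.ofBijective (fun i => ⟨k i, hmem i⟩) ⟨fun i j h => hinj (congrArg
        Subtype.val h), fun x => ?_⟩, Finset.mem_univ _, rfl⟩
      obtain ⟨x, hx⟩ := x
      rw [← himg, Finset.mem_image] at hx
      obtain ⟨i, -, hi⟩ := hx
      exact ⟨i, Subtype.ext hi⟩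
    · intro e _
      have : G.submatrix (fun i => ((e i : S) : ι)) (fun i => ((e i : S) : ι)) =
          (G.submatrix (Subtype.val : S → ι) (Subtype.val : S → ι)).submatrix e e := rfl
      rw [this, Matrix.det_submatrix_equiv_self]
  rw [Finset.filter_filter, h3, Finset.sum_const, Finset.card_univ,
    Fintype.card_equiv (finCongr hcard.symm |>.trans S.equivFin.symm), Fintype.card_fin,
    nsmul_eq_mul]

/-- The sums of principal minors are, up to sign, the coefficients of det(1 - XG), evaluated here at
X = 1. -/
lemma sum_minors_eq_det_one_sub (G : Matrix ι ι ℝ) :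
    ∑ n ∈ Finset.range (Fintype.card ι + 1), (-1 : ℝ) ^ n *
      ∑ S ∈ (Finset.univ : Finset ι).powersetCard n,
        (G.submatrix (Subtype.val : S → ι) (Subtype.val : S → ι)).det = (1 - G).det := by
  set p := (1 + (Polynomial.X : Polynomial ℝ) • (-G).map Polynomial.C).det with hp
  have hc : ∀ n, p.coeff n = (-1 : ℝ) ^ n * ∑ S ∈ (Finset.univ : Finset ι).powersetCard n,
      (G.submatrix (Subtype.val : S → ι) (Subtype.val : S → ι)).det := fun n => by
    rw [hp, Matrix.coeff_det_one_add_X_smul_eq_sum_minors, Finset.mul_sum]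
    refine Finset.sum_congr rfl fun S hS => ?_
    rw [Matrix.submatrix_neg, Pi.neg_apply, Pi.neg_apply, Matrix.det_neg, Fintype.card_coe,
      (Finset.mem_powersetCard.1 hS).2]
  have hdeg : p.natDegree < Fintype.card ι + 1 := by
    rw [Nat.lt_succ_iff, Polynomial.natDegree_le_iff_coeff_eq_zero]
    intro n hn
    rw [hc, Finset.powersetCard_eq_empty.2 (by simpa using hn), Finset.sum_empty, mul_zero]
  have h1 : p.eval 1 = (1 - G).det := by
    rw [hp, ← Polynomial.coe_evalRingHom, RingHom.map_det]
    congr 1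
    ext i j
    simp only [RingHom.mapMatrix_apply, Matrix.map_apply, Matrix.add_apply, Matrix.smul_apply,
      Polynomial.coe_evalRingHom, Polynomial.eval_add, smul_eq_mul, Polynomial.eval_mul,
      Polynomial.eval_X, Polynomial.eval_C, Matrix.neg_apply, Matrix.sub_apply]
    rw [Matrix.one_apply, Matrix.one_apply]
    split_ifs <;> simp [sub_eq_add_neg]
  rw [← h1, Polynomial.eval_eq_sum_range' hdeg]
  simp_rw [hc, one_pow, mul_one]

lemma hasSum_minors (G : Matrix ι ι ℝ) :
    HasSum (fun n : ℕ => (-1 : ℝ) ^ n / (n.factorial : ℝ) *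
      ∑ k : Fin n → ι, (G.submatrix k k).det) (1 - G).det := by
  have e : ∀ n : ℕ, (-1 : ℝ) ^ n / (n.factorial : ℝ) * ∑ k : Fin n → ι, (G.submatrix k k).det =
      (-1 : ℝ) ^ n * ∑ S ∈ (Finset.univ : Finset ι).powersetCard n,
        (G.submatrix (Subtype.val : S → ι) (Subtype.val : S → ι)).det := fun n => by
    rw [sum_det_submatrix_eq]
    have : (n.factorial : ℝ) ≠ 0 := by positivity
    field_simp
  simp_rw [e]
  rw [← sum_minors_eq_det_one_sub]
  refine hasSum_sum_of_ne_finset_zero fun n hn => ?_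
  rw [Finset.powersetCard_eq_empty.2, Finset.sum_empty, mul_zero]
  simpa using hn

end Minors

/-! ### Fredholm determinants of finite-rank and of Gram kernels -/

/-- Row multilinearity extracts the sums over k, and the Leibniz formula reduces each determinant to
products. Reindexing one factor by σ leaves a single function of each x_i, so the integral splits.
-/
lemma integral_det_finite_rank {α ι : Type*} [MeasurableSpace α] {μ : Measure α} [SigmaFinite μ]
    [Fintype ι] {f : ι → α → ℝ}
    (hf : ∀ k l, Integrable (fun x => f k x * f l x) μ) (n : ℕ) :
    ∫ x : Fin n → α, (Matrix.of fun i j => ∑ k, f k (x i) * f k (x j)).det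
        ∂(Measure.pi fun _ => μ) =
      ∑ k : Fin n → ι,
        ((Matrix.of fun a b => ∫ x, f a x * f b x ∂μ).submatrix k k).det := by
  have h1 : ∀ x : Fin n → α, (Matrix.of fun i j => ∑ k, f k (x i) * f k (x j)).det =
      ∑ k : Fin n → ι, ∑ σ : Equiv.Perm (Fin n), (Equiv.Perm.sign σ : ℝ) *
        ∏ i, f (k (σ i)) (x i) * f (k i) (x i) := fun x => by
    have e1 : (Matrix.of fun i j => ∑ k, f k (x i) * f k (x j)) =
        fun i => ∑ k, fun j => f k (x i) * f k (x j) := by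
      ext i j; simp
    have e2 : (Matrix.of fun i j => ∑ k, f k (x i) * f k (x j)).det =
        ∑ k : Fin n → ι, (Matrix.of fun i j => f (k i) (x i) * f (k i) (x j)).det := by
      rw [e1]
      exact (Matrix.detRowAlternating (R := ℝ) (n := Fin n)).toMultilinearMap.map_sum
        (fun i k j => f k (x i) * f k (x j))
    rw [e2]
    refine Finset.sum_congr rfl fun k _ => ?_
    rw [Matrix.det_apply']
    refine Finset.sum_congr rfl fun σ _ => ?_
    congr 1
    simp only [Matrix.of_apply]
    rw [Finset.prod_mul_distrib, Finset.prod_mul_distrib, mul_comm,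
      Equiv.prod_comp σ (fun i => f (k i) (x i)), mul_comm]
  simp_rw [h1]
  have hi : ∀ (k : Fin n → ι) (σ : Equiv.Perm (Fin n)), Integrable (fun x : Fin n → α =>
      (Equiv.Perm.sign σ : ℝ) * ∏ i, f (k (σ i)) (x i) * f (k i) (x i))
        (Measure.pi fun _ => μ) := fun k σ =>
    (Integrable.fintype_prod (f := fun i x => f (k (σ i)) x * f (k i) x)
      fun i => hf _ _).const_mul _
  rw [integral_finsetSum _ fun k _ => integrable_finsetSum _ fun σ _ => hi k σ]
  refine Finset.sum_congr rfl fun k _ => ?_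
  rw [integral_finsetSum _ fun σ _ => hi k σ, Matrix.det_apply']
  refine Finset.sum_congr rfl fun σ _ => ?_
  rw [integral_const_mul,
    integral_fintype_prod_eq_prod (fun i x => f (k (σ i)) x * f (k i) x)]
  rfl

section GramKernel

variable {α E : Type*} [MeasurableSpace α] {μ : Measure α} [SigmaFinite μ]
  [NormedAddCommGroup E] [InnerProductSpace ℝ E]

/-- The Fredholm determinant of the kernel `⟨v x, v y⟩`. -/
noncomputable def gramFredholm (μ : Measure α) (v : α → E) : ℝ :=
  ∑' n : ℕ, (-1 : ℝ) ^ n / (n.factorial : ℝ) * ∫ x : Fin n → α,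
    (Matrix.of fun i j => inner ℝ (v (x i)) (v (x j))).det ∂(Measure.pi fun _ => μ)

lemma norm_integral_det_gram_le {v w : α → E} (hw : Integrable (fun x => ‖w x‖ ^ 2) μ)
    (hvw : ∀ x, ‖v x‖ ≤ ‖w x‖) (n : ℕ) :
    ‖(-1 : ℝ) ^ n / (n.factorial : ℝ) * ∫ x : Fin n → α,
      (Matrix.of fun i j => inner ℝ (v (x i)) (v (x j))).det ∂(Measure.pi fun _ => μ)‖ ≤
        (∫ x, ‖w x‖ ^ 2 ∂μ) ^ n / (n.factorial : ℝ) := by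
  have h1 : ‖∫ x : Fin n → α, (Matrix.of fun i j => inner ℝ (v (x i)) (v (x j))).det
      ∂(Measure.pi fun _ => μ)‖ ≤ (∫ x, ‖w x‖ ^ 2 ∂μ) ^ n := by
    have h2 : ∫ x : Fin n → α, ∏ i, ‖w (x i)‖ ^ 2 ∂(Measure.pi fun _ => μ) =
        (∫ x, ‖w x‖ ^ 2 ∂μ) ^ n := by
      rw [integral_fintype_prod_eq_prod (fun (_ : Fin n) x => ‖w x‖ ^ 2)]
      simp
    rw [← h2]
    refine norm_integral_le_of_norm_le (Integrable.fintype_prod (f := fun _ x => ‖w x‖ ^ 2)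
      fun i => hw) (ae_of_all _ fun x => ?_)
    refine (abs_det_gram_le fun i => v (x i)).trans ?_
    exact Finset.prod_le_prod (fun i _ => by positivity) fun i _ => by gcongr; exact hvw _
  rw [norm_mul, norm_div, norm_pow, norm_neg, norm_one, one_pow, Real.norm_natCast, div_mul_eq_mul_div,
    one_mul]
  gcongr

/-- Hadamard's inequality bounds the n-th integrand by ∏ ‖w(x_i)‖² and the n-th term by Cⁿ/n!, which
dominates the integrals and then the series. -/
lemma tendsto_gramFredholm {κ : Type*} {l : Filter κ} [l.IsCountablyGenerated] {v : κ → α → E}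
    {w : α → E} (hw : Integrable (fun x => ‖w x‖ ^ 2) μ)
    (hm : ∀ (k : κ) (n : ℕ), AEStronglyMeasurable (fun x : Fin n → α =>
      (Matrix.of fun i j => inner ℝ (v k (x i)) (v k (x j))).det) (Measure.pi fun _ => μ))
    (hvw : ∀ k x, ‖v k x‖ ≤ ‖w x‖) (hlim : ∀ x, Tendsto (fun k => v k x) l (𝓝 (w x))) :
    Tendsto (fun k => gramFredholm μ (v k)) l (𝓝 (gramFredholm μ w)) := by
  refine tendsto_tsum_of_dominated_convergence (Real.summable_pow_div_factorial _)
    (fun n => ?_) (Eventually.of_forall fun k n => norm_integral_det_gram_le hw (hvw k) n)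
  refine Tendsto.const_mul _ ?_
  refine tendsto_integral_filter_of_dominated_convergence (fun x => ∏ i, ‖w (x i)‖ ^ 2)
    (Eventually.of_forall fun k => hm k n) (Eventually.of_forall fun k => ae_of_all _ fun x => ?_)
    (Integrable.fintype_prod (f := fun _ x => ‖w x‖ ^ 2) fun i => hw) (ae_of_all _ fun x => ?_)
  · refine (abs_det_gram_le fun i => v k (x i)).trans ?_
    exact Finset.prod_le_prod (fun i _ => by positivity) fun i _ => by gcongr; exact hvw _ _
  · have hM : Tendsto (fun k => (Matrix.of fun i j => inner ℝ (v k (x i)) (v k (x j)) :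
        Matrix (Fin n) (Fin n) ℝ)) l (𝓝 (Matrix.of fun i j => inner ℝ (w (x i)) (w (x j)))) :=
      tendsto_pi_nhds.2 fun i => tendsto_pi_nhds.2 fun j => (hlim _).inner (hlim _)
    exact ((continuous_id.matrix_det (A := fun M : Matrix (Fin n) (Fin n) ℝ => M)).tendsto _).comp hM

lemma gramFredholm_finProj {ι : Type*} (b : HilbertBasis ι ℝ E) (F : Finset ι) {v : α → E}
    (hv : ∀ k l, Integrable (fun x => inner ℝ (b k) (v x) * inner ℝ (b l) (v x)) μ) [DecidableEq ι] :
    gramFredholm μ (fun x => finProj b F (v x)) =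
      (1 - Matrix.of fun k l : F => ∫ x, inner ℝ (b k) (v x) * inner ℝ (b l) (v x) ∂μ).det := by
  rw [← (hasSum_minors _).tsum_eq, gramFredholm]
  refine tsum_congr fun n => ?_
  rw [← integral_det_finite_rank (f := fun (k : F) x => inner ℝ (b k) (v x)) fun k l => hv k l]
  congr 2
  ext x
  congr 2
  ext i j
  rw [inner_finProj_finProj, inner_finProj]
  exact (Finset.sum_coe_sort F fun k => inner ℝ (b k) (v (x i)) * inner ℝ (b k) (v (x j))).symm

end GramKernel

/-! ### Determinants of matrices: derivative and lower bound -/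

section MatrixDet

variable {ι : Type*} [Fintype ι] [DecidableEq ι]

lemma Matrix.det_updateCol_eq_sum (M : Matrix ι ι ℝ) (i : ι) (c : ι → ℝ) :
    (M.updateCol i c).det = ∑ σ : Equiv.Perm ι, (Equiv.Perm.sign σ : ℝ) *
      ((∏ j ∈ Finset.univ.erase i, M (σ j) j) * c (σ i)) := by
  rw [Matrix.det_apply']
  refine Finset.sum_congr rfl fun σ _ => ?_
  rw [← Finset.prod_erase_mul _ _ (Finset.mem_univ i)]
  congr 2
  · refine Finset.prod_congr rfl fun j hj => ?_
    rw [Matrix.updateCol_ne (Finset.ne_of_mem_erase hj)]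
  · rw [Matrix.updateCol_self]

lemma hasDerivAt_det {M : ℝ → Matrix ι ι ℝ} {M' : Matrix ι ι ℝ} {t : ℝ}
    (h : ∀ i j, HasDerivAt (fun τ => M τ i j) (M' i j) t) :
    HasDerivAt (fun τ => (M τ).det) (∑ i, ((M t).updateCol i fun k => M' k i).det) t := by
  simp_rw [Matrix.det_updateCol_eq_sum]
  rw [Finset.sum_comm]
  simp_rw [Matrix.det_apply', ← Finset.mul_sum]
  refine HasDerivAt.fun_sum fun σ _ => HasDerivAt.const_mul _ ?_
  simpa using HasDerivAt.fun_finsetProd fun i (_ : i ∈ (Finset.univ : Finset ι)) => h (σ i) i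

/-- Column i of the derivative is a_i times a, and replacing column i by a is Cramer's numerator. -/
lemma hasDerivAt_det_of_rank_one {M : ℝ → Matrix ι ι ℝ} {a : ι → ℝ} {t : ℝ}
    (h : ∀ i j, HasDerivAt (fun τ => M τ i j) (a i * a j) t) :
    HasDerivAt (fun τ => (M τ).det) (a ⬝ᵥ (M t).cramer a) t := by
  refine (hasDerivAt_det (M' := Matrix.of fun i j => a i * a j) h).congr_deriv ?_
  refine Finset.sum_congr rfl fun i _ => ?_
  have : (fun k => (Matrix.of fun i j => a i * a j) k i) = a i • a := by
    ext k; simp [mul_comm]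
  rw [this, Matrix.det_updateCol_smul, Matrix.cramer_apply]

/-- An eigenvalue m of 1 - G lies in [1-r, 1], so log m ≥ 1 - 1/m = -(1-m)/m ≥ -(1-m)/(1-r); summing
gives the trace. The bound depends on the matrix only through its trace and r, so it survives the
limit over finite sections. -/
lemma exp_neg_trace_div_le_det_one_sub {G : Matrix ι ι ℝ} (hG : G.IsHermitian) {r : ℝ} (hr : r < 1)
    (h0 : ∀ x : ι → ℝ, 0 ≤ x ⬝ᵥ G.mulVec x) (h1 : ∀ x : ι → ℝ, x ⬝ᵥ G.mulVec x ≤ r * (x ⬝ᵥ x)) :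
    Real.exp (-(G.trace / (1 - r))) ≤ (1 - G).det := by
  have hM : (1 - G).IsHermitian := Matrix.isHermitian_one.sub hG
  have e1 : (1 - G).det = ∏ i, hM.eigenvalues i := by
    simpa using hM.det_eq_prod_eigenvalues
  have e2 : (1 - G).trace = ∑ i, hM.eigenvalues i := by
    simpa using hM.trace_eq_sum_eigenvalues
  have e3 : G.trace = ∑ i, (1 - hM.eigenvalues i) := by
    rw [Finset.sum_sub_distrib, ← e2, Matrix.trace_sub, Matrix.trace_one]; simp
  have e4 : ∀ i, ∃ x : ι → ℝ, x ⬝ᵥ x = 1 ∧ hM.eigenvalues i = 1 - x ⬝ᵥ G.mulVec x := fun i => by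
    refine ⟨hM.eigenvectorBasis i, ?_, ?_⟩
    · have := (real_inner_self_eq_norm_sq (hM.eigenvectorBasis i))
      rw [hM.eigenvectorBasis.norm_eq_one, EuclideanSpace.inner_eq_star_dotProduct] at this
      simpa using this
    · have := (real_inner_self_eq_norm_sq (hM.eigenvectorBasis i))
      rw [hM.eigenvectorBasis.norm_eq_one, EuclideanSpace.inner_eq_star_dotProduct] at this
      rw [hM.eigenvalues_eq, Matrix.sub_mulVec, dotProduct_sub, Matrix.one_mulVec]
      simpa using this
  rw [e1, e3, Finset.sum_div, ← Finset.sum_neg_distrib, Real.exp_sum]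
  refine Finset.prod_le_prod (fun i _ => (Real.exp_pos _).le) fun i _ => ?_
  obtain ⟨x, hx, hi⟩ := e4 i
  have h2 := h0 x
  have h3 := h1 x
  rw [hx] at h3
  set m := hM.eigenvalues i
  have hm : 1 - r ≤ m := by linarith
  have hm0 : 0 < m := by linarith
  rw [← Real.le_log_iff_exp_le hm0]
  have h4 := Real.one_sub_inv_le_log_of_pos hm0
  refine le_trans ?_ h4
  have h5 : (1 - m) / m ≤ (1 - m) / (1 - r) := by
    apply div_le_div_of_nonneg_left <;> linarith
  have h6 : (1 - m) / m = m⁻¹ - 1 := by field_simp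
  linarith

end MatrixDet

/-! ### Galerkin approximation -/

section Galerkin

variable {E ι : Type*} [NormedAddCommGroup E] [InnerProductSpace ℝ E] (b : HilbertBasis ι ℝ E)
  (F : Finset ι) (T : E →L[ℝ] E)

/-- The matrix of `T* T` on the span of finitely many vectors of a Hilbert basis. -/
noncomputable def gramMatrix : Matrix F F ℝ :=
  Matrix.of fun k l => inner ℝ (T (b k)) (T (b l))

lemma isHermitian_gramMatrix : (gramMatrix b F T).IsHermitian :=
  Matrix.IsHermitian.ext fun _ _ => real_inner_comm _ _

lemma sum_basis_dotProduct_gramMatrix (x y : F → ℝ) :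
    x ⬝ᵥ (gramMatrix b F T).mulVec y =
      inner ℝ (T (∑ k, x k • b k)) (T (∑ k, y k • b k)) := by
  rw [map_sum, map_sum, sum_inner]
  refine Finset.sum_congr rfl fun k _ => ?_
  rw [inner_sum, Matrix.mulVec, dotProduct, Finset.mul_sum]
  refine Finset.sum_congr rfl fun l _ => ?_
  rw [map_smul, map_smul, real_inner_smul_left, inner_smul_right, gramMatrix, Matrix.of_apply]
  ring

lemma inner_basis_sum (x : F → ℝ) (k : F) : inner ℝ (b k) (∑ l, x l • b l) = x k := by
  classical
  rw [inner_sum]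
  simp_rw [inner_smul_right, orthonormal_iff_ite.1 b.orthonormal]
  simp [Subtype.ext_iff.symm]

lemma inner_sum_basis (x : F → ℝ) (u : E) :
    inner ℝ (∑ k, x k • b k) u = ∑ k, x k * inner ℝ (b k) u := by
  rw [sum_inner]
  simp_rw [real_inner_smul_left]

lemma norm_sq_sum_basis (x : F → ℝ) : ‖∑ k, x k • b k‖ ^ 2 = x ⬝ᵥ x := by
  rw [← real_inner_self_eq_norm_sq, inner_sum_basis]
  exact Finset.sum_congr rfl fun k _ => by rw [inner_basis_sum]

variable {T} {ρ : ℝ} (hT : ‖T‖ ≤ ρ) (hρ : ρ < 1)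

include hT in
lemma norm_sq_apply_le (f : E) : ‖T f‖ ^ 2 ≤ ρ ^ 2 * ‖f‖ ^ 2 := by
  rw [← mul_pow]
  exact pow_le_pow_left₀ (norm_nonneg _) (T.le_of_opNorm_le hT f) 2

include hT hρ

lemma sq_lt_one_of_norm_le : ρ ^ 2 < 1 := by
  have : 0 ≤ ρ := (norm_nonneg T).trans hT
  nlinarith

lemma exp_neg_le_det_one_sub_gramMatrix [DecidableEq ι] {C : ℝ}
    (hC : ∑ k ∈ F, ‖T (b k)‖ ^ 2 ≤ C) :
    Real.exp (-(C / (1 - ρ ^ 2))) ≤ (1 - gramMatrix b F T).det := by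
  have h1 := sq_lt_one_of_norm_le hT hρ
  refine le_trans ?_ (exp_neg_trace_div_le_det_one_sub (isHermitian_gramMatrix b F T) h1
    (fun x => ?_) (fun x => ?_))
  · have h2 : (gramMatrix b F T).trace = ∑ k ∈ F, ‖T (b k)‖ ^ 2 := by
      rw [← Finset.sum_coe_sort]
      exact Finset.sum_congr rfl fun k _ => real_inner_self_eq_norm_sq _
    rw [h2]
    gcongr
  · rw [sum_basis_dotProduct_gramMatrix, real_inner_self_eq_norm_sq]
    positivity
  · rw [sum_basis_dotProduct_gramMatrix, real_inner_self_eq_norm_sq, ← norm_sq_sum_basis b]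
    exact norm_sq_apply_le hT _

omit hρ in
lemma norm_sq_le_of_contraction (f : E) : (1 - ρ ^ 2) * ‖f‖ ^ 2 ≤ inner ℝ f f - inner ℝ (T f) (T f) := by
  rw [real_inner_self_eq_norm_sq, real_inner_self_eq_norm_sq]
  linarith [norm_sq_apply_le hT f]

variable {F} {a Y f : E} {y : F → ℝ} (hY : Y = ∑ k, y k • b k)
  (hy : ∀ k : F, inner ℝ (b k) Y - inner ℝ (T (b k)) (T Y) = inner ℝ (b k) a)
include hY hy

omit hT hρ hY in
lemma galerkin_inner (x : F → ℝ) : inner ℝ (∑ k, x k • b k) Y -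
    inner ℝ (T (∑ k, x k • b k)) (T Y) = inner ℝ (∑ k, x k • b k) a := by
  rw [map_sum, inner_sum_basis, inner_sum_basis, sum_inner, ← Finset.sum_sub_distrib]
  refine Finset.sum_congr rfl fun k _ => ?_
  rw [← hy, map_smul, real_inner_smul_left]
  ring

/-- Coercivity: testing the Galerkin equations with Y itself gives (1-ρ²)‖Y‖² ≤ ⟨Y, a⟩. -/
lemma norm_galerkin_le : ‖Y‖ ≤ ‖a‖ / (1 - ρ ^ 2) := by
  have h1 := sq_lt_one_of_norm_le hT hρ
  have h2 := norm_sq_le_of_contraction hT Y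
  have h3 := galerkin_inner b hy y
  rw [← hY] at h3
  rw [h3] at h2
  have h4 := real_inner_le_norm Y a
  rw [le_div_iff₀ (by linarith)]
  rcases eq_or_lt_of_le (norm_nonneg Y) with h | h
  · rw [← h]; simp
  · refine le_of_mul_le_mul_left ?_ h
    nlinarith

/-- Céa's argument. The vector Z = Y - Pf lies in the trial space, so Y and the exact solution f
have equal forms against it; coercivity then bounds Z by the projection error of f. -/
lemma norm_galerkin_sub_le (hf : ∀ g, inner ℝ g f - inner ℝ (T g) (T f) = inner ℝ g a) :
    ‖Y - f‖ ≤ (2 / (1 - ρ ^ 2) + 1) * ‖finProj b F f - f‖ := by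
  have h1 := sq_lt_one_of_norm_le hT hρ
  have hT1 : ‖T‖ ≤ 1 := hT.trans hρ.le
  set Z := Y - finProj b F f with hZ
  set h := finProj b F f - f with hh
  have hZx : Z = ∑ k : F, (y k - inner ℝ (b k) f) • b k := by
    simp_rw [sub_smul]
    rw [Finset.sum_sub_distrib, hZ, ← hY, finProj_apply, ← Finset.sum_coe_sort]
  have h3 := galerkin_inner b hy fun k => y k - inner ℝ (b k) f
  rw [← hZx, ← hf Z] at h3
  have e : Z = Y - f - h := by rw [hZ, hh]; abel
  have h4 : inner ℝ Z Z - inner ℝ (T Z) (T Z) = inner ℝ (T Z) (T h) - inner ℝ Z h := by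
    have e1 : inner ℝ Z Z = inner ℝ Z Y - inner ℝ Z f - inner ℝ Z h := by
      rw [← inner_sub_right, ← inner_sub_right, ← e]
    have e2 : inner ℝ (T Z) (T Z) =
        inner ℝ (T Z) (T Y) - inner ℝ (T Z) (T f) - inner ℝ (T Z) (T h) := by
      rw [← inner_sub_right, ← inner_sub_right, ← map_sub, ← map_sub, ← e]
    linarith
  have h5 : inner ℝ (T Z) (T h) - inner ℝ Z h ≤ 2 * (‖Z‖ * ‖h‖) := by
    have i1 := (real_inner_le_norm (T Z) (T h)).trans (mul_le_mul
      (by simpa using T.le_of_opNorm_le hT1 Z) (by simpa using T.le_of_opNorm_le hT1 h)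
      (norm_nonneg _) (norm_nonneg _))
    have i2 := (abs_le.1 (abs_real_inner_le_norm Z h)).1
    linarith
  have h6 := norm_sq_le_of_contraction hT Z
  have h7 : ‖Z‖ ≤ 2 * ‖h‖ / (1 - ρ ^ 2) := by
    rw [le_div_iff₀ (by linarith)]
    rcases eq_or_lt_of_le (norm_nonneg Z) with h0 | h0
    · rw [← h0, zero_mul]; positivity
    · refine le_of_mul_le_mul_left ?_ h0
      nlinarith
  calc ‖Y - f‖ = ‖Z + h‖ := by rw [e]; congr 1; abel
    _ ≤ ‖Z‖ + ‖h‖ := norm_add_le _ _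
    _ ≤ 2 * ‖h‖ / (1 - ρ ^ 2) + ‖h‖ := by gcongr
    _ = _ := by ring

end Galerkin

section GalerkinValue

variable {E ι : Type*} [NormedAddCommGroup E] [InnerProductSpace ℝ E] [DecidableEq ι]
  (b : HilbertBasis ι ℝ E)

/-- The Galerkin approximation of `⟨a, (1 - T* T)⁻¹ a⟩` on the span of finitely many vectors of a
Hilbert basis. -/
noncomputable def galerkinValue (F : Finset ι) (T : E →L[ℝ] E) (a : E) : ℝ :=
  ((1 - gramMatrix b F T).det)⁻¹ * ((fun k : F => inner ℝ (b k) a) ⬝ᵥ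
    (1 - gramMatrix b F T).cramer fun k : F => inner ℝ (b k) a)

variable {T : E →L[ℝ] E} {ρ : ℝ} (hT : ‖T‖ ≤ ρ) (hρ : ρ < 1)
include hT hρ

lemma det_one_sub_gramMatrix_pos (F : Finset ι) : 0 < (1 - gramMatrix b F T).det :=
  (Real.exp_pos _).trans_le (exp_neg_le_det_one_sub_gramMatrix b F hT hρ le_rfl)

lemma exists_galerkin (F : Finset ι) (a : E) : ∃ (y : F → ℝ) (Y : E), Y = ∑ k, y k • b k ∧
    (∀ k : F, inner ℝ (b k) Y - inner ℝ (T (b k)) (T Y) = inner ℝ (b k) a) ∧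
    galerkinValue b F T a = inner ℝ a Y := by
  have hD := (det_one_sub_gramMatrix_pos b hT hρ F).ne'
  set M := 1 - gramMatrix b F T with hM
  set α := fun k : F => inner ℝ (b k) a with hα
  set y := M.det⁻¹ • M.cramer α with hy
  have h1 : M.mulVec y = α := by
    rw [hy, Matrix.mulVec_smul, Matrix.mulVec_cramer, smul_smul, inv_mul_cancel₀ hD, one_smul]
  refine ⟨y, _, rfl, fun k => ?_, ?_⟩
  · have h2 := congrFun h1 k
    rw [hM, Matrix.sub_mulVec, Matrix.one_mulVec, Pi.sub_apply] at h2
    rw [inner_basis_sum, map_sum, inner_sum]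
    simp_rw [map_smul, inner_smul_right]
    refine Eq.trans ?_ h2
    congr 1
    exact Finset.sum_congr rfl fun l _ => mul_comm _ _
  · rw [real_inner_comm, inner_sum_basis, galerkinValue, ← smul_eq_mul, ← dotProduct_smul,
      dotProduct_comm]
    rfl

lemma abs_galerkinValue_le (F : Finset ι) (a : E) :
    |galerkinValue b F T a| ≤ ‖a‖ ^ 2 / (1 - ρ ^ 2) := by
  obtain ⟨y, Y, hY, hy, e⟩ := exists_galerkin b hT hρ F a
  rw [e]
  calc _ ≤ ‖a‖ * ‖Y‖ := abs_real_inner_le_norm _ _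
    _ ≤ ‖a‖ * (‖a‖ / (1 - ρ ^ 2)) := by gcongr; exact norm_galerkin_le b hT hρ hY hy
    _ = _ := by ring

lemma tendsto_galerkinValue {a f : E}
    (hf : ∀ g, inner ℝ g f - inner ℝ (T g) (T f) = inner ℝ g a) :
    Tendsto (fun F => galerkinValue b F T a) atTop (𝓝 (inner ℝ a f)) := by
  have h0 : Tendsto (fun F => ‖finProj b F f - f‖) atTop (𝓝 0) := by
    simpa using ((tendsto_finProj b f).sub_const f).norm
  have h1 := (h0.const_mul (2 / (1 - ρ ^ 2) + 1)).const_mul ‖a‖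
  rw [mul_zero, mul_zero] at h1
  rw [tendsto_iff_norm_sub_tendsto_zero]
  refine squeeze_zero (fun _ => norm_nonneg _) (fun F => ?_) h1
  obtain ⟨y, Y, hY, hy, e⟩ := exists_galerkin b hT hρ F a
  rw [e, ← inner_sub_right]
  refine (abs_real_inner_le_norm _ _).trans ?_
  gcongr
  exact norm_galerkin_sub_le b hT hρ hY hy hf

end GalerkinValue

section LogDerivative

variable {E ι : Type*} [NormedAddCommGroup E] [InnerProductSpace ℝ E] [DecidableEq ι]
  (b : HilbertBasis ι ℝ E) {T : ℝ → E →L[ℝ] E} {a f : ℝ → E} {ρ : ℝ} (hρ : ρ < 1)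
  (hder : ∀ t g h, HasDerivAt (fun τ => inner ℝ (T τ g) (T τ h))
    (-(inner ℝ (a t) g * inner ℝ (a t) h)) t)

include hder in
lemma hasDerivAt_det_one_sub_gramMatrix (F : Finset ι) (t : ℝ) :
    HasDerivAt (fun τ => (1 - gramMatrix b F (T τ)).det) ((fun k : F => inner ℝ (b k) (a t)) ⬝ᵥ
      (1 - gramMatrix b F (T t)).cramer fun k : F => inner ℝ (b k) (a t)) t := by
  refine hasDerivAt_det_of_rank_one (M := fun τ => 1 - gramMatrix b F (T τ)) fun i j => ?_
  refine ((hder t (b i) (b j)).const_sub _).congr_deriv ?_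
  rw [neg_neg, real_inner_comm, real_inner_comm (b j)]

include hder in
omit [DecidableEq ι] in
lemma continuous_gramMatrix (F : Finset ι) : Continuous fun t => gramMatrix b F (T t) :=
  continuous_matrix fun i j => continuous_iff_continuousAt.2 fun t =>
    (hder t (b i) (b j)).continuousAt

include hρ hder in
-- By the rank-one derivative formula, the logarithmic derivative of the finite determinant is
-- exactly the Galerkin value.
lemma log_det_sub_log_det (ha : Continuous a) (F : Finset ι) {s t : ℝ}
    (hT : ∀ τ ∈ uIcc s t, ‖T τ‖ ≤ ρ) :
    IntervalIntegrable (fun τ => galerkinValue b F (T τ) (a τ)) volume s t ∧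
    ∫ τ in s..t, galerkinValue b F (T τ) (a τ) =
      Real.log (1 - gramMatrix b F (T t)).det - Real.log (1 - gramMatrix b F (T s)).det := by
  have hpos : ∀ τ ∈ uIcc s t, (1 - gramMatrix b F (T τ)).det ≠ 0 := fun τ hτ =>
    (det_one_sub_gramMatrix_pos b (hT τ hτ) hρ F).ne'
  have hM : Continuous fun τ => 1 - gramMatrix b F (T τ) :=
    continuous_const.sub (continuous_gramMatrix b hder F)
  have hi : IntervalIntegrable (fun τ => galerkinValue b F (T τ) (a τ)) volume s t := by
    refine ContinuousOn.intervalIntegrable ((hM.matrix_det.continuousOn.inv₀ hpos).mul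
      (Continuous.continuousOn ?_))
    simp_rw [Matrix.cramer_eq_adjugate_mulVec]
    have h1 : Continuous fun τ => fun k : F => inner ℝ (b k) (a τ) := by fun_prop
    exact h1.dotProduct (hM.matrix_adjugate.matrix_mulVec h1)
  refine ⟨hi, intervalIntegral.integral_eq_sub_of_hasDerivAt
    (f := fun τ => Real.log (1 - gramMatrix b F (T τ)).det) (fun τ hτ => ?_) hi⟩
  refine ((hasDerivAt_det_one_sub_gramMatrix b hder F τ).log (hpos τ hτ)).congr_deriv ?_
  rw [galerkinValue, div_eq_inv_mul]

variable [Countable ι] {D : ℝ → ℝ} {C : ℝ → ℝ}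
  (hC : ∀ t F, ∑ k ∈ F, ‖T t (b k)‖ ^ 2 ≤ C t)
  (hD : ∀ t, Tendsto (fun F => (1 - gramMatrix b F (T t)).det) atTop (𝓝 (D t)))

include hρ hC hD in
omit [Countable ι] in
lemma pos_of_tendsto_det {t : ℝ} (hT : ‖T t‖ ≤ ρ) : 0 < D t :=
  (Real.exp_pos _).trans_le
    (ge_of_tendsto' (hD t) fun F => exp_neg_le_det_one_sub_gramMatrix b F hT hρ (hC t F))

include hρ hder hC hD in
-- Derivatives need not pass to the limit, but the integrated identity does: the Galerkin values
-- converge pointwise with the bound ‖a‖²/(1-ρ²), uniform in F. Continuity of the limit integrand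
-- then gives the derivative.
lemma hasDerivAt_log_of_tendsto_det (ha : Continuous a) {s : ℝ} (hT : ∀ᶠ t in 𝓝 s, ‖T t‖ ≤ ρ)
    (hf : ∀ᶠ t in 𝓝 s, ∀ g, inner ℝ g (f t) - inner ℝ (T t g) (T t (f t)) = inner ℝ g (a t))
    (hu : ∀ᶠ t in 𝓝 s, ContinuousAt (fun τ => inner ℝ (a τ) (f τ)) t) :
    HasDerivAt (fun t => Real.log (D t)) (inner ℝ (a s) (f s)) s := by
  obtain ⟨δ, hδ, hball⟩ := Metric.eventually_nhds_iff_ball.1 (hT.and (hf.and hu))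
  have hsub : ∀ t ∈ Metric.ball s δ, uIcc s t ⊆ Metric.ball s δ := fun t ht => by
    rw [Real.ball_eq_Ioo] at ht ⊢
    exact ordConnected_Ioo.uIcc_subset ⟨by linarith, by linarith⟩ ht
  have hcont : ContinuousOn (fun τ => inner ℝ (a τ) (f τ)) (Metric.ball s δ) :=
    fun t ht => (hball t ht).2.2.continuousWithinAt
  have key : ∀ t ∈ Metric.ball s δ,
      Real.log (D t) = Real.log (D s) + ∫ τ in s..t, inner ℝ (a τ) (f τ) := fun t ht => by
    have hTt : ∀ τ ∈ uIcc s t, ‖T τ‖ ≤ ρ := fun τ hτ => (hball τ (hsub t ht hτ)).1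
    have h1 : Tendsto (fun F => ∫ τ in s..t, galerkinValue b F (T τ) (a τ)) atTop
        (𝓝 (∫ τ in s..t, inner ℝ (a τ) (f τ))) := by
      refine intervalIntegral.tendsto_integral_filter_of_dominated_convergence
        (fun τ => ‖a τ‖ ^ 2 / (1 - ρ ^ 2)) (Eventually.of_forall fun F => ?_)
        (Eventually.of_forall fun F => ae_of_all _ fun τ hτ => ?_)
        (Continuous.intervalIntegrable (by fun_prop) _ _) (ae_of_all _ fun τ hτ => ?_)
      · exact (log_det_sub_log_det b hρ hder ha F hTt).1.aestronglyMeasurable_restrict_uIoc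
      · exact abs_galerkinValue_le b (hTt τ (uIoc_subset_uIcc hτ)) hρ F _
      · exact tendsto_galerkinValue b (hTt τ (uIoc_subset_uIcc hτ)) hρ
          (hball τ (hsub t ht (uIoc_subset_uIcc hτ))).2.1
    simp_rw [fun F => (log_det_sub_log_det b hρ hder ha F hTt).2] at h1
    have h2 : ∀ τ ∈ uIcc s t, Tendsto (fun F => Real.log (1 - gramMatrix b F (T τ)).det) atTop
        (𝓝 (Real.log (D τ))) := fun τ hτ =>
      (hD τ).log (pos_of_tendsto_det b hρ hC hD (hTt τ hτ)).ne'
    have h3 := tendsto_nhds_unique h1 ((h2 t right_mem_uIcc).sub (h2 s left_mem_uIcc))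
    linarith
  have hs : s ∈ Metric.ball s δ := Metric.mem_ball_self hδ
  have h4 : HasDerivAt (fun t => ∫ τ in s..t, inner ℝ (a τ) (f τ)) (inner ℝ (a s) (f s)) s :=
    intervalIntegral.integral_hasDerivAt_right (by simp)
      (hcont.stronglyMeasurableAtFilter Metric.isOpen_ball s hs) (hball s hs).2.2
  refine (h4.const_add (Real.log (D s))).congr_of_eventuallyEq ?_
  filter_upwards [Metric.ball_mem_nhds s hδ] with t ht
  exact key t ht

end LogDerivative

/-! ### The Fredholm determinant of `K_s` -/

lemma integrable_halfLine_comp_add {g : ℝ → ℝ} {t : ℝ} (h : IntegrableOn g (Ioi t)) :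
    Integrable (fun x => g (x + t)) halfLine := by
  have hp : (fun x : ℝ => x + t) ⁻¹' Ioi t = Ioi 0 := by ext x; simp
  have h1 := ((measurePreserving_add_right volume t).integrableOn_comp_preimage
    (MeasurableEquiv.addRight t).measurableEmbedding (f := g) (s := Ioi t)).2 h
  rw [hp] at h1
  exact h1

namespace SmoothIntegrable

variable {A : ℝ → ℝ} (hA : SmoothIntegrable A)
include hA

lemma fredholmDet_squareKernel (t : ℝ) :
    fredholmDet (squareKernel A t) = gramFredholm halfLine fun x => ketA A 0 (x + t) := by
  have h : ∀ x y, squareKernel A t x y = inner ℝ (ketA A 0 (x + t)) (ketA A 0 (y + t)) :=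
    fun x y => by
      rw [hA.inner_ketA_ketA, squareKernel]
      refine integral_congr_ae (ae_of_all _ fun r => ?_)
      simp only [iteratedDeriv_zero]
      rw [show x + r + t = r + (x + t) by ring, show y + r + t = r + (y + t) by ring]
  rw [fredholmDet, gramFredholm]
  simp_rw [h]
  refine tsum_congr fun n => ?_
  rw [volume_pi, Measure.restrict_pi_pi]

variable {s : ℝ} (hHS : ∀ t, HilbertSchmidtKernel (hankelKernel A t))
include hHS

lemma gramFredholm_finProj_ketA {ι : Type*} [DecidableEq ι] (b : HilbertBasis ι ℝ L2R)
    (F : Finset ι) (t : ℝ) :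
    gramFredholm halfLine (fun x => finProj b F (ketA A 0 (x + t))) =
      (1 - gramMatrix b F (opA A t)).det := by
  have e : ∀ k l x, inner ℝ (b k) (ketA A 0 x) * inner ℝ (b l) (ketA A 0 x) =
      inner ℝ (ketA A 0 x) (b k) * inner ℝ (ketA A 0 x) (b l) := fun k l x => by
    rw [real_inner_comm, real_inner_comm (b l)]
  rw [gramFredholm_finProj b F fun k l => ?_]
  · congr 2
    ext k l
    rw [Matrix.of_apply, gramMatrix, Matrix.of_apply, hA.inner_opA_opA (hHS t),
      integral_Ioi_zero_comp_add
        (fun x => inner ℝ (b k) (ketA A 0 x) * inner ℝ (b l) (ketA A 0 x)) t]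
    simp_rw [e]
  · have h := hA.integrableOn_inner_mul_inner (hHS t) (b k) (b l)
    simp_rw [← e] at h
    exact integrable_halfLine_comp_add h

lemma tendsto_det_one_sub_gramMatrix {ι : Type*} [DecidableEq ι] [Countable ι]
    (b : HilbertBasis ι ℝ L2R) (t : ℝ) :
    Tendsto (fun F => (1 - gramMatrix b F (opA A t)).det) atTop
      (𝓝 (fredholmDet (squareKernel A t))) := by
  simp_rw [← hA.gramFredholm_finProj_ketA hHS b _ t]
  rw [hA.fredholmDet_squareKernel]
  have hc := hA.continuous_ketA 0
  refine tendsto_gramFredholm ?_ (fun F n => ?_) (fun F x => norm_finProj_le b F _)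
    fun x => tendsto_finProj b _
  · exact integrable_halfLine_comp_add ((hA.hilbertSchmidt_iff t).1 (hHS t))
  · refine Continuous.aestronglyMeasurable (Continuous.matrix_det (continuous_matrix
      fun i j => ?_))
    simp only [Matrix.of_apply]
    have : Continuous (finProj b F) := (finProj b F).continuous
    fun_prop

/-- Bessel's inequality under the integral bounds the traces of all finite sections by the squared
Hilbert–Schmidt norm. -/
lemma sum_norm_sq_opA_le {ι : Type*} (b : HilbertBasis ι ℝ L2R) (t : ℝ) (F : Finset ι) :
    ∑ k ∈ F, ‖opA A t (b k)‖ ^ 2 ≤ ∫ x in Ioi t, ‖ketA A 0 x‖ ^ 2 := by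
  simp_rw [← real_inner_self_eq_norm_sq, fun k => hA.inner_opA_opA (hHS t) (b k) (b k)]
  rw [← integral_finsetSum _ fun k _ => hA.integrableOn_inner_mul_inner (hHS t) (b k) (b k)]
  refine integral_mono (integrable_finsetSum _ fun k _ =>
    hA.integrableOn_inner_mul_inner (hHS t) (b k) (b k)) ?_ fun x => ?_
  · simp_rw [real_inner_self_eq_norm_sq]
    exact (hA.hilbertSchmidt_iff t).1 (hHS t)
  · simp only [real_inner_self_eq_norm_sq]
    refine le_trans (le_of_eq ?_) (b.orthonormal.sum_inner_products_le (ketA A 0 x) (s := F))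
    refine Finset.sum_congr rfl fun k _ => ?_
    rw [real_inner_comm, Real.norm_eq_abs, sq_abs, pow_two]

variable (h1 : ‖opA A s‖ < 1)
include h1

lemma fredholmDet_pos_and_hasDerivAt_log :
    0 < fredholmDet (squareKernel A s) ∧
    HasDerivAt (fun t => Real.log (fredholmDet (squareKernel A t))) (uFun A 0 s) s := by
  classical
  have : Fact ((2 : ENNReal) ≠ ⊤) := ⟨ENNReal.ofNat_ne_top⟩
  obtain ⟨w, b, hw⟩ := exists_countable_hilbertBasis L2R
  -- Norm continuity of t ↦ A_t keeps ‖A_t‖ ≤ ρ < 1 in a neighbourhood of s, so all the constants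
  -- above are uniform there.
  obtain ⟨ρ, hρs, hρ⟩ := exists_between h1
  have hT : ∀ᶠ t in 𝓝 s, ‖opA A t‖ ≤ ρ := by
    filter_upwards [(hA.hasDerivAt_opA hHS s).continuousAt.norm.eventually_lt_const hρs]
      with t ht using ht.le
  have hu : ∀ᶠ t in 𝓝 s, IsUnit (1 - opK A t) :=
    hT.mono fun t ht => isUnit_of_norm_opA_lt_one (ht.trans_lt hρ)
  have hC := hA.sum_norm_sq_opA_le hHS b
  have hD := hA.tendsto_det_one_sub_gramMatrix hHS b
  refine ⟨pos_of_tendsto_det b hρ hC hD hT.self_of_nhds,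
    hasDerivAt_log_of_tendsto_det (a := ketA A 0)
      (f := fun t => resolventK A t (ketA A 0 t)) b hρ (hA.hasDerivAt_inner_opA_opA hHS) hC hD
      (hA.continuous_ketA 0) hT (hu.mono fun t ht g => ?_)
      (hu.mono fun t ht => (hA.hasDerivAt_uFun hHS ht 0).continuousAt)⟩
  rw [hA.inner_opA_left (hHS t), ← inner_sub_right, sub_opK_resolventK ht]

end SmoothIntegrable

theorem mainTheorem8 (A : ℝ → ℝ) (hA : ContDiff ℝ (⊤ : ℕ∞) A)
    (hAint : ∀ p : ℕ, Integrable (iteratedDeriv p A))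
    (s : ℝ) (hHS : HilbertSchmidtKernel (hankelKernel A s)) (hK : opK A s ≤ 1) :
    ((∃ t < s, opK A t ≤ 1) → IsUnit (1 - opK A s)) ∧
    (IsUnit (1 - opK A s) →
      SolvesZakharovShabatRHP (reflection A) s (explicitX A s) ∧
      HasLaurentExpansion (explicitX A s) (laurentCoeff A s) ∧
      0 < fredholmDet (squareKernel A s) ∧
      HasDerivAt (fun t => Real.log (fredholmDet (squareKernel A t))) (uFun A 0 s) s ∧
      (∀ p : ℕ, HasDerivAt (qFun A p) (qFun A (p + 1) s - qFun A 0 s * uFun A p s) s) ∧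
      (∀ p : ℕ, HasDerivAt (uFun A p) (-(qFun A 0 s * qFun A p s)) s)) := by
  have h : SmoothIntegrable A := ⟨hA, hAint⟩
  have hHS' := h.hilbertSchmidt_of hHS
  refine ⟨fun ⟨t, hts, ht⟩ => h.isUnit_one_sub_opK hHS' hts ht, fun hu => ?_⟩
  -- In the second part K_s ≤ I enters only here, where with invertibility it gives ‖A_s‖ < 1.
  obtain ⟨hpos, hlog⟩ := h.fredholmDet_pos_and_hasDerivAt_log hHS' (h.norm_opA_lt_one hHS hK hu)
  exact ⟨h.solvesRHP_explicitX hHS hu, h.hasLaurentExpansion_explicitX hHS hu, hpos, hlog,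
    h.hasDerivAt_qFun hHS' hu, h.hasDerivAt_uFun hHS' hu⟩
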